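/- **Model.** Consider the unit-cost random access machine: a program is a finite deterministic program over integer registers and integer-indexed arrays of integers, all initially $0$ except for the input, built from constants, register and array accesses with computed addresses, the operations $+,-,\times$, integer quotient and remainder, the comparisons $<,=$, assignments, sequencing, conditionals and while-loops; every such elementary operation, access, assignment and test costs one step. **Problem.** For integer strings $P$ (the pattern) of length $m$ and $T$ (the text) of length $n$, with $1\le m\le n$, and for $0\le i\le n-m$, let $$d(i)=\min_{\alpha\in\mathbb Q}\bigl|\{\,j\in\{0,\dots,m-1\} : \alpha+P[j]\ne T[i+j]\,\}\bigr|$$ be the shift-normalised Hamming distance at alignment $i$. The shift-normalised $k$-mismatch problem asks, given $P$, $T$ and an integer $k\ge 0$, to output $\min(d(i),k+1)$ for every $i\in\{0,\dots,n-m\}$. **Theorem.** The shift-normalised $k$-mismatch problem can be solved deterministically in $O(nk\log k)$ time, where the bound is read as $O(n)$ for $k\in\{0,1\}$. That is, there are a single program of the above kind and a constant $C$ such that for all integer strings $P,T$ with $1\le m\le n$ and all $k\ge 0$ the program, given $P,T,m,n,k$, halts after at most $C\,n\max(1,k\log_2 k)$ steps having written $\min(d(i),k+1)$ to cell $i$ of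 its output array for every $0\le i\le n-m$. Moreover, words of $O(\log(n+k+U))$ bits suffice: if all characters of $P$ and $T$ have absolute value at most $U$, then all numbers and addresses handled by the program have absolute value at most $(n+k+U+2)^C$. -/

import Mathlib

/-! ### Deterministic random access machine with unit costs

A machine has integer registers `0, 1, 2, …` and integer arrays `0, 1, 2, …` (random access memory
blocks).  A program is a finite piece of syntax, so it mentions only finitely many registers and
arrays.  Every operation, register access, memory access and branch costs one step. -/

namespace RAM

/-- Machine operations.  Comparisons return `1` (true) or `0` (false). -/
inductive Op where
  | plus | minus | times | div | mod | lt | eq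

def Op.eval : Op → ℤ → ℤ → ℤ
  | .plus, a, b => a + b
  | .minus, a, b => a - b
  | .times, a, b => a * b
  | .div, a, b => a / b
  | .mod, a, b => a % b
  | .lt, a, b => if a < b then 1 else 0
  | .eq, a, b => if a = b then 1 else 0

/-- The contents of the registers and of the arrays. -/
structure State where
  reg : ℕ → ℤ
  arr : ℕ → ℤ → ℤ

/-- Write `v` into register `x`. -/
def State.setReg (s : State) (x : ℕ) (v : ℤ) : State :=
  { s with reg := Function.update s.reg x v }

/-- Write `v` into cell `p` of array `a`. -/
def State.setArr (s : State) (a : ℕ) (p v : ℤ) : State :=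
  { s with arr := Function.update s.arr a (Function.update (s.arr a) p v) }

/-- Expressions: a constant, a register, the cell of array `a` at a computed address, or an
operation applied to two expressions. -/
inductive Expr where
  | const (c : ℤ)
  | reg (x : ℕ)
  | cell (a : ℕ) (p : Expr)
  | op (o : Op) (e₁ e₂ : Expr)

def Expr.eval (s : State) : Expr → ℤ
  | .const c => c
  | .reg x => s.reg x
  | .cell a p => s.arr a (p.eval s)
  | .op o e₁ e₂ => o.eval (e₁.eval s) (e₂.eval s)

/-- The number of steps needed to evaluate an expression: one per node. -/
def Expr.cost : Expr → ℕ
  | .const _ => 1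
  | .reg _ => 1
  | .cell _ p => p.cost + 1
  | .op _ e₁ e₂ => e₁.cost + e₂.cost + 1

/-- All values (in particular all addresses) that occur during the evaluation of an expression
have absolute value at most `W`. -/
def Expr.Fits (W : ℕ) (s : State) : Expr → Prop
  | .const c => |c| ≤ (W : ℤ)
  | .reg x => |s.reg x| ≤ (W : ℤ)
  | .cell a p => p.Fits W s ∧ |s.arr a (p.eval s)| ≤ (W : ℤ)
  | .op o e₁ e₂ => e₁.Fits W s ∧ e₂.Fits W s ∧ |o.eval (e₁.eval s) (e₂.eval s)| ≤ (W : ℤ)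

/-- Programs. In `cond` and `loop` the test succeeds when its value is nonzero. -/
inductive Program where
  | skip
  | assign (x : ℕ) (e : Expr)
  | store (a : ℕ) (p e : Expr)
  | seq (c₁ c₂ : Program)
  | cond (b : Expr) (c₁ c₂ : Program)
  | loop (b : Expr) (c : Program)

/-- `Runs W c s t s'`: started in state `s`, the program `c` halts in state `s'` after exactly `t`
steps, and every number it handles on the way has absolute value at most `W`. -/
inductive Runs (W : ℕ) : Program → State → ℕ → State → Prop where
  | skip (s : State) : Runs W .skip s 1 s
  | assign (s : State) (x : ℕ) (e : Expr) (he : e.Fits W s) :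
      Runs W (.assign x e) s (e.cost + 1) (s.setReg x (e.eval s))
  | store (s : State) (a : ℕ) (p e : Expr) (hp : p.Fits W s) (he : e.Fits W s) :
      Runs W (.store a p e) s (p.cost + e.cost + 1) (s.setArr a (p.eval s) (e.eval s))
  | seq {c₁ c₂ : Program} {s s₁ s₂ : State} {t₁ t₂ : ℕ}
      (h₁ : Runs W c₁ s t₁ s₁) (h₂ : Runs W c₂ s₁ t₂ s₂) :
      Runs W (.seq c₁ c₂) s (t₁ + t₂) s₂
  | condTrue {b : Expr} {c₁ c₂ : Program} {s s' : State} {t : ℕ}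
      (hb : b.Fits W s) (h : b.eval s ≠ 0) (h₁ : Runs W c₁ s t s') :
      Runs W (.cond b c₁ c₂) s (b.cost + 1 + t) s'
  | condFalse {b : Expr} {c₁ c₂ : Program} {s s' : State} {t : ℕ}
      (hb : b.Fits W s) (h : b.eval s = 0) (h₂ : Runs W c₂ s t s') :
      Runs W (.cond b c₁ c₂) s (b.cost + 1 + t) s'
  | loopTrue {b : Expr} {c : Program} {s s₁ s₂ : State} {t₁ t₂ : ℕ}
      (hb : b.Fits W s) (h : b.eval s ≠ 0) (h₁ : Runs W c s t₁ s₁)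
      (h₂ : Runs W (.loop b c) s₁ t₂ s₂) :
      Runs W (.loop b c) s (b.cost + 1 + t₁ + t₂) s₂
  | loopFalse {b : Expr} {c : Program} {s : State}
      (hb : b.Fits W s) (h : b.eval s = 0) :
      Runs W (.loop b c) s (b.cost + 1) s

/-- The array whose cells `0, …, S.length - 1` hold the string `S`; all other cells are `0`. -/
def ofString (S : List ℤ) (p : ℤ) : ℤ :=
  if 0 ≤ p then S.getD p.toNat 0 else 0

/-- The initial state: pattern in array `0`, text in array `1`, the numbers `m`, `n`, `k` in
registers `0`, `1`, `2`; all other cells and registers are `0`. -/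
def initial (P T : List ℤ) (k : ℕ) : State where
  reg x := if x = 0 then (P.length : ℤ) else if x = 1 then (T.length : ℤ)
    else if x = 2 then (k : ℤ) else 0
  arr a := if a = 0 then ofString P else if a = 1 then ofString T else fun _ => 0

end RAM

/-- The shift-normalised Hamming distance `d(i) = min_α |{j : α + P[j] ≠ T[i + j]}|` between the
pattern `P` and the text `T` at alignment `i` (meant for `i + P.length ≤ T.length`). -/
noncomputable def shiftHam (P T : List ℤ) (i : ℕ) : ℕ :=
  ⨅ α : ℚ, ((Finset.range P.length).filter
    (fun j => α + (P.getD j 0 : ℚ) ≠ (T.getD (i + j) 0 : ℚ))).card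

/-- The shift-normalised `k`-mismatch value `min(d(i), k + 1)`. -/
noncomputable def shiftMismatch (k : ℕ) (P T : List ℤ) (i : ℕ) : ℕ :=
  min (shiftHam P T i) (k + 1)

set_option linter.unusedSimpArgs false

/-! ### A program logic with a clock -/

namespace RAM

/-! Fix an alignment `i` and call `T[i+j] - P[j]` the offset at `j`. All offsets are integers, so
`d(i)` is `m` minus the largest multiplicity of an offset, and rational shifts bring nothing new
(`IsDistance.eq_shiftMismatch`). It suffices to walk through the maximal runs of equal offsets and
to add up, for every offset, the lengths of its runs. If a constant misses `t` of the offsets, then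
every place where the offset changes has a missed position on one of its two sides, and a missed
position is next to at most two changes; so there are at most `2t` changes (`changes_le`). Hence if
positions are left over after `2k+1` runs, then `d(i) > k` and the answer is `k+1`; otherwise all
runs have been seen and the counts are exact (`alignmentDistance_spec`).

Each run is found in constant time. Consecutive offsets agree exactly when the consecutive
differences of text and pattern agree (`offset_add_one`), so the length of a run is one more than a
longest common prefix of two suffixes of the string of differences, cut off at the end of the
pattern. Such queries are answered after linear preprocessing. Differences receive small names by
direct addressing. The suffixes are ranked by the skew recursion: those at positions not divisible
by three are ranked through a string of about two thirds of the length, the others are sorted by one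
character and a known rank, and the two lists are merged. Common prefixes of neighbours in suffix
order are found by carrying the match length from one position to the next, and those of arbitrary
suffixes are range minima (`IsRank.isLcp_of_rangeMin`). Range minima use blocks of logarithmic
length: inside a block a bit mask of the suffix minima decides, between blocks a table of minima of
runs of `2 ^ e` blocks.

The counter for offset `α` at alignment `i` is cell `α * Z + i` with `Z > n`. Different pairs use
different cells, so no counter is ever cleared and nothing is sorted. The total time is `O(n (k +
1))`, which is at most the claimed bound; the logarithmic factor is only needed to state it.

Time and word length are handled by a program logic. `wp` carries a clock, which also supplies the
termination of loops. `Exec` controls only the values that are stored; the program has expressions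
of bounded cost, so intermediate values and addresses are polynomial in the bound on stored values
(`Exec.runs`). -/

instance : Add Expr := ⟨Expr.op Op.plus⟩
instance : Sub Expr := ⟨Expr.op Op.minus⟩
instance : Mul Expr := ⟨Expr.op Op.times⟩
instance : Div Expr := ⟨Expr.op Op.div⟩
instance : Mod Expr := ⟨Expr.op Op.mod⟩
instance (n : ℕ) : OfNat Expr n := ⟨Expr.const n⟩

/-- The test `e₁ < e₂`. -/
def Expr.less (e₁ e₂ : Expr) : Expr := Expr.op Op.lt e₁ e₂
/-- The test `e₁ = e₂`. -/
def Expr.equal (e₁ e₂ : Expr) : Expr := Expr.op Op.eq e₁ e₂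

section
variable (s : State) (a b : Expr)

@[simp] theorem Expr.eval_const (c : ℤ) : (Expr.const c).eval s = c := rfl
@[simp] theorem Expr.eval_reg (x : ℕ) : (Expr.reg x).eval s = s.reg x := rfl
@[simp] theorem Expr.eval_cell (x : ℕ) : (Expr.cell x a).eval s = s.arr x (a.eval s) := rfl
@[simp] theorem Expr.eval_add : (a + b).eval s = a.eval s + b.eval s := rfl
@[simp] theorem Expr.eval_sub : (a - b).eval s = a.eval s - b.eval s := rfl
@[simp] theorem Expr.eval_mul : (a * b).eval s = a.eval s * b.eval s := rfl
@[simp] theorem Expr.eval_div : (a / b).eval s = a.eval s / b.eval s := rfl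
@[simp] theorem Expr.eval_mod : (a % b).eval s = a.eval s % b.eval s := rfl
@[simp] theorem Expr.eval_less :
    (a.less b).eval s = if a.eval s < b.eval s then 1 else 0 := rfl
@[simp] theorem Expr.eval_equal :
    (a.equal b).eval s = if a.eval s = b.eval s then 1 else 0 := rfl
@[simp] theorem Expr.eval_zero : (0 : Expr).eval s = 0 := rfl
@[simp] theorem Expr.eval_one : (1 : Expr).eval s = 1 := rfl
@[simp] theorem Expr.eval_ofNat (n : ℕ) [n.AtLeastTwo] :
    (ofNat(n) : Expr).eval s = (ofNat(n) : ℤ) := rfl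

@[simp] theorem Expr.cost_const (c : ℤ) : (Expr.const c).cost = 1 := rfl
@[simp] theorem Expr.cost_reg (x : ℕ) : (Expr.reg x).cost = 1 := rfl
@[simp] theorem Expr.cost_cell (x : ℕ) : (Expr.cell x a).cost = a.cost + 1 := rfl
@[simp] theorem Expr.cost_add : (a + b).cost = a.cost + b.cost + 1 := rfl
@[simp] theorem Expr.cost_sub : (a - b).cost = a.cost + b.cost + 1 := rfl
@[simp] theorem Expr.cost_mul : (a * b).cost = a.cost + b.cost + 1 := rfl
@[simp] theorem Expr.cost_div : (a / b).cost = a.cost + b.cost + 1 := rfl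
@[simp] theorem Expr.cost_mod : (a % b).cost = a.cost + b.cost + 1 := rfl
@[simp] theorem Expr.cost_less : (a.less b).cost = a.cost + b.cost + 1 := rfl
@[simp] theorem Expr.cost_equal : (a.equal b).cost = a.cost + b.cost + 1 := rfl
@[simp] theorem Expr.cost_zero : (0 : Expr).cost = 1 := rfl
@[simp] theorem Expr.cost_one : (1 : Expr).cost = 1 := rfl
@[simp] theorem Expr.cost_ofNat (n : ℕ) [n.AtLeastTwo] : (ofNat(n) : Expr).cost = 1 := rfl

@[simp] theorem State.reg_setReg (x y : ℕ) (v : ℤ) :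
    (s.setReg x v).reg y = if y = x then v else s.reg y := by
  simp [State.setReg, Function.update_apply]
@[simp] theorem State.arr_setReg (x : ℕ) (v : ℤ) : (s.setReg x v).arr = s.arr := rfl
@[simp] theorem State.reg_setArr (x : ℕ) (p v : ℤ) : (s.setArr x p v).reg = s.reg := rfl
@[simp] theorem State.arr_setArr (x y : ℕ) (p v : ℤ) :
    (s.setArr x p v).arr y = if y = x then Function.update (s.arr x) p v else s.arr y := by
  simp only [State.setArr, Function.update_apply]
end

theorem flag_ne_zero {p : Prop} [Decidable p] : (if p then (1 : ℤ) else 0) ≠ 0 ↔ p := by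
  split_ifs <;> simp_all

theorem flag_eq_zero {p : Prop} [Decidable p] : (if p then (1 : ℤ) else 0) = 0 ↔ ¬p := by
  split_ifs <;> simp_all

theorem Expr.one_le_cost (e : Expr) : 1 ≤ e.cost := by
  cases e <;> simp [Expr.cost]

/-- The registers that a program may change. -/
def Program.regs : Program → List ℕ
  | .skip => []
  | .assign x _ => [x]
  | .store _ _ _ => []
  | .seq c₁ c₂ => c₁.regs ++ c₂.regs
  | .cond _ c₁ c₂ => c₁.regs ++ c₂.regs
  | .loop _ c => c.regs

/-- The arrays that a program may change. -/
def Program.arrs : Program → List ℕ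
  | .skip => []
  | .assign _ _ => []
  | .store a _ _ => [a]
  | .seq c₁ c₂ => c₁.arrs ++ c₂.arrs
  | .cond _ c₁ c₂ => c₁.arrs ++ c₂.arrs
  | .loop _ c => c.arrs

/-- The largest cost of an expression in a program. -/
def Program.width : Program → ℕ
  | .skip => 1
  | .assign _ e => e.cost
  | .store _ p e => max p.cost e.cost
  | .seq c₁ c₂ => max c₁.width c₂.width
  | .cond b c₁ c₂ => max b.cost (max c₁.width c₂.width)
  | .loop b c => max b.cost c.width

/-- All constants in an expression have absolute value at most `B`. -/
def Expr.ConstLe (B : ℤ) : Expr → Prop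
  | .const c => |c| ≤ B
  | .reg _ => True
  | .cell _ p => p.ConstLe B
  | .op _ e₁ e₂ => e₁.ConstLe B ∧ e₂.ConstLe B

/-- All constants in a program have absolute value at most `B`. -/
def Program.ConstLe (B : ℤ) : Program → Prop
  | .skip => True
  | .assign _ e => e.ConstLe B
  | .store _ p e => p.ConstLe B ∧ e.ConstLe B
  | .seq c₁ c₂ => c₁.ConstLe B ∧ c₂.ConstLe B
  | .cond b c₁ c₂ => b.ConstLe B ∧ c₁.ConstLe B ∧ c₂.ConstLe B
  | .loop b c => b.ConstLe B ∧ c.ConstLe B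

/-- Executions in which every value written into a register or an array lies in `[-B, B]`. -/
inductive Exec (B : ℤ) : Program → State → ℕ → State → Prop where
  | skip (s : State) : Exec B .skip s 1 s
  | assign (s : State) (x : ℕ) (e : Expr) (h : -B ≤ e.eval s ∧ e.eval s ≤ B) :
      Exec B (.assign x e) s (e.cost + 1) (s.setReg x (e.eval s))
  | store (s : State) (a : ℕ) (p e : Expr) (h : -B ≤ e.eval s ∧ e.eval s ≤ B) :
      Exec B (.store a p e) s (p.cost + e.cost + 1) (s.setArr a (p.eval s) (e.eval s))
  | seq {c₁ c₂ : Program} {s s₁ s₂ : State} {t₁ t₂ : ℕ}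
      (h₁ : Exec B c₁ s t₁ s₁) (h₂ : Exec B c₂ s₁ t₂ s₂) :
      Exec B (.seq c₁ c₂) s (t₁ + t₂) s₂
  | condTrue {b : Expr} {c₁ c₂ : Program} {s s' : State} {t : ℕ}
      (h : b.eval s ≠ 0) (h₁ : Exec B c₁ s t s') :
      Exec B (.cond b c₁ c₂) s (b.cost + 1 + t) s'
  | condFalse {b : Expr} {c₁ c₂ : Program} {s s' : State} {t : ℕ}
      (h : b.eval s = 0) (h₂ : Exec B c₂ s t s') :
      Exec B (.cond b c₁ c₂) s (b.cost + 1 + t) s'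
  | loopTrue {b : Expr} {c : Program} {s s₁ s₂ : State} {t₁ t₂ : ℕ}
      (h : b.eval s ≠ 0) (h₁ : Exec B c s t₁ s₁)
      (h₂ : Exec B (.loop b c) s₁ t₂ s₂) :
      Exec B (.loop b c) s (b.cost + 1 + t₁ + t₂) s₂
  | loopFalse {b : Expr} {c : Program} {s : State} (h : b.eval s = 0) :
      Exec B (.loop b c) s (b.cost + 1) s

/-- Every register and every array cell lies in `[-B, B]`. -/
def State.Bounded (B : ℤ) (s : State) : Prop :=
  (∀ x, |s.reg x| ≤ B) ∧ ∀ a p, |s.arr a p| ≤ B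

/-- For bounds that are at least `2` the product dominates the sum, so one bound `A * C` serves all
operations. A remainder by zero returns the dividend, hence the separate case. -/
theorem Op.abs_eval_le (o : Op) {a b A C : ℤ} (hA : 2 ≤ A) (hC : 2 ≤ C) (ha : |a| ≤ A)
    (hb : |b| ≤ C) : |o.eval a b| ≤ A * C := by
  have h1 : A + C ≤ A * C := by nlinarith
  have h2 : |a| + |b| ≤ A * C := by linarith
  cases o
  · exact (abs_add_le a b).trans h2
  · exact (abs_sub a b).trans h2
  · rw [Op.eval, abs_mul]; exact mul_le_mul ha hb (abs_nonneg _) (by linarith)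
  · have : |a / b| ≤ |a| := Int.abs_ediv_le_abs a b
    have := abs_nonneg b
    simp only [Op.eval]; linarith
  · simp only [Op.eval]
    rcases eq_or_ne b 0 with rfl | hb0
    · simp only [Int.emod_zero]; have := abs_nonneg a; linarith
    · have h3 := Int.emod_nonneg a hb0
      have h4 := Int.emod_lt_abs a hb0
      rw [abs_of_nonneg h3]
      have := abs_nonneg a
      linarith
  · simp only [Op.eval]; split_ifs <;> norm_num <;> linarith
  · simp only [Op.eval]; split_ifs <;> norm_num <;> linarith

/-- An operation at most multiplies the bounds of its operands, so the exponents add up to the cost.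
A cell is bounded by `B` however large its address is. -/
theorem Expr.abs_eval_le {B : ℤ} (hB : 2 ≤ B) {s : State} (hs : s.Bounded B) (e : Expr)
    (he : e.ConstLe B) : |e.eval s| ≤ B ^ e.cost := by
  have hp : ∀ c : ℕ, 1 ≤ c → B ≤ B ^ c := fun c hc => by
    calc B = B ^ 1 := (pow_one B).symm
      _ ≤ B ^ c := pow_le_pow_right₀ (by linarith) hc
  induction e with
  | const c => simpa [Expr.cost, Expr.ConstLe] using he
  | reg x => simpa using hs.1 x
  | cell a p ih => exact (hs.2 _ _).trans (hp _ (Expr.one_le_cost _))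
  | op o e₁ e₂ ih₁ ih₂ =>
    have h1 := hp _ e₁.one_le_cost
    have h2 := hp _ e₂.one_le_cost
    have := o.abs_eval_le (by linarith) (by linarith) (ih₁ he.1) (ih₂ he.2)
    refine this.trans ?_
    rw [← pow_add]
    exact pow_le_pow_right₀ (by linarith) (by simp [Expr.cost])

theorem Expr.fits_of_bounded {B : ℤ} (hB : 2 ≤ B) {s : State} (hs : s.Bounded B) (e : Expr)
    (he : e.ConstLe B) {W : ℕ} (hW : B ^ e.cost ≤ W) : e.Fits W s := by
  have hp : ∀ c d : ℕ, c ≤ d → B ^ c ≤ B ^ d := fun c d h =>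
    pow_le_pow_right₀ (by linarith) h
  induction e with
  | const c => exact (Expr.abs_eval_le hB hs _ he).trans hW
  | reg x => exact (Expr.abs_eval_le hB hs (Expr.reg x) he).trans hW
  | cell a p ih =>
    exact ⟨ih he ((hp _ _ (by simp [Expr.cost])).trans hW),
      (Expr.abs_eval_le hB hs (Expr.cell a p) he).trans hW⟩
  | op o e₁ e₂ ih₁ ih₂ =>
    exact ⟨ih₁ he.1 ((hp _ _ (by simp only [Expr.cost]; omega)).trans hW),
      ih₂ he.2 ((hp _ _ (by simp only [Expr.cost]; omega)).trans hW),
      (Expr.abs_eval_le hB hs (Expr.op o e₁ e₂) he).trans hW⟩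

/-- Stored values in `[-B, B]` are enough to control everything: an expression of cost at most `E`
over such values stays below `B ^ E`. Boundedness of the state is the invariant of the induction. -/
theorem Exec.runs {B : ℤ} (hB : 2 ≤ B) {W E : ℕ} (hW : B ^ E ≤ W) {c : Program} {s s' : State}
    {t : ℕ} (h : Exec B c s t s') (hs : s.Bounded B) (hc : c.ConstLe B) (hE : c.width ≤ E) :
    Runs W c s t s' ∧ s'.Bounded B := by
  have fits : ∀ {s : State} (e : Expr), s.Bounded B → e.ConstLe B → e.cost ≤ E → e.Fits W s :=
    fun e hs he hE => Expr.fits_of_bounded hB hs e he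
      ((pow_le_pow_right₀ (by linarith) hE).trans hW)
  induction h with
  | skip s => exact ⟨Runs.skip s, hs⟩
  | assign s x e h =>
    refine ⟨Runs.assign s x e (fits e hs hc hE), fun y => ?_, hs.2⟩
    rw [State.reg_setReg]
    split_ifs
    · exact abs_le.2 h
    · exact hs.1 y
  | store s a p e h =>
    refine ⟨Runs.store s a p e (fits p hs hc.1 (le_of_max_le_left hE))
      (fits e hs hc.2 (le_of_max_le_right hE)), hs.1, fun b q => ?_⟩
    rw [State.arr_setArr]
    split_ifs
    · rw [Function.update_apply]
      split_ifs
      · exact abs_le.2 h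
      · exact hs.2 a q
    · exact hs.2 b q
  | seq h₁ h₂ ih₁ ih₂ =>
    have r₁ := ih₁ hs hc.1 (le_of_max_le_left hE)
    have r₂ := ih₂ r₁.2 hc.2 (le_of_max_le_right hE)
    exact ⟨Runs.seq r₁.1 r₂.1, r₂.2⟩
  | condTrue h h₁ ih =>
    have r := ih hs hc.2.1 (le_of_max_le_left (le_of_max_le_right hE))
    exact ⟨Runs.condTrue (fits _ hs hc.1 (le_of_max_le_left hE)) h r.1, r.2⟩
  | condFalse h h₁ ih =>
    have r := ih hs hc.2.2 (le_of_max_le_right (le_of_max_le_right hE))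
    exact ⟨Runs.condFalse (fits _ hs hc.1 (le_of_max_le_left hE)) h r.1, r.2⟩
  | loopTrue h h₁ h₂ ih₁ ih₂ =>
    have r₁ := ih₁ hs hc.2 (le_of_max_le_right hE)
    have r₂ := ih₂ r₁.2 hc hE
    exact ⟨Runs.loopTrue (fits _ hs hc.1 (le_of_max_le_left hE)) h r₁.1 r₂.1, r₂.2⟩
  | loopFalse h => exact ⟨Runs.loopFalse (fits _ hs hc.1 (le_of_max_le_left hE)) h, hs⟩

/-- `s'` differs from `s` only in registers and arrays that `c` may change. -/
def Frame (c : Program) (s s' : State) : Prop :=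
  (∀ x, x ∉ c.regs → s'.reg x = s.reg x) ∧ ∀ a, a ∉ c.arrs → s'.arr a = s.arr a

theorem Frame.refl (c : Program) (s : State) : Frame c s s := ⟨fun _ _ => rfl, fun _ _ => rfl⟩

theorem Frame.trans {c : Program} {s₁ s₂ s₃ : State} (h : Frame c s₁ s₂) (h' : Frame c s₂ s₃) :
    Frame c s₁ s₃ :=
  ⟨fun x hx => (h'.1 x hx).trans (h.1 x hx), fun a ha => (h'.2 a ha).trans (h.2 a ha)⟩

theorem Frame.mono {c d : Program} {s₁ s₂ : State} (h : Frame c s₁ s₂)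
    (hr : c.regs ⊆ d.regs) (ha : c.arrs ⊆ d.arrs) : Frame d s₁ s₂ :=
  ⟨fun x hx => h.1 x fun h' => hx (hr h'), fun a hx => h.2 a fun h' => hx (ha h')⟩

theorem Exec.frame {B : ℤ} {c : Program} {s s' : State} {t : ℕ} (h : Exec B c s t s') :
    Frame c s s' := by
  induction h with
  | skip s => exact Frame.refl _ _
  | assign s x e h =>
    refine ⟨fun y hy => ?_, fun _ _ => rfl⟩
    simp only [Program.regs, List.mem_singleton] at hy
    simp [hy]
  | store s a p e h =>
    refine ⟨fun _ _ => rfl, fun b hb => ?_⟩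
    simp only [Program.arrs, List.mem_singleton] at hb
    simp [hb]
  | seq h₁ h₂ ih₁ ih₂ =>
    exact (ih₁.mono (List.subset_append_left _ _) (List.subset_append_left _ _)).trans
      (ih₂.mono (List.subset_append_right _ _) (List.subset_append_right _ _))
  | condTrue h h₁ ih =>
    exact ih.mono (List.subset_append_left _ _) (List.subset_append_left _ _)
  | condFalse h h₁ ih =>
    exact ih.mono (List.subset_append_right _ _) (List.subset_append_right _ _)
  | loopTrue h h₁ h₂ ih₁ ih₂ => exact Frame.trans ⟨ih₁.1, ih₁.2⟩ ih₂
  | loopFalse h => exact Frame.refl _ _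

/-! ### Preconditions with a clock and the rules for loops -/

/-- Started in state `s` at time `τ`, the program `c` halts, writing only values in `[-B, B]`, in
a state and at a time that satisfy `Q`. -/
def wp (B : ℤ) (c : Program) (s : State) (τ : ℤ) (Q : State → ℤ → Prop) : Prop :=
  ∃ (t : ℕ) (s' : State), Exec B c s t s' ∧ Q s' (τ + t)

section
variable {B : ℤ} {s : State} {τ : ℤ} {Q : State → ℤ → Prop}

/-- Executions are directed by the syntax, so the rules for assignments, sequences and branches are
equivalences; rewriting with them turns a program into arithmetic conditions. -/
theorem wp_skip : wp B .skip s τ Q ↔ Q s (τ + 1) := by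
  constructor
  · rintro ⟨t, s', h, hQ⟩; cases h; simpa using hQ
  · intro h; exact ⟨1, s, Exec.skip s, by simpa using h⟩

theorem wp_assign {x : ℕ} {e : Expr} : wp B (.assign x e) s τ Q ↔
    (-B ≤ e.eval s ∧ e.eval s ≤ B) ∧ Q (s.setReg x (e.eval s)) (τ + ((e.cost : ℤ) + 1)) := by
  constructor
  · rintro ⟨t, s', h, hQ⟩; cases h with | assign _ _ _ h => exact ⟨h, by simpa using hQ⟩
  · rintro ⟨h, hQ⟩; exact ⟨_, _, Exec.assign s x e h, by simpa using hQ⟩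

theorem wp_store {a : ℕ} {p e : Expr} : wp B (.store a p e) s τ Q ↔
    (-B ≤ e.eval s ∧ e.eval s ≤ B) ∧
      Q (s.setArr a (p.eval s) (e.eval s)) (τ + ((p.cost : ℤ) + e.cost + 1)) := by
  constructor
  · rintro ⟨t, s', h, hQ⟩; cases h with | store _ _ _ _ h => exact ⟨h, by simpa using hQ⟩
  · rintro ⟨h, hQ⟩; exact ⟨_, _, Exec.store s a p e h, by simpa using hQ⟩

theorem wp_seq {c₁ c₂ : Program} :
    wp B (.seq c₁ c₂) s τ Q ↔ wp B c₁ s τ (fun s₁ τ₁ => wp B c₂ s₁ τ₁ Q) := by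
  constructor
  · rintro ⟨t, s', h, hQ⟩
    cases h with
    | seq h₁ h₂ =>
      refine ⟨_, _, h₁, _, _, h₂, ?_⟩
      push_cast at hQ
      rwa [add_assoc]
  · rintro ⟨t₁, s₁, h₁, t₂, s₂, h₂, hQ⟩
    refine ⟨_, _, Exec.seq h₁ h₂, ?_⟩
    push_cast
    rwa [← add_assoc]

theorem wp_cond {b : Expr} {c₁ c₂ : Program} : wp B (.cond b c₁ c₂) s τ Q ↔
    (b.eval s ≠ 0 → wp B c₁ s (τ + ((b.cost : ℤ) + 1)) Q) ∧
      (b.eval s = 0 → wp B c₂ s (τ + ((b.cost : ℤ) + 1)) Q) := by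
  constructor
  · rintro ⟨t, s', h, hQ⟩
    cases h with
    | condTrue hb h =>
      exact ⟨fun _ => ⟨_, _, h, by push_cast at hQ; rwa [add_assoc]⟩, fun h => absurd h hb⟩
    | condFalse hb h =>
      exact ⟨fun h => absurd hb h, fun _ => ⟨_, _, h, by push_cast at hQ; rwa [add_assoc]⟩⟩
  · rintro ⟨h₁, h₂⟩
    by_cases hb : b.eval s = 0
    · obtain ⟨t, s', h, hQ⟩ := h₂ hb
      exact ⟨_, _, Exec.condFalse hb h, by push_cast; rwa [← add_assoc]⟩
    · obtain ⟨t, s', h, hQ⟩ := h₁ hb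
      exact ⟨_, _, Exec.condTrue hb h, by push_cast; rwa [← add_assoc]⟩

/-- The rule of consequence together with the frame: specifications mention only what changes, and
the caller recovers everything else from `Frame`. -/
theorem wp_frame_mono {c : Program} {Q' : State → ℤ → Prop} (h : wp B c s τ Q)
    (hQ : ∀ s' τ', Frame c s s' → Q s' τ' → Q' s' τ') : wp B c s τ Q' := by
  obtain ⟨t, s', h, hq⟩ := h
  exact ⟨t, s', h, hQ _ _ h.frame hq⟩

/-- The rule for loops. The clock bounds the number of iterations. -/
theorem wp_loop {b : Expr} {c : Program} (I : State → ℤ → Prop) (T : ℤ) (h0 : I s τ)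
    (hT : ∀ s' τ', I s' τ' → τ' ≤ T)
    (hstep : ∀ s' τ', Frame c s s' → I s' τ' → b.eval s' ≠ 0 →
      wp B c s' (τ' + ((b.cost : ℤ) + 1)) I)
    (hQ : ∀ s' τ', Frame c s s' → I s' τ' → b.eval s' = 0 → Q s' (τ' + ((b.cost : ℤ) + 1))) :
    wp B (.loop b c) s τ Q := by
  -- The remaining time `T - τ'` is the variant. Every test costs at least one step, so an invariant
  -- that caps the clock already forces termination.
  suffices H : ∀ (n : ℕ) (s' : State) (τ' : ℤ), T - τ' ≤ n → Frame c s s' → I s' τ' →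
      wp B (.loop b c) s' τ' Q from H (T - τ).toNat s τ (by omega) (Frame.refl _ _) h0
  intro n
  induction n with
  | zero =>
    intro s' τ' hn hf hI
    by_cases hb : b.eval s' = 0
    · exact ⟨_, _, Exec.loopFalse hb, by push_cast; exact hQ _ _ hf hI hb⟩
    · obtain ⟨t, s₁, h, hI₁⟩ := hstep _ _ hf hI hb
      have := hT _ _ hI₁
      push_cast at hn
      omega
  | succ n ih =>
    intro s' τ' hn hf hI
    by_cases hb : b.eval s' = 0
    · exact ⟨_, _, Exec.loopFalse hb, by push_cast; exact hQ _ _ hf hI hb⟩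
    · obtain ⟨t, s₁, h, hI₁⟩ := hstep _ _ hf hI hb
      obtain ⟨t₂, s₂, h₂, hq⟩ := ih s₁ _ (by push_cast at hn ⊢; omega) (hf.trans h.frame) hI₁
      refine ⟨_, _, Exec.loopTrue hb h h₂, ?_⟩
      push_cast
      convert hq using 1
      ring
end

/-- `for x := 0 to hi - 1 do c`. -/
def forLoop (x : ℕ) (hi : Expr) (c : Program) : Program :=
  .seq (.assign x 0) (.loop ((Expr.reg x).less hi) (.seq c (.assign x (.reg x + 1))))

/-- The clock pays `2` for the initialisation, `hi.cost + 3` for each test and `4` for each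
increment. The bound is evaluated anew in every round, so its value must survive all changes that
the loop may make. -/
theorem wp_for {B : ℤ} {s : State} {τ : ℤ} {Q : State → ℤ → Prop} {x : ℕ} {hi : Expr}
    {c : Program} (n : ℤ) (I : ℤ → State → ℤ → Prop) (hn : 0 ≤ n) (hnB : n ≤ B)
    (hx : x ∉ c.regs)
    (hhi : ∀ s', Frame (forLoop x hi c) s s' → hi.eval s' = n)
    (h0 : I 0 (s.setReg x 0) (τ + 2))
    (hstep : ∀ i s' τ', 0 ≤ i → i < n → s'.reg x = i → Frame (forLoop x hi c) s s' →
      I i s' τ' → wp B c s' (τ' + (hi.cost + 3))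
        (fun s'' τ'' => I (i + 1) (s''.setReg x (i + 1)) (τ'' + 4)))
    (hQ : ∀ s' τ', s'.reg x = n → Frame (forLoop x hi c) s s' → I n s' τ' →
      Q s' (τ' + (hi.cost + 3))) :
    wp B (forLoop x hi c) s τ Q := by
  have hfr : ∀ s' s'', Frame c s' s'' → Frame (forLoop x hi c) s' s'' := fun s' s'' h =>
    h.mono (by intro y hy; simp [forLoop, Program.regs, hy])
      (by intro y hy; simp [forLoop, Program.arrs, hy])
  have hset : ∀ s' v, Frame (forLoop x hi c) s' (s'.setReg x v) := fun s' v =>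
    ⟨fun y hy => by simp [forLoop, Program.regs] at hy; simp [hy.1], fun _ _ => rfl⟩
  suffices H : ∀ (k : ℕ) (s' : State) (τ' i : ℤ), n - i = k → 0 ≤ i → s'.reg x = i →
      Frame (forLoop x hi c) s s' → I i s' τ' →
      wp B (.loop ((Expr.reg x).less hi) (.seq c (.assign x (.reg x + 1)))) s' τ' Q by
    rw [forLoop, wp_seq, wp_assign]
    refine ⟨by simp; omega, ?_⟩
    exact H n.toNat _ _ 0 (by omega) le_rfl (by simp) (hset _ _) (by simpa using h0)
  intro k
  induction k with
  | zero =>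
    intro s' τ' i hk hi0 hxi hf hI
    have hb : ((Expr.reg x).less hi).eval s' = 0 := by
      simp only [Expr.eval_less, Expr.eval_reg, hhi s' hf]
      rw [if_neg]; push_cast at hk; omega
    have hin : i = n := by push_cast at hk; omega
    subst hin
    refine ⟨_, _, Exec.loopFalse hb, ?_⟩
    have := hQ s' τ' hxi hf hI
    convert this using 1
    push_cast [Expr.cost_less, Expr.cost_reg]; ring
  | succ k ih =>
    intro s' τ' i hk hi0 hxi hf hI
    have hin : i < n := by push_cast at hk; omega
    have hb : ((Expr.reg x).less hi).eval s' ≠ 0 := by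
      simp only [Expr.eval_less, Expr.eval_reg, hhi s' hf]
      rw [if_pos (by omega)]; norm_num
    obtain ⟨t, s₁, h, hI₁⟩ := hstep i s' τ' hi0 hin hxi hf hI
    have hx₁ : s₁.reg x = i := (h.frame.1 x hx).trans hxi
    have hf₁ := (hf.trans (hfr _ _ h.frame)).trans (hset s₁ (i + 1))
    obtain ⟨t₂, s₂, h₂, hq⟩ := ih _ _ (i + 1) (by push_cast at hk; omega) (by omega)
      (by simp) hf₁ hI₁
    have ha : Exec B (.assign x (.reg x + 1)) s₁ 4 (s₁.setReg x (i + 1)) := by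
      have := Exec.assign (B := B) s₁ x (.reg x + 1) (by simp [hx₁]; omega)
      simpa [hx₁] using this
    refine ⟨_, _, Exec.loopTrue hb (Exec.seq h ha) h₂, ?_⟩
    convert hq using 1
    push_cast [Expr.cost_less, Expr.cost_reg]; ring

end RAM

/-! ### Counting -/

open Classical in
/-- The number of `u ∈ [0, i)` with `p u`. -/
noncomputable def countBelow (p : ℤ → Prop) (i : ℤ) : ℤ := ((Finset.Ico 0 i).filter p).card

theorem countBelow_nonneg (p : ℤ → Prop) (i : ℤ) : 0 ≤ countBelow p i := by
  simp [countBelow]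

theorem countBelow_zero (p : ℤ → Prop) : countBelow p 0 = 0 := by
  simp [countBelow]

open Classical in
theorem countBelow_succ (p : ℤ → Prop) {i : ℤ} (hi : 0 ≤ i) :
    countBelow p (i + 1) = countBelow p i + if p i then 1 else 0 := by
  have : Finset.Ico 0 (i + 1) = insert i (Finset.Ico 0 i) := by
    ext x; simp; omega
  rw [countBelow, this, Finset.filter_insert, countBelow]
  split_ifs
  · rw [Finset.card_insert_of_notMem (by simp)]; push_cast; ring
  · simp

theorem countBelow_le (p : ℤ → Prop) {i : ℤ} (hi : 0 ≤ i) : countBelow p i ≤ i := by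
  classical
  have h := Finset.card_filter_le (Finset.Ico 0 i) p
  rw [Int.card_Ico] at h
  simp only [countBelow]
  have h' : (((Finset.Ico 0 i).filter p).card : ℤ) ≤ ((i - 0).toNat : ℤ) := Int.ofNat_le.2 h
  convert h'.trans (by omega : ((i - 0).toNat : ℤ) ≤ i)

theorem countBelow_mono {p q : ℤ → Prop} {i : ℤ} (h : ∀ u, 0 ≤ u → u < i → p u → q u) :
    countBelow p i ≤ countBelow q i := by
  classical
  simp only [countBelow, Nat.cast_le]
  refine Finset.card_le_card fun u hu => ?_
  simp only [Finset.mem_filter, Finset.mem_Ico] at hu ⊢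
  exact ⟨hu.1, h u hu.1.1 hu.1.2 hu.2⟩

theorem countBelow_lt {p q : ℤ → Prop} {i v : ℤ} (h : ∀ u, 0 ≤ u → u < i → p u → q u)
    (hv0 : 0 ≤ v) (hvi : v < i) (hp : ¬ p v) (hq : q v) : countBelow p i < countBelow q i := by
  classical
  simp only [countBelow, Nat.cast_lt]
  refine Finset.card_lt_card ⟨fun u hu => ?_, fun hs => ?_⟩
  · simp only [Finset.mem_filter, Finset.mem_Ico] at hu ⊢
    exact ⟨hu.1, h u hu.1.1 hu.1.2 hu.2⟩
  · have : v ∈ (Finset.Ico 0 i).filter q := by simp [hv0, hvi, hq]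
    have := hs this
    simp [hp] at this

theorem countBelow_congr {p q : ℤ → Prop} {i : ℤ} (h : ∀ u, 0 ≤ u → u < i → (p u ↔ q u)) :
    countBelow p i = countBelow q i :=
  le_antisymm (countBelow_mono fun u h0 h1 => (h u h0 h1).1)
    (countBelow_mono fun u h0 h1 => (h u h0 h1).2)

theorem countBelow_or {p q : ℤ → Prop} {i : ℤ} (h : ∀ u, p u → ¬ q u) :
    countBelow (fun u => p u ∨ q u) i = countBelow p i + countBelow q i := by
  classical
  have := Finset.card_union_of_disjoint (s := (Finset.Ico 0 i).filter p)
    (t := (Finset.Ico 0 i).filter q) (by rw [Finset.disjoint_filter]; exact fun u _ => h u)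
  rw [← Finset.filter_or] at this
  simp only [countBelow]
  rw [← Nat.cast_add, ← this]
  congr

theorem countBelow_and_lt {p : ℤ → Prop} {i t : ℤ} (ht : t ≤ i) :
    countBelow (fun u => p u ∧ u < t) i = countBelow p t := by
  classical
  simp only [countBelow, Nat.cast_inj]
  congr 1
  ext u
  simp only [Finset.mem_filter, Finset.mem_Ico]
  constructor
  · rintro ⟨h1, h2, h3⟩; exact ⟨⟨h1.1, h3⟩, h2⟩
  · rintro ⟨h1, h2⟩; exact ⟨⟨h1.1, by omega⟩, h2, h1.2⟩

/-- Pigeonhole; it turns an injective placement into a listing without gaps. -/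
theorem surj_of_inj_Ico {f : ℤ → ℤ} {n : ℤ} (hf : ∀ t, 0 ≤ t → t < n → 0 ≤ f t ∧ f t < n)
    (hinj : ∀ t u, 0 ≤ t → t < u → u < n → f t ≠ f u) {p : ℤ} (hp0 : 0 ≤ p) (hpn : p < n) :
    ∃ t, 0 ≤ t ∧ t < n ∧ f t = p := by
  have := Finset.surj_on_of_inj_on_of_card_le (s := Finset.Ico 0 n) (t := Finset.Ico 0 n)
    (fun t _ => f t) (fun t ht => by
      rw [Finset.mem_Ico] at ht ⊢; exact hf t ht.1 ht.2) (fun t u ht hu h => by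
      rw [Finset.mem_Ico] at ht hu
      rcases lt_trichotomy t u with h' | h' | h'
      · exact absurd h (hinj t u ht.1 h' hu.2)
      · exact h'
      · exact absurd h.symm (hinj u t hu.1 h' ht.2)) le_rfl p (by simp [hp0, hpn])
  obtain ⟨t, ht, h⟩ := this
  rw [Finset.mem_Ico] at ht
  exact ⟨t, ht.1, ht.2, h.symm⟩

/-! ### Listings and stable sorting -/

/-- `X 0, …, X (n - 1)` lists the elements of `S` without repetition. -/
structure Listing (S : ℤ → Prop) (X : ℤ → ℤ) (n : ℤ) : Prop where
  mem : ∀ p, 0 ≤ p → p < n → S (X p)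
  surj : ∀ v, S v → ∃ p, 0 ≤ p ∧ p < n ∧ X p = v
  inj : ∀ p q, 0 ≤ p → p < q → q < n → X p ≠ X q

/-- `X 0, …, X (n - 1)` is sorted by the key `f`. -/
def SortedBy (f X : ℤ → ℤ) (n : ℤ) : Prop :=
  ∀ p q, 0 ≤ p → p < q → q < n → f (X p) ≤ f (X q)

/-- `X` is placed into `Y` in the stable order of the keys `κ`. -/
theorem stable_placement {X Y κ f key pos : ℤ → ℤ} {S : ℤ → Prop} {n F : ℤ}
    (hX : Listing S X n) (hκ : ∀ t, 0 ≤ t → t < n → κ t = key (X t))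
    (hf : SortedBy f X n) (hF : ∀ v, S v → 0 ≤ f v ∧ f v < F)
    (hpos : ∀ t, 0 ≤ t → t < n → 0 ≤ pos t ∧ pos t < n)
    (hmono : ∀ t u, 0 ≤ t → t < n → 0 ≤ u → u < n → (κ t < κ u ∨ κ t = κ u ∧ t < u) →
      pos t < pos u)
    (hY : ∀ t, 0 ≤ t → t < n → Y (pos t) = X t) :
    Listing S Y n ∧ SortedBy (fun v => key v * F + f v) Y n := by
  have hcmp : ∀ t u, 0 ≤ t → t < u → u < n → pos t ≠ pos u := by
    intro t u h0 h1 h2 h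
    rcases lt_trichotomy (κ t) (κ u) with h' | h' | h'
    · have := hmono t u h0 (by omega) (by omega) h2 (Or.inl h'); omega
    · have := hmono t u h0 (by omega) (by omega) h2 (Or.inr ⟨h', h1⟩); omega
    · have := hmono u t (by omega) h2 h0 (by omega) (Or.inl h'); omega
  have hsurj := fun p h0 hn => surj_of_inj_Ico (p := p) hpos hcmp h0 hn
  refine ⟨⟨?_, ?_, ?_⟩, ?_⟩
  · intro p h0 hn
    obtain ⟨t, ht0, htn, rfl⟩ := hsurj p h0 hn
    rw [hY t ht0 htn]; exact hX.mem t ht0 htn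
  · intro v hv
    obtain ⟨t, ht0, htn, rfl⟩ := hX.surj v hv
    exact ⟨pos t, (hpos t ht0 htn).1, (hpos t ht0 htn).2, hY t ht0 htn⟩
  · intro p q h0 hpq hn
    obtain ⟨t, ht0, htn, rfl⟩ := hsurj p h0 (by omega)
    obtain ⟨u, hu0, hun, rfl⟩ := hsurj q (by omega) hn
    rw [hY t ht0 htn, hY u hu0 hun]
    rcases lt_trichotomy t u with h | h | h
    · exact hX.inj t u ht0 h hun
    · subst h; omega
    · exact (hX.inj u t hu0 h htn).symm
  · intro p q h0 hpq hn
    obtain ⟨t, ht0, htn, rfl⟩ := hsurj p h0 (by omega)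
    obtain ⟨u, hu0, hun, rfl⟩ := hsurj q (by omega) hn
    rw [hY t ht0 htn, hY u hu0 hun]
    dsimp only
    rw [← hκ t ht0 htn, ← hκ u hu0 hun]
    have h1 := hF _ (hX.mem t ht0 htn)
    have h2 := hF _ (hX.mem u hu0 hun)
    rcases lt_trichotomy (κ t) (κ u) with h | h | h
    -- As `0 ≤ f < F`, the number `key * F + f` orders pairs lexicographically; passes can thus be
    -- chained by enlarging `F`.
    · have : κ t * F + F ≤ κ u * F := by nlinarith
      linarith
    · rcases lt_trichotomy t u with h' | h' | h'
      · have := hf t u ht0 h' hun; rw [h]; linarith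
      · subst h'; omega
      · have := hmono u t hu0 hun ht0 htn (Or.inr ⟨h.symm, h'⟩); omega
    · have := hmono u t hu0 hun ht0 htn (Or.inl h); omega

/-! ### Radix sort by stable counting passes -/

namespace RAM

open RAM.Expr RAM.Program

notation:60 c:61 ";;" d:60 => Program.seq c d

@[simp] theorem regs_forLoop (x : ℕ) (hi : Expr) (c : Program) :
    (forLoop x hi c).regs = x :: (c.regs ++ [x]) := rfl
@[simp] theorem arrs_forLoop (x : ℕ) (hi : Expr) (c : Program) :
    (forLoop x hi c).arrs = c.arrs ++ [] := rfl

attribute [simp] Program.regs Program.arrs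

/-- Tabulate in array `8` how often every key occurs. -/
def tally (ka src : ℕ) (off : ℤ) : Program :=
  forLoop 20 (reg 12 + 1) (store 8 (reg 20) 0) ;;
  forLoop 20 (reg 10)
    (assign 21 (cell ka (reg 11 + cell src (reg 20) + const off)) ;;
     store 8 (reg 21) (cell 8 (reg 21) + 1))

/-- Replace the tally in array `8` by its prefix sums. -/
def prefixSums : Program :=
  assign 22 0 ;;
  forLoop 20 (reg 12 + 1)
    (assign 23 (cell 8 (reg 20)) ;; store 8 (reg 20) (reg 22) ;; assign 22 (reg 22 + reg 23))

/-- Move the items of array `src` to their places in array `dst`. -/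
def distribute (ka src dst : ℕ) (off : ℤ) : Program :=
  forLoop 20 (reg 10)
    (assign 21 (cell ka (reg 11 + cell src (reg 20) + const off)) ;;
     store dst (cell 8 (reg 21)) (cell src (reg 20)) ;;
     store 8 (reg 21) (cell 8 (reg 21) + 1))

/-- One pass of radix sort: the items are in array `src`, their number is in register `10`, the
key of item `v` is in cell `base + v + off` of array `ka`, with `base` in register `11`, and the
keys are at most the value of register `12`. The sorted items are written to array `dst`. -/
def radixPass (ka src dst : ℕ) (off : ℤ) : Program :=
  tally ka src off ;; prefixSums ;; distribute ka src dst off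

section
variable {B : ℤ} {s : State} {τ : ℤ}

theorem tally_spec {ka src : ℕ} {off n K : ℤ} {κ : ℤ → ℤ} (hka : ka ≠ 8) (hsrc : src ≠ 8)
    (h10 : s.reg 10 = n) (h12 : s.reg 12 = K) (hn : 0 ≤ n) (hK : 0 ≤ K) (hnB : n < B)
    (hKB : K < B)
    (hκ : ∀ t, 0 ≤ t → t < n → s.arr ka (s.reg 11 + s.arr src t + off) = κ t ∧ 0 ≤ κ t ∧ κ t ≤ K) :
    wp B (tally ka src off) s τ (fun s' τ' => τ' ≤ τ + 40 * (n + K + 1) ∧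
      ∀ c, 0 ≤ c → c ≤ K → s'.arr 8 c = countBelow (fun u => κ u = c) n) := by
  simp only [tally, wp_seq]
  refine wp_for (K + 1) (fun i s' τ' => τ' ≤ τ + 2 + 20 * i ∧
    ∀ c, 0 ≤ c → c < i → s'.arr 8 c = 0) (by omega) (by omega) (by simp) ?_ ?_ ?_ ?_
  · intro s' hf
    simp [hf.1 12 (by simp), h12]
  · refine ⟨by simp, fun c h0 h1 => by omega⟩
  · rintro i s' τ' hi0 hin hxi hf ⟨hτ, hI⟩
    simp only [wp_store]
    simp [Function.update_apply, hxi]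
    refine ⟨by omega, by omega, fun c h0 h1 h => ?_⟩
    exact hI c h0 (by omega)
  rintro s₁ τ₁ hx₁ hf₁ ⟨hτ₁, hI₁⟩
  have e10 := hf₁.1 10 (by simp)
  have e11 := hf₁.1 11 (by simp)
  have ek := hf₁.2 ka (by simp [hka])
  have es := hf₁.2 src (by simp [hsrc])
  refine wp_for n (fun i s' τ' => τ' ≤ τ + 2 + 20 * (K + 1) + 10 + 30 * i ∧
    ∀ c, 0 ≤ c → c ≤ K → s'.arr 8 c = countBelow (fun u => κ u = c) i) (by omega) (by omega)
    (by simp) ?_ ?_ ?_ ?_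
  · intro s' hf
    simp [hf.1 10 (by simp), e10, h10]
  · refine ⟨by simp; omega, fun c h0 h1 => ?_⟩
    simp [countBelow_zero, hI₁ c h0 (by omega)]
  · rintro i s' τ' hi0 hin hxi hf ⟨hτ, hI⟩
    have hk := hκ i hi0 hin
    have f11 := hf.1 11 (by simp)
    have fk := hf.2 ka (by simp [hka])
    have fs := hf.2 src (by simp [hsrc])
    have hc := hI _ hk.2.1 hk.2.2
    have h3 := countBelow_le (fun u => κ u = κ i) hi0
    have h4 := countBelow_nonneg (fun u => κ u = κ i) i
    simp only [wp_seq, wp_assign, wp_store]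
    simp [Function.update_apply, hxi, f11, fk, fs, e11, ek, es, hk.1]
    refine ⟨⟨by omega, by omega⟩, ⟨by omega, by omega⟩, by omega, fun c h0 h1 => ?_⟩
    rw [countBelow_succ _ hi0]
    split_ifs with h h' h'
    · rw [h, hc]
    · exact absurd h.symm h'
    · exact absurd h'.symm h
    · rw [hI c h0 h1, add_zero]
  · rintro s' τ' hx hf ⟨hτ, hI⟩
    simp
    exact ⟨by omega, hI⟩

/-- The sums are exclusive: the running total is stored before the tally of the current key is
added. So cell `c` becomes the first place for items of key `c`. -/
theorem prefixSums_spec {n K : ℤ} {κ : ℤ → ℤ} (h12 : s.reg 12 = K) (hn : 0 ≤ n) (hK : 0 ≤ K)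
    (hnB : n < B) (hKB : K < B)
    (h8 : ∀ c, 0 ≤ c → c ≤ K → s.arr 8 c = countBelow (fun u => κ u = c) n)
    (hκ : ∀ t, 0 ≤ t → t < n → 0 ≤ κ t) :
    wp B prefixSums s τ (fun s' τ' => τ' ≤ τ + 40 * (K + 2) ∧
      ∀ c, 0 ≤ c → c ≤ K → s'.arr 8 c = countBelow (fun u => κ u < c) n) := by
  simp only [prefixSums, wp_seq, wp_assign]
  refine ⟨by simp; omega, ?_⟩
  refine wp_for (K + 1) (fun i s' τ' => τ' ≤ τ + 10 + 30 * i ∧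
    s'.reg 22 = countBelow (fun u => κ u < i) n ∧
    (∀ c, 0 ≤ c → c < i → s'.arr 8 c = countBelow (fun u => κ u < c) n) ∧
    (∀ c, i ≤ c → c ≤ K → s'.arr 8 c = countBelow (fun u => κ u = c) n))
    (by omega) (by omega) (by simp) ?_ ?_ ?_ ?_
  · intro s' hf
    simp [hf.1 12 (by simp), h12]
  · refine ⟨by simp; omega, ?_, fun c h0 h1 => by omega, fun c h0 h1 => ?_⟩
    · have : countBelow (fun u => κ u < 0) n = countBelow (fun _ => False) n :=
        countBelow_congr fun u h0 h1 => by have := hκ u h0 h1; simp; omega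
      simp [this]; simp [countBelow]
    · simp [h8 c h0 h1]
  · rintro i s' τ' hi0 hin hxi hf ⟨hτ, h22, hlt, hge⟩
    have h1 := hge i le_rfl (by omega)
    have hsum : countBelow (fun u => κ u ≤ i) n
        = countBelow (fun u => κ u < i) n + countBelow (fun u => κ u = i) n := by
      rw [← countBelow_or (by intro u h; omega)]
      exact countBelow_congr fun u _ _ => by omega
    have a1 := countBelow_le (fun u => κ u < i) hn
    have a2 := countBelow_nonneg (fun u => κ u < i) n
    have a3 := countBelow_le (fun u => κ u = i) hn
    have a4 := countBelow_nonneg (fun u => κ u = i) n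
    have a5 := countBelow_le (fun u => κ u ≤ i) hn
    simp only [wp_seq, wp_assign, wp_store]
    simp [Function.update_apply, hxi, h1, h22]
    refine ⟨⟨by omega, by omega⟩, ⟨by omega, by omega⟩, ⟨by omega, by omega⟩, by omega,
      hsum.symm, fun c h0 h1 => ?_, fun c h0 h1 => ?_⟩
    · split_ifs with h
      · rw [h]
      · exact hlt c h0 (by omega)
    · rw [if_neg (by omega)]; exact hge c (by omega) h1
  · rintro s' τ' hx hf ⟨hτ, h22, hlt, hge⟩
    simp
    exact ⟨by omega, fun c h0 h1 => hlt c h0 (by omega)⟩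

/-- The place of an item is the number of items before it in the stable order: those with a smaller
key and the earlier ones with the same key. The cell of a key in array `8` always holds the number
of smaller keys plus the number of items of this key already moved, which is the place of the next
one. -/
theorem distribute_spec {ka src dst : ℕ} {off n K : ℤ} {κ : ℤ → ℤ} (hka : ka ≠ 8) (hsrc : src ≠ 8)
    (hdst : dst ≠ 8) (hkd : ka ≠ dst) (hsd : src ≠ dst)
    (h10 : s.reg 10 = n) (hn : 0 ≤ n) (hnB : n < B) (hKB : K < B)
    (h8 : ∀ c, 0 ≤ c → c ≤ K → s.arr 8 c = countBelow (fun u => κ u < c) n)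
    (hX : ∀ t, 0 ≤ t → t < n → -B ≤ s.arr src t ∧ s.arr src t ≤ B)
    (hκ : ∀ t, 0 ≤ t → t < n → s.arr ka (s.reg 11 + s.arr src t + off) = κ t ∧ 0 ≤ κ t ∧ κ t ≤ K) :
    wp B (distribute ka src dst off) s τ (fun s' τ' => τ' ≤ τ + 40 * (n + 1) ∧
      ∃ pos : ℤ → ℤ, (∀ t, 0 ≤ t → t < n → 0 ≤ pos t ∧ pos t < n) ∧
        (∀ t u, 0 ≤ t → t < n → 0 ≤ u → u < n → (κ t < κ u ∨ κ t = κ u ∧ t < u) →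
          pos t < pos u) ∧
        (∀ t, 0 ≤ t → t < n → s'.arr dst (pos t) = s.arr src t)) := by
  set pos : ℤ → ℤ := fun t => countBelow (fun u => κ u < κ t ∨ κ u = κ t ∧ u < t) n with hposdef
  have hpos : ∀ t, 0 ≤ t → t < n → pos t =
      countBelow (fun u => κ u < κ t) n + countBelow (fun u => κ u = κ t) t := by
    intro t h0 h1
    rw [hposdef, ← countBelow_and_lt (p := fun u => κ u = κ t) h1.le]
    exact countBelow_or fun u h => by omega
  have hrange : ∀ t, 0 ≤ t → t < n → 0 ≤ pos t ∧ pos t < n := by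
    intro t h0 h1
    refine ⟨countBelow_nonneg _ _, ?_⟩
    have := countBelow_lt (p := fun u => κ u < κ t ∨ κ u = κ t ∧ u < t) (q := fun _ => True)
      (i := n) (v := t) (fun _ _ _ _ => trivial) h0 h1 (by omega) trivial
    exact this.trans_le (countBelow_le _ hn)
  have hmono : ∀ t u, 0 ≤ t → t < n → 0 ≤ u → u < n → (κ t < κ u ∨ κ t = κ u ∧ t < u) →
      pos t < pos u := by
    intro t u ht0 ht hu0 hu h
    exact countBelow_lt (v := t) (fun w _ _ hw => by omega) ht0 ht (by omega) h
  have hne : ∀ t u, 0 ≤ t → t < u → u < n → pos t ≠ pos u := by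
    intro t u h0 h1 h2 h
    rcases lt_trichotomy (κ t) (κ u) with h' | h' | h'
    · have := hmono t u h0 (by omega) (by omega) h2 (Or.inl h'); omega
    · have := hmono t u h0 (by omega) (by omega) h2 (Or.inr ⟨h', h1⟩); omega
    · have := hmono u t (by omega) h2 h0 (by omega) (Or.inl h'); omega
  simp only [distribute]
  refine wp_for n (fun i s' τ' => τ' ≤ τ + 2 + 40 * i ∧
    (∀ c, 0 ≤ c → c ≤ K → s'.arr 8 c =
      countBelow (fun u => κ u < c) n + countBelow (fun u => κ u = c) i) ∧
    (∀ t, 0 ≤ t → t < i → s'.arr dst (pos t) = s.arr src t))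
    (by omega) (by omega) (by simp) ?_ ?_ ?_ ?_
  · intro s' hf
    simp [hf.1 10 (by simp), h10]
  · refine ⟨by simp, fun c h0 h1 => ?_, fun t h0 h1 => by omega⟩
    simp [countBelow_zero, h8 c h0 h1]
  · rintro i s' τ' hi0 hin hxi hf ⟨hτ, hI, hJ⟩
    have hk := hκ i hi0 hin
    have f11 := hf.1 11 (by simp)
    have fk := hf.2 ka (by simp [hka, hkd])
    have fs := hf.2 src (by simp [hsrc, hsd])
    have hc := hI _ hk.2.1 hk.2.2
    have hp := hpos i hi0 hin
    have hr := hrange i hi0 hin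
    rw [← hp] at hc
    have hx := hX i hi0 hin
    simp only [wp_seq, wp_assign, wp_store]
    simp [Function.update_apply, hxi, f11, fk, fs, hk.1, hdst, hdst.symm, hc, hsd]
    refine ⟨⟨by omega, by omega⟩, hx, ⟨by omega, by omega⟩, by omega, fun c h0 h1 => ?_,
      fun t h0 h1 => ?_⟩
    · rw [countBelow_succ _ hi0]
      split_ifs with h h' h'
      · subst h; rw [← add_assoc, ← hp]
      · exact absurd h.symm h'
      · exact absurd h'.symm h
      · rw [hI c h0 h1, add_zero]
    · split_ifs with h
      · rcases eq_or_lt_of_le h1 with h' | h'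
        · rw [h']
        · exact absurd h (hne t i h0 h' hin)
      · refine hJ t h0 ?_
        rcases eq_or_lt_of_le h1 with h' | h'
        · subst h'; exact absurd rfl h
        · exact h'
  · rintro s' τ' hx hf ⟨hτ, hI, hJ⟩
    simp
    exact ⟨by omega, pos, hrange, hmono, hJ⟩

/-- A stable pass keeps the order by `f` among equal keys. With `F` above all values of `f`, the
result is sorted by `key * F + f`, which can serve as `f` in the next pass. -/
theorem radixPass_spec {ka src dst : ℕ} {off n K F : ℤ} {S : ℤ → Prop} {key f : ℤ → ℤ}
    (hka : ka ≠ 8) (hsrc : src ≠ 8)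
    (hdst : dst ≠ 8) (hkd : ka ≠ dst) (hsd : src ≠ dst)
    (h10 : s.reg 10 = n) (h12 : s.reg 12 = K) (hn : 0 ≤ n) (hK : 0 ≤ K) (hnB : n < B)
    (hKB : K < B)
    (hX : Listing S (s.arr src) n) (hSB : ∀ v, S v → -B ≤ v ∧ v ≤ B)
    (hkey : ∀ v, S v → s.arr ka (s.reg 11 + v + off) = key v ∧ 0 ≤ key v ∧ key v ≤ K)
    (hf : SortedBy f (s.arr src) n) (hF : ∀ v, S v → 0 ≤ f v ∧ f v < F) :
    wp B (radixPass ka src dst off) s τ (fun s' τ' => τ' ≤ τ + 200 * (n + K + 1) ∧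
      Listing S (s'.arr dst) n ∧ SortedBy (fun v => key v * F + f v) (s'.arr dst) n) := by
  set κ : ℤ → ℤ := fun t => key (s.arr src t) with hκdef
  have hκ : ∀ t, 0 ≤ t → t < n →
      s.arr ka (s.reg 11 + s.arr src t + off) = κ t ∧ 0 ≤ κ t ∧ κ t ≤ K :=
    fun t h0 h1 => hkey _ (hX.mem t h0 h1)
  simp only [radixPass, wp_seq]
  refine wp_frame_mono (tally_spec hka hsrc h10 h12 hn hK hnB hKB hκ) ?_
  rintro s₁ τ₁ hf₁ ⟨hτ₁, h8⟩
  have e10 := hf₁.1 10 (by simp [tally])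
  have e11 := hf₁.1 11 (by simp [tally])
  have e12 := hf₁.1 12 (by simp [tally])
  have ek := hf₁.2 ka (by simp [hka, tally])
  have es := hf₁.2 src (by simp [hsrc, tally])
  refine wp_frame_mono (prefixSums_spec (e12.trans h12) hn hK hnB hKB h8
    fun t h0 h1 => (hκ t h0 h1).2.1) ?_
  rintro s₂ τ₂ hf₂ ⟨hτ₂, h8'⟩
  have d10 := (hf₂.1 10 (by simp [prefixSums])).trans e10
  have d11 := (hf₂.1 11 (by simp [prefixSums])).trans e11
  have dk := (hf₂.2 ka (by simp [hka, prefixSums])).trans ek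
  have ds := (hf₂.2 src (by simp [hsrc, prefixSums])).trans es
  refine wp_frame_mono (distribute_spec (κ := κ) (K := K) hka hsrc hdst hkd hsd (d10.trans h10) hn
    hnB hKB h8' (fun t h0 h1 => ?_) (by rw [dk, d11, ds]; exact hκ)) ?_
  · rw [ds]; exact hSB _ (hX.mem t h0 h1)
  rintro s₃ τ₃ hf₃ ⟨hτ₃, pos, hpos, hmono, hY⟩
  rw [ds] at hY
  exact ⟨by omega, stable_placement hX (fun t _ _ => rfl) hf hF hpos hmono hY⟩

end

end RAM

/-! ### Suffixes of zero-padded strings -/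

/-- A string of length `N` over `{1, …, N}`, padded with zeros. -/
structure Padded (s : ℤ → ℤ) (N : ℤ) : Prop where
  zero : ∀ i, N ≤ i → s i = 0
  mem : ∀ i, 0 ≤ i → i < N → 1 ≤ s i ∧ s i ≤ N

/-- The suffixes at `i` and `j` agree on their first `h` characters. -/
def Agree (s : ℤ → ℤ) (i j h : ℤ) : Prop := ∀ e, 0 ≤ e → e < h → s (i + e) = s (j + e)

/-- The suffix at `i` is lexicographically smaller than the suffix at `j`. -/
def SufLt (s : ℤ → ℤ) (i j : ℤ) : Prop := ∃ d, 0 ≤ d ∧ Agree s i j d ∧ s (i + d) < s (j + d)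

/-- `r` numbers the suffixes of a string of length `N` from `1` to `N` in increasing order. -/
structure IsRank (s : ℤ → ℤ) (N : ℤ) (r : ℤ → ℤ) : Prop where
  mem : ∀ i, 0 ≤ i → i < N → 1 ≤ r i ∧ r i ≤ N
  lt : ∀ i j, 0 ≤ i → i < N → 0 ≤ j → j < N → SufLt s i j → r i < r j

theorem Padded.nonneg {s : ℤ → ℤ} {N : ℤ} (hs : Padded s N) {i : ℤ} (hi : 0 ≤ i) : 0 ≤ s i := by
  by_cases h : i < N
  · linarith [(hs.mem i hi h).1]
  · rw [hs.zero i (by omega)]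

theorem Padded.le {s : ℤ → ℤ} {N : ℤ} (hs : Padded s N) (hN : 0 ≤ N) {i : ℤ} (hi : 0 ≤ i) :
    s i ≤ N := by
  by_cases h : i < N
  · exact (hs.mem i hi h).2
  · rwa [hs.zero i (by omega)]

theorem Padded.lt_of_pos {s : ℤ → ℤ} {N i : ℤ} (hs : Padded s N) (h : 0 < s i) : i < N := by
  by_contra h'
  rw [hs.zero i (by omega)] at h
  omega

section
variable {s : ℤ → ℤ} {i j k h : ℤ}

theorem Agree.symm (H : Agree s i j h) : Agree s j i h := fun e h0 h1 => (H e h0 h1).symm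

theorem Agree.trans (H : Agree s i j h) (H' : Agree s j k h) : Agree s i k h :=
  fun e h0 h1 => (H e h0 h1).trans (H' e h0 h1)

theorem Agree.mono {h' : ℤ} (H : Agree s i j h) (hh : h' ≤ h) : Agree s i j h' :=
  fun e h0 h1 => H e h0 (by omega)

theorem SufLt.trichotomy_aux (hne : ∃ e, 0 ≤ e ∧ s (i + e) ≠ s (j + e)) :
    SufLt s i j ∨ SufLt s j i := by
  classical
  have hex : ∃ e : ℕ, s (i + e) ≠ s (j + e) := by
    obtain ⟨e, h0, h⟩ := hne
    exact ⟨e.toNat, by rwa [Int.toNat_of_nonneg h0]⟩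
  have hag : Agree s i j (Nat.find hex) := by
    intro e h0 h1
    have := Nat.find_min hex (m := e.toNat) (by omega)
    rw [Int.toNat_of_nonneg h0] at this
    exact not_not.1 this
  rcases lt_or_gt_of_ne (Nat.find_spec hex) with h | h
  · exact Or.inl ⟨_, Int.natCast_nonneg _, hag, h⟩
  · exact Or.inr ⟨_, Int.natCast_nonneg _, hag.symm, h⟩

/-- Shift until `j` reaches the end of the string (not at all if it is already there): at `j` a
padding zero is read, at `i` still a positive character. So distinct suffixes always have a first
difference, and suffix order is total on them. -/
theorem Padded.exists_ne {N : ℤ} (hs : Padded s N) (hi : 0 ≤ i) (hij : i < j) (hN : i < N) :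
    ∃ e, 0 ≤ e ∧ i + e < N ∧ N ≤ j + e ∧ s (i + e) ≠ s (j + e) := by
  have key : ∀ e, 0 ≤ e → i + e < N → N ≤ j + e → s (i + e) ≠ s (j + e) := by
    intro e h0 h1 h2
    have := (hs.mem (i + e) (by omega) h1).1
    rw [hs.zero (j + e) h2]; omega
  by_cases h : j ≤ N
  · exact ⟨N - j, by omega, by omega, by omega, key _ (by omega) (by omega) (by omega)⟩
  · exact ⟨0, by omega, by omega, by omega, key _ (by omega) (by omega) (by omega)⟩

theorem SufLt.total {N : ℤ} (hs : Padded s N) (hi : 0 ≤ i) (hj : 0 ≤ j) (hij : i ≠ j)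
    (hN : i < N ∨ j < N) : SufLt s i j ∨ SufLt s j i := by
  rcases lt_or_gt_of_ne hij with h | h
  · obtain ⟨e, h0, -, -, h1⟩ := hs.exists_ne hi h (by omega)
    exact SufLt.trichotomy_aux ⟨e, h0, h1⟩
  · obtain ⟨e, h0, -, -, h1⟩ := hs.exists_ne hj h (by omega)
    exact (SufLt.trichotomy_aux ⟨e, h0, h1⟩).symm

theorem SufLt.trans (H : SufLt s i j) (H' : SufLt s j k) : SufLt s i k := by
  obtain ⟨d, d0, ha, hd⟩ := H
  obtain ⟨e, e0, hb, he⟩ := H'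
  rcases lt_trichotomy d e with h | h | h
  · exact ⟨d, d0, ha.trans (hb.mono h.le), by rwa [← hb d d0 h]⟩
  · subst h; exact ⟨d, d0, ha.trans hb, hd.trans he⟩
  · exact ⟨e, e0, (ha.mono h.le).trans hb, by rwa [ha e e0 h]⟩

theorem SufLt.irrefl : ¬ SufLt s i i := fun ⟨_, _, _, h⟩ => lt_irrefl _ h

theorem SufLt.asymm (H : SufLt s i j) : ¬ SufLt s j i := fun H' => SufLt.irrefl (H.trans H')

theorem SufLt.of_lt (H : s i < s j) : SufLt s i j :=
  ⟨0, le_rfl, fun e _ _ => by omega, by simpa using H⟩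

theorem SufLt.le (H : SufLt s i j) : s i ≤ s j := by
  obtain ⟨d, d0, ha, hd⟩ := H
  rcases eq_or_lt_of_le d0 with h | h
  · subst h; simpa using hd.le
  · have := ha 0 le_rfl h
    simp only [add_zero] at this
    exact this.le

theorem sufLt_succ (H : s i = s j) : SufLt s (i + 1) (j + 1) ↔ SufLt s i j := by
  constructor
  · rintro ⟨d, d0, ha, hd⟩
    refine ⟨d + 1, by omega, fun e h0 h1 => ?_, ?_⟩
    · rcases eq_or_lt_of_le h0 with h | h
      · subst h; simpa using H
      · have := ha (e - 1) (by omega) (by omega)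
        rwa [show i + 1 + (e - 1) = i + e by ring, show j + 1 + (e - 1) = j + e by ring] at this
    · rwa [show i + (d + 1) = i + 1 + d by ring, show j + (d + 1) = j + 1 + d by ring]
  · rintro ⟨d, d0, ha, hd⟩
    rcases eq_or_lt_of_le d0 with h | h
    · subst h; simp only [add_zero] at hd; omega
    · refine ⟨d - 1, by omega, fun e h0 h1 => ?_, ?_⟩
      · have := ha (e + 1) (by omega) (by omega)
        rwa [show i + (e + 1) = i + 1 + e by ring, show j + (e + 1) = j + 1 + e by ring] at this
      · rwa [show i + 1 + (d - 1) = i + d by ring, show j + 1 + (d - 1) = j + d by ring]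

/-- A suffix between two suffixes that agree agrees with both. -/
theorem Agree.sandwich (H : Agree s i k h) (h₁ : SufLt s i j) (h₂ : SufLt s j k) :
    Agree s j k h := by
  obtain ⟨d, d0, ha, hd⟩ := h₁
  obtain ⟨e, e0, hb, he⟩ := h₂
  have hde : h ≤ e := by
    by_contra hlt
    push Not at hlt
    rcases lt_trichotomy d e with h' | h' | h'
    · have := H d d0 (by omega); rw [hb d d0 h'] at hd; omega
    · subst h'; have := H d d0 (by omega); omega
    · have := H e e0 hlt; rw [ha e e0 h'] at this; omega
  exact hb.mono hde
end

/-! ### Longest common prefixes and range minima -/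

/-- `v` is the length of the longest common prefix of the suffixes at `i` and `j`. -/
structure IsLcp (s : ℤ → ℤ) (i j v : ℤ) : Prop where
  nonneg : 0 ≤ v
  agree : Agree s i j v
  ne : s (i + v) ≠ s (j + v)

theorem IsLcp.symm {s : ℤ → ℤ} {i j v : ℤ} (H : IsLcp s i j v) : IsLcp s j i v :=
  ⟨H.nonneg, H.agree.symm, H.ne.symm⟩

theorem IsLcp.lt_of_sufLt {s : ℤ → ℤ} {i j v : ℤ} (H : IsLcp s i j v) (h : SufLt s i j) :
    s (i + v) < s (j + v) := by
  obtain ⟨d, d0, ha, hd⟩ := h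
  rcases lt_trichotomy d v with h' | h' | h'
  · have := H.agree d d0 h'; omega
  · subst h'; exact hd
  · exact absurd (ha v H.nonneg h') H.ne

/-- The order matters when `v = w`: both mismatches go upwards, so the characters of `i` and `k` at
this place still differ. If `v ≠ w`, the shorter match ends at a character that the other pair
shares. -/
theorem IsLcp.min {s : ℤ → ℤ} {i j k v w : ℤ} (H : IsLcp s i j v) (H' : IsLcp s j k w)
    (h₁ : SufLt s i j) (h₂ : SufLt s j k) : IsLcp s i k (min v w) := by
  have a := H.lt_of_sufLt h₁
  have b := H'.lt_of_sufLt h₂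
  refine ⟨le_min H.nonneg H'.nonneg,
    (H.agree.mono (min_le_left _ _)).trans (H'.agree.mono (min_le_right _ _)), ?_⟩
  rcases lt_trichotomy v w with h | h | h
  · rw [min_eq_left h.le, ← H'.agree v H.nonneg h]; exact a.ne
  · subst h; rw [min_self]; exact (a.trans b).ne
  · rw [min_eq_right h.le, H.agree w H'.nonneg h]; exact b.ne

/-- `v` is the least value of `f` on `[lo, hi)`. -/
structure RangeMin (f : ℤ → ℤ) (lo hi v : ℤ) : Prop where
  attained : ∃ p, lo ≤ p ∧ p < hi ∧ f p = v
  le : ∀ p, lo ≤ p → p < hi → v ≤ f p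

theorem RangeMin.single (f : ℤ → ℤ) (p : ℤ) : RangeMin f p (p + 1) (f p) :=
  ⟨⟨p, le_rfl, by omega, rfl⟩, fun q h0 h1 => by rw [show q = p by omega]⟩

theorem RangeMin.union {f : ℤ → ℤ} {a b c d v w : ℤ} (H : RangeMin f a b v) (H' : RangeMin f c d w)
    (hac : a ≤ c) (hcb : c ≤ b) (hbd : b ≤ d) : RangeMin f a d (min v w) := by
  refine ⟨?_, fun p h0 h1 => ?_⟩
  · rcases le_total v w with h | h
    · obtain ⟨p, h0, h1, h2⟩ := H.attained
      exact ⟨p, h0, by omega, by rw [min_eq_left h, h2]⟩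
    · obtain ⟨p, h0, h1, h2⟩ := H'.attained
      exact ⟨p, by omega, h1, by rw [min_eq_right h, h2]⟩
  · by_cases h : p < b
    · exact (min_le_left _ _).trans (H.le p h0 h)
    · exact (min_le_right _ _).trans (H'.le p (by omega) h1)

theorem RangeMin.unique {f : ℤ → ℤ} {a b v w : ℤ} (H : RangeMin f a b v) (H' : RangeMin f a b w) :
    v = w := by
  obtain ⟨p, h0, h1, h2⟩ := H.attained
  obtain ⟨q, g0, g1, g2⟩ := H'.attained
  have := H.le q g0 g1
  have := H'.le p h0 h1
  omega

section
variable {s r : ℤ → ℤ} {N : ℤ}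

theorem IsRank.sufLt (hr : IsRank s N r) (hs : Padded s N) {i j : ℤ} (hi : 0 ≤ i) (hiN : i < N)
    (hj : 0 ≤ j) (hjN : j < N) (h : r i < r j) : SufLt s i j := by
  have hne : i ≠ j := by rintro rfl; omega
  rcases SufLt.total hs hi hj hne (Or.inl hiN) with h' | h'
  · exact h'
  · have := hr.lt j i hj hjN hi hiN h'; omega

theorem IsRank.inj (hr : IsRank s N r) (hs : Padded s N) {i j : ℤ} (hi : 0 ≤ i) (hiN : i < N)
    (hj : 0 ≤ j) (hjN : j < N) (hne : i ≠ j) : r i ≠ r j := by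
  rcases SufLt.total hs hi hj hne (Or.inl hiN) with h' | h'
  · exact (hr.lt i j hi hiN hj hjN h').ne
  · exact (hr.lt j i hj hjN hi hiN h').ne'

theorem IsRank.surj (hr : IsRank s N r) (hs : Padded s N) {p : ℤ} (h0 : 1 ≤ p) (hp : p ≤ N) :
    ∃ i, 0 ≤ i ∧ i < N ∧ r i = p := by
  obtain ⟨i, h1, h2, h3⟩ := surj_of_inj_Ico (f := fun i => r i - 1) (n := N) (p := p - 1)
    (fun t a b => by have := hr.mem t a b; omega)
    (fun t u a b c => by
      have := hr.inj hs a (by omega) (by omega : 0 ≤ u) c b.ne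
      omega) (by omega) (by omega)
  exact ⟨i, h1, h2, by omega⟩

/-- The step of the linear-time computation of longest common prefixes. -/
theorem IsRank.agree_succ (hr : IsRank s N r) (hs : Padded s N) {i j j' h : ℤ} (hi : 0 ≤ i)
    (hiN : i + 1 < N) (hj : 0 ≤ j) (hjN : j < N) (hj' : 0 ≤ j') (hjN' : j' < N)
    (hprev : r j < r i) (hprev' : r j' = r (i + 1) - 1) (hag : Agree s i j h) :
    Agree s (i + 1) j' (h - 1) := by
  intro e h0 h1
  have hag' : Agree s (i + 1) (j + 1) (h - 1) := fun e h0 h1 => by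
    have := hag (e + 1) (by omega) (by omega)
    rwa [show i + (e + 1) = i + 1 + e by ring, show j + (e + 1) = j + 1 + e by ring] at this
  have h3 : s (i + 1) = s (j + 1) := by simpa using hag' 0 le_rfl (by omega)
  have h4 : s i = s j := by simpa using hag 0 le_rfl (by omega)
  have hj1 : j + 1 < N := hs.lt_of_pos (by
    have := (hs.mem (i + 1) (by omega) hiN).1
    omega)
  have hlt := (sufLt_succ h4.symm).2 (hr.sufLt hs hj hjN hi (by omega) hprev)
  have hrk := hr.lt _ _ (by omega) hj1 (by omega) hiN hlt
  by_cases hjj : j + 1 = j'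
  · subst hjj; exact hag' e h0 h1
  -- The suffix at `j + 1` precedes the one at `i + 1` and agrees with it on `h - 1` characters. The
  -- immediate predecessor `j'` lies between them and therefore agrees as well.
  · have hne := hr.inj hs (by omega) hj1 hj' hjN' hjj
    have := Agree.sandwich hag'.symm (hr.sufLt hs (by omega) hj1 hj' hjN' (by omega))
      (hr.sufLt hs hj' hjN' (by omega) hiN (by omega))
    exact (this e h0 h1).symm

/-- Longest common prefixes are range minima over those of neighbours in suffix order. -/
theorem IsRank.isLcp_of_rangeMin (hr : IsRank s N r) (hs : Padded s N) {L : ℤ → ℤ}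
    (hL : ∀ i j, 0 ≤ i → i < N → 0 ≤ j → j < N → r j = r i - 1 → IsLcp s i j (L (r i)))
    {i j v : ℤ} (hi : 0 ≤ i) (hiN : i < N) (hj : 0 ≤ j) (hjN : j < N) (hij : r i < r j)
    (hv : RangeMin L (r i + 1) (r j + 1) v) : IsLcp s i j v := by
  -- Induction on the number of ranks strictly between: the suffix `q` just before `j` splits off
  -- the last pair of neighbours, and `IsLcp.min` joins the two parts.
  suffices H : ∀ (n : ℕ) (j v : ℤ), 0 ≤ j → j < N → r j = r i + 1 + n →
      RangeMin L (r i + 1) (r j + 1) v → IsLcp s i j v from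
    H (r j - r i - 1).toNat j v hj hjN (by omega) hv
  intro n
  induction n with
  | zero =>
    intro j v hj hjN hjr hv
    have h1 := (hL j i hj hjN hi hiN (by push_cast at hjr; omega)).symm
    have h2 : RangeMin L (r i + 1) (r j + 1) (L (r j)) := by
      have := RangeMin.single L (r j)
      rwa [show r j = r i + 1 by push_cast at hjr; omega] at this ⊢
    rwa [hv.unique h2]
  | succ n ih =>
    intro j v hj hjN hjr hv
    push_cast at hjr
    have hmi := hr.mem i hi hiN
    have hmj := hr.mem j hj hjN
    obtain ⟨q, hq0, hqN, hqr⟩ := hr.surj hs (p := r j - 1) (by omega) (by omega)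
    have hLj := hL j q hj hjN hq0 hqN hqr
    have hmin : ∃ w, RangeMin L (r i + 1) (r q + 1) w := by
      have hne : (Finset.Ico (r i + 1) (r q + 1)).Nonempty := ⟨r i + 1, by simp; omega⟩
      obtain ⟨p, hp, hp'⟩ := Finset.exists_min_image _ L hne
      rw [Finset.mem_Ico] at hp
      exact ⟨L p, ⟨p, hp.1, hp.2, rfl⟩, fun x h0 h1 => hp' x (by rw [Finset.mem_Ico]; exact ⟨h0, h1⟩)⟩
    obtain ⟨w, hw⟩ := hmin
    have h1 := ih q w hq0 hqN (by omega) hw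
    have h2 := h1.min hLj.symm (hr.sufLt hs hi hiN hq0 hqN (by omega))
      (hr.sufLt hs hq0 hqN hj hjN (by omega))
    have h3 : RangeMin L (r i + 1) (r j + 1) (min w (L (r j))) :=
      hw.union (RangeMin.single L (r j)) (by omega) (by omega) (by omega)
    rwa [hv.unique h3]
end

/-! ### Sampled suffixes -/

/-- The sampled positions of a string of length `N`: those congruent to `1` or `2` modulo `3`. -/
def Sampled (N v : ℤ) : Prop := 0 ≤ v ∧ (v % 3 = 1 ∧ v ≤ N ∨ v % 3 = 2 ∧ v < N)

/-- The index of a sampled position in the reduced string. -/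
def sampleIndex (N v : ℤ) : ℤ := if v % 3 = 1 then v / 3 else (N + 2) / 3 + v / 3

/-- The length of the reduced string. -/
def reducedLength (N : ℤ) : ℤ := (N + 2) / 3 + N / 3

/-- The first three characters of a suffix, as a number. -/
def tripleCode (s : ℤ → ℤ) (Q v : ℤ) : ℤ :=
  s v * (Q * Q) + (s (v + 1) * Q + (s (v + 2) * 1 + 0))

/-- `s'` names the triples at the sampled positions of `s` in an order-preserving way. -/
structure IsReduction (s : ℤ → ℤ) (N : ℤ) (s' : ℤ → ℤ) : Prop where
  padded : Padded s' (reducedLength N)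
  lt : ∀ v w, Sampled N v → Sampled N w → tripleCode s (N + 1) v < tripleCode s (N + 1) w →
    s' (sampleIndex N v) < s' (sampleIndex N w)
  eq : ∀ v w, Sampled N v → Sampled N w → tripleCode s (N + 1) v = tripleCode s (N + 1) w →
    s' (sampleIndex N v) = s' (sampleIndex N w)

theorem Sampled.index_mem {N v : ℤ} (h : Sampled N v) :
    0 ≤ sampleIndex N v ∧ sampleIndex N v < reducedLength N := by
  obtain ⟨h0, h⟩ := h
  unfold sampleIndex reducedLength
  split_ifs <;> omega

theorem Sampled.index_inj {N v w : ℤ} (hv : Sampled N v) (hw : Sampled N w)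
    (h : sampleIndex N v = sampleIndex N w) : v = w := by
  obtain ⟨h0, hv⟩ := hv
  obtain ⟨h1, hw⟩ := hw
  unfold sampleIndex at h
  split_ifs at h <;> omega

/-- A move by three keeps the residue class, hence the half of the reduced string. So consecutive
names in the reduced string spell the suffix of `s` in steps of three characters. -/
theorem sampleIndex_add (N v e : ℤ) : sampleIndex N (v + 3 * e) = sampleIndex N v + e := by
  unfold sampleIndex
  split_ifs <;> omega

theorem pair_lt {a b a' b' Q : ℤ} (hQ : 0 ≤ Q) (hb : b < Q) (hb' : 0 ≤ b') (h : a < a') :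
    a * Q + b < a' * Q + b' := by nlinarith [mul_le_mul_of_nonneg_right (Int.add_one_le_iff.2 h) hQ]

/-- Characters are at most `N`, so triples are numerals in base `N + 1` and the first difference
decides. -/
theorem tripleCode_lt {s : ℤ → ℤ} {N v w d : ℤ} (hs : Padded s N) (hN : 0 ≤ N) (hv : 0 ≤ v)
    (hw : 0 ≤ w) (hd0 : 0 ≤ d) (hd : d < 3) (ha : Agree s v w d) (hlt : s (v + d) < s (w + d)) :
    tripleCode s (N + 1) v < tripleCode s (N + 1) w := by
  have b1 := hs.nonneg (i := w + 1) (by omega)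
  have b2 := hs.nonneg (i := w + 2) (by omega)
  have c1 := hs.le hN (i := v + 1) (by omega)
  have c2 := hs.le hN (i := v + 2) (by omega)
  unfold tripleCode
  have hcase : d = 0 ∨ d = 1 ∨ d = 2 := by omega
  rcases hcase with rfl | rfl | rfl
  · simp only [add_zero] at hlt
    refine pair_lt (by positivity) ?_ ?_ hlt
    · nlinarith
    · nlinarith
  · have h0 := ha 0 le_rfl (by norm_num)
    simp only [add_zero] at h0
    rw [h0]
    have := pair_lt (Q := N + 1) (b := s (v + 2) * 1 + 0) (b' := s (w + 2) * 1 + 0)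
      (by omega) (by omega) (by omega) hlt
    linarith
  · have h0 := ha 0 le_rfl (by norm_num)
    have h1 := ha 1 (by norm_num) (by norm_num)
    simp only [add_zero] at h0
    rw [h0, h1]
    linarith

theorem tripleCode_eq {s : ℤ → ℤ} {Q v w : ℤ} (ha : Agree s v w 3) :
    tripleCode s Q v = tripleCode s Q w := by
  have h0 := ha 0 le_rfl (by norm_num)
  have h1 := ha 1 (by norm_num) (by norm_num)
  have h2 := ha 2 (by norm_num) (by norm_num)
  simp only [add_zero] at h0
  rw [tripleCode, tripleCode, h0, h1, h2]

/-- If the suffixes first differ after `d` characters, the reduced ones agree on `d / 3` names and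
differ in the next. The comparison never runs from the first half of the reduced string into the
second: the smaller suffix may end first, and then either the extra sample at `N` (residue `1`) or
the padding behind the last half (residue `2`) supplies the smaller name. -/
theorem IsReduction.sufLt {s s' : ℤ → ℤ} {N v w : ℤ} (H : IsReduction s N s') (hs : Padded s N)
    (hv : Sampled N v) (hw : Sampled N w) (h : SufLt s v w) :
    SufLt s' (sampleIndex N v) (sampleIndex N w) := by
  obtain ⟨d, d0, ha, hd⟩ := h
  have hv0 := hv.1
  have hw0 := hw.1
  have hwN : w + d < N := hs.lt_of_pos (lt_of_le_of_lt (hs.nonneg (by omega)) hd)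
  have hvd : ∀ e, 0 ≤ e → e < d → v + e < N := fun e h0 h1 => hs.lt_of_pos (by
    rw [ha e h0 h1]; linarith [(hs.mem (w + e) (by omega) (by omega)).1])
  have hws : ∀ t, 0 ≤ t → 3 * t ≤ d → Sampled N (w + 3 * t) := fun t h0 h1 =>
    ⟨by omega, by have := hw.2; omega⟩
  have hvs : ∀ t, 0 ≤ t → 3 * t < d → Sampled N (v + 3 * t) := fun t h0 h1 =>
    ⟨by omega, by have := hv.2; have := hvd (3 * t) (by omega) h1; omega⟩
  refine ⟨d / 3, by omega, fun t h0 h1 => ?_, ?_⟩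
  · rw [← sampleIndex_add, ← sampleIndex_add]
    refine H.eq _ _ (hvs t h0 (by omega)) (hws t h0 (by omega)) (tripleCode_eq fun e g0 g1 => ?_)
    have := ha (3 * t + e) (by omega) (by omega)
    rwa [← add_assoc, ← add_assoc] at this
  · rw [← sampleIndex_add, ← sampleIndex_add]
    have hw' := hws (d / 3) (by omega) (by omega)
    by_cases hv' : Sampled N (v + 3 * (d / 3))
    · refine H.lt _ _ hv' hw' (tripleCode_lt (d := d % 3) hs (by omega) (by omega) (by omega)
        (by omega) (by omega) (fun e g0 g1 => ?_) ?_)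
      · have := ha (3 * (d / 3) + e) (by omega) (by omega)
        rwa [← add_assoc, ← add_assoc] at this
      · rwa [show v + 3 * (d / 3) + d % 3 = v + d by omega,
          show w + 3 * (d / 3) + d % 3 = w + d by omega]
    · have hd3 : 3 * (d / 3) = d := by
        by_contra hne
        exact hv' (hvs _ (by omega) (by omega))
      have hsmall : v + d ≤ N := by
        rcases eq_or_lt_of_le d0 with h | h
        · subst h; have := hv.2; omega
        · have := hvd (d - 1) (by omega) (by omega); omega
      -- The position reached from `v` can fail to be sampled only at the end of the string in class
      -- `2`; class `1` contains `N` itself.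
      have h2 : v % 3 = 2 ∧ v + d = N := by
        by_contra hcon
        exact hv' ⟨by omega, by have := hv.2; omega⟩
      have hidx : sampleIndex N (v + 3 * (d / 3)) = reducedLength N := by
        rw [hd3, h2.2]
        unfold sampleIndex reducedLength
        rw [if_neg (by omega)]
      rw [hidx, H.padded.zero _ le_rfl]
      linarith [(H.padded.mem _ hw'.index_mem.1 hw'.index_mem.2).1]

/-- `sr` orders the sampled suffixes. -/
structure SampleRank (s : ℤ → ℤ) (N : ℤ) (sr : ℤ → ℤ) : Prop where
  mem : ∀ v, 0 ≤ v → v ≤ N + 2 → 0 ≤ sr v ∧ sr v ≤ N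
  lt : ∀ v w, 0 ≤ v → v ≤ N → v % 3 ≠ 0 → 0 ≤ w → w ≤ N → w % 3 ≠ 0 → SufLt s v w → sr v < sr w

/-- Cells that are not sampled hold `0`. Among positions up to `N` outside the multiples of three
this concerns only the empty suffix, which is smaller than every other, whereas true ranks start at
`1`. -/
theorem IsReduction.sampleRank {s s' r' sr : ℤ → ℤ} {N : ℤ} (H : IsReduction s N s')
    (hs : Padded s N) (hN : 1 ≤ N) (hr : IsRank s' (reducedLength N) r')
    (h : ∀ v, Sampled N v → sr v = r' (sampleIndex N v))
    (h0 : ∀ v, 0 ≤ v → v ≤ N + 2 → ¬ Sampled N v → sr v = 0) : SampleRank s N sr := by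
  have hle : reducedLength N ≤ N := by unfold reducedLength; omega
  refine ⟨fun v hv0 hv => ?_, fun v w hv0 hvN hv3 hw0 hwN hw3 hlt => ?_⟩
  · by_cases hS : Sampled N v
    · rw [h v hS]
      have := hr.mem _ hS.index_mem.1 hS.index_mem.2
      omega
    · rw [h0 v hv0 hv hS]; omega
  · have hw' : w < N := by
      obtain ⟨d, d0, ha, hd⟩ := hlt
      have := hs.lt_of_pos (lt_of_le_of_lt (hs.nonneg (by omega)) hd)
      omega
    have hwS : Sampled N w := ⟨hw0, by omega⟩
    have hwm := hr.mem _ hwS.index_mem.1 hwS.index_mem.2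
    by_cases hS : Sampled N v
    · rw [h v hS, h w hwS]
      exact hr.lt _ _ hS.index_mem.1 hS.index_mem.2 hwS.index_mem.1 hwS.index_mem.2
        (H.sufLt hs hS hwS hlt)
    · rw [h0 v hv0 (by omega) hS, h w hwS]; omega

section
variable {s sr : ℤ → ℤ} {N i j : ℤ}

/-- For residues `0` and `1` the next position has residue `1` or `2`, so one character and a known
rank decide. This compares a multiple of three with a sample of residue `1`, and multiples of three
with each other. -/
theorem SampleRank.pair_lt (H : SampleRank s N sr) (hs : Padded s N) (hi : 0 ≤ i)
    (hiN : i ≤ N) (hj : 0 ≤ j) (hjN : j ≤ N) (hi3 : i % 3 ≠ 2) (hj3 : j % 3 ≠ 2) {F : ℤ}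
    (hF : ∀ v, 0 ≤ v → v ≤ N + 2 → sr v < F)
    (h : SufLt s i j) : s i * F + sr (i + 1) < s j * F + sr (j + 1) := by
  rcases eq_or_lt_of_le h.le with he | hl
  · have h' := (sufLt_succ he).2 h
    have hjN : j < N := by
      obtain ⟨d, d0, ha, hd⟩ := h
      have := hs.lt_of_pos (lt_of_le_of_lt (hs.nonneg (by omega)) hd)
      omega
    have hiN : i < N := hs.lt_of_pos (by rw [he]; linarith [(hs.mem j hj hjN).1])
    have := H.lt _ _ (by omega) (by omega) (by omega) (by omega) (by omega) (by omega) h'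
    rw [he]; linarith
  · exact _root_.pair_lt ((H.mem 0 le_rfl (by omega)).1.trans (hF 0 le_rfl (by omega)).le)
      (hF _ (by omega) (by omega)) (H.mem _ (by omega) (by omega)).1 hl

/-- For residues `0` and `2` the position two further on has residue `2` or `1`, so two characters
and a known rank decide. This compares a multiple of three with a sample of residue `2`. -/
theorem SampleRank.triple_lt (H : SampleRank s N sr) (hs : Padded s N) (hN : 0 ≤ N) (hi : 0 ≤ i)
    (hiN : i ≤ N) (hj : 0 ≤ j) (hjN : j ≤ N) (hi3 : i % 3 ≠ 1) (hj3 : j % 3 ≠ 1)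
    (h : SufLt s i j) :
    (s i * (N + 1) + s (i + 1)) * (N + 1) + sr (i + 2)
      < (s j * (N + 1) + s (j + 1)) * (N + 1) + sr (j + 2) := by
  have hj' : j < N := by
    obtain ⟨d, d0, ha, hd⟩ := h
    have := hs.lt_of_pos (lt_of_le_of_lt (hs.nonneg (by omega)) hd)
    omega
  have g1 := H.mem (i + 2) (by omega) (by omega)
  have g2 := H.mem (j + 2) (by omega) (by omega)
  have g3 := hs.le hN (i := i + 1) (by omega)
  have g4 := hs.nonneg (i := j + 1) (by omega)
  rcases eq_or_lt_of_le h.le with he | hl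
  · have h' := (sufLt_succ he).2 h
    have hi' : i < N := hs.lt_of_pos (by rw [he]; linarith [(hs.mem j hj hj').1])
    rcases eq_or_lt_of_le h'.le with he' | hl'
    · have h'' := (sufLt_succ he').2 h'
      rw [add_assoc, add_assoc] at h''
      have hj1 : j + 1 < N := by
        obtain ⟨d, d0, ha, hd⟩ := h'
        have := hs.lt_of_pos (lt_of_le_of_lt (hs.nonneg (by omega)) hd)
        omega
      have hi1 : i + 1 < N :=
        hs.lt_of_pos (by rw [he']; linarith [(hs.mem (j + 1) (by omega) hj1).1])
      have := H.lt _ _ (by omega) (by omega) (by omega) (by omega) (by omega) (by omega) h''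
      rw [he, he']
      norm_num at this ⊢
      linarith
    · refine _root_.pair_lt (by omega) (by omega) g2.1 ?_
      rw [he]; linarith
  · refine _root_.pair_lt (by omega) (by omega) g2.1 ?_
    exact _root_.pair_lt (by omega) (by omega) g4 hl

end

/-! ### Reducing a string to its sampled suffixes -/

namespace RAM

open RAM.Expr RAM.Program

/-- List the sampled positions in array `6`. -/
def listSample : Program :=
  forLoop 20 (reg 10)
    (cond ((reg 20).less (reg 14)) (store 6 (reg 20) (3 * reg 20 + 1))
      (store 6 (reg 20) (3 * (reg 20 - reg 14) + 2)))

/-- Name the triples of the level with base address in register `11` at the positions sorted in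
array `7`; the names form the next level. -/
def nameTriples : Program :=
  assign 24 0 ;;
  assign 25 (const (-1)) ;;
  forLoop 20 (reg 10)
    (assign 21 (cell 7 (reg 20)) ;;
     assign 23 (cell 4 (reg 11 + reg 21) * ((reg 13 + 1) * (reg 13 + 1)) +
       (cell 4 (reg 11 + reg 21 + 1) * (reg 13 + 1) + cell 4 (reg 11 + reg 21 + 2))) ;;
     assign 24 (reg 24 + (1 - (reg 23).equal (reg 25))) ;;
     assign 25 (reg 23) ;;
     store 4 (reg 11 + reg 3 + ((1 - (reg 21 % 3).equal 1) * reg 14 + reg 21 / 3)) (reg 24))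

/-- Build the next level from the level whose number is in register `5`. -/
def descend : Program :=
  assign 13 (cell 5 (reg 5)) ;;
  assign 11 (reg 5 * reg 3) ;;
  assign 14 ((reg 13 + 2) / 3) ;;
  assign 10 (reg 14 + reg 13 / 3) ;;
  assign 12 (reg 13) ;;
  listSample ;;
  radixPass 4 6 7 2 ;;
  radixPass 4 7 6 1 ;;
  radixPass 4 6 7 0 ;;
  nameTriples ;;
  store 5 (reg 5 + 1) (reg 10) ;;
  assign 5 (reg 5 + 1)

section
variable {B : ℤ} {s : State} {τ : ℤ}

theorem listSample_spec {N : ℤ} (hN : 1 ≤ N) (hNB : N + 5 ≤ B) (h10 : s.reg 10 = reducedLength N)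
    (h14 : s.reg 14 = (N + 2) / 3) :
    wp B listSample s τ (fun s' τ' => τ' ≤ τ + 40 * (N + 1) ∧
      Listing (Sampled N) (s'.arr 6) (reducedLength N)) := by
  have hle : reducedLength N ≤ N := by unfold reducedLength; omega
  have hnn : 0 ≤ reducedLength N := by unfold reducedLength; omega
  unfold listSample
  refine wp_for (reducedLength N) (fun i s' τ' => τ' ≤ τ + 2 + 30 * i ∧
    ∀ t, 0 ≤ t → t < i → s'.arr 6 t =
      if t < (N + 2) / 3 then 3 * t + 1 else 3 * (t - (N + 2) / 3) + 2)
    hnn (by omega) (by simp) ?_ ?_ ?_ ?_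
  · intro s' hf; simp [hf.1 10 (by simp), h10]
  · exact ⟨by simp, fun t h0 h1 => by omega⟩
  · rintro i s' τ' hi0 hin hxi hf ⟨hτ, hI⟩
    have f14 := hf.1 14 (by simp)
    have hup : ∀ t, 0 ≤ t → t ≤ i → ¬ t = i → s'.arr 6 t =
      if t < (N + 2) / 3 then 3 * t + 1 else 3 * (t - (N + 2) / 3) + 2 :=
      fun t h0 h1 h2 => hI t h0 (by omega)
    simp only [wp_cond, wp_store]
    simp [Function.update_apply, hxi, f14, h14]
    unfold reducedLength at hle hin
    refine ⟨fun hlt => ⟨⟨by omega, by omega⟩, by omega, fun t h0 h1 => ?_⟩,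
      fun hge => ⟨⟨by omega, by omega⟩, by omega, fun t h0 h1 => ?_⟩⟩
    · by_cases h : t = i
      · subst h; simp [hlt]
      · rw [if_neg h]; exact hup t h0 h1 h
    · by_cases h : t = i
      · subst h; simp [not_lt.2 hge]
      · rw [if_neg h]; exact hup t h0 h1 h
  · rintro s' τ' hx hf ⟨hτ, hI⟩
    unfold reducedLength at *
    simp only [cost_reg]
    refine ⟨by push_cast; omega, ⟨fun p h0 h1 => ?_, fun v hv => ?_, fun p q h0 h1 h2 => ?_⟩⟩
    · rw [hI p h0 h1]
      split_ifs
      · exact ⟨by omega, by omega⟩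
      · exact ⟨by omega, by omega⟩
    · obtain ⟨hv0, hv⟩ := hv
      by_cases h3 : v % 3 = 1
      · exact ⟨v / 3, by omega, by omega, by
          rw [hI _ (by omega) (by omega), if_pos (by omega)]; omega⟩
      · exact ⟨(N + 2) / 3 + v / 3, by omega, by omega, by
          rw [hI _ (by omega) (by omega), if_neg (by omega)]; omega⟩
    · rw [hI p h0 (by omega), hI q (by omega) h2]
      split_ifs <;> omega

theorem le_cube {Z : ℤ} (hZ : 0 ≤ Z) : Z ≤ Z * Z * Z := by
  rcases eq_or_lt_of_le hZ with h | h
  · rw [← h]; norm_num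
  · have : 1 ≤ Z * Z := by nlinarith
    nlinarith

theorem tripleCode_bounds {σ : ℤ → ℤ} {N v : ℤ} (hσ : Padded σ N) (hN : 0 ≤ N) (hv : 0 ≤ v) :
    0 ≤ tripleCode σ (N + 1) v ∧ tripleCode σ (N + 1) v < (N + 1) * (N + 1) * (N + 1) := by
  have a0 := hσ.nonneg hv
  have a1 := hσ.nonneg (i := v + 1) (by omega)
  have a2 := hσ.nonneg (i := v + 2) (by omega)
  have b0 := hσ.le hN hv
  have b1 := hσ.le hN (i := v + 1) (by omega)
  have b2 := hσ.le hN (i := v + 2) (by omega)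
  unfold tripleCode
  refine ⟨by positivity, ?_⟩
  have h1 : σ v * ((N + 1) * (N + 1)) ≤ N * ((N + 1) * (N + 1)) :=
    mul_le_mul_of_nonneg_right b0 (by positivity)
  have h2 : σ (v + 1) * (N + 1) ≤ N * (N + 1) := mul_le_mul_of_nonneg_right b1 (by positivity)
  nlinarith

/-- In sorted order equal triples are adjacent, so the name is the number of distinct triples seen
so far; it rises exactly when the code differs from the last one. Only the names are written: the
padding of the new level consists of cells that were zero before. -/
theorem nameTriples_spec {σ : ℤ → ℤ} {N Z b : ℤ} (hσ : Padded σ N) (hN : 1 ≤ N) (hNZ : N + 5 ≤ Z)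
    (hB : Z * Z * Z ≤ B) (h3 : s.reg 3 = Z) (h10 : s.reg 10 = reducedLength N)
    (h11 : s.reg 11 = b) (h13 : s.reg 13 = N) (h14 : s.reg 14 = (N + 2) / 3)
    (h4 : ∀ i, 0 ≤ i → i < Z → s.arr 4 (b + i) = σ i)
    (h4' : ∀ i, 0 ≤ i → s.arr 4 (b + Z + i) = 0)
    (h7 : Listing (Sampled N) (s.arr 7) (reducedLength N))
    (hsort : SortedBy (tripleCode σ (N + 1)) (s.arr 7) (reducedLength N)) :
    wp B nameTriples s τ (fun s' τ' => τ' ≤ τ + 100 * (N + 1) ∧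
      IsReduction σ N (fun i => s'.arr 4 (b + Z + i)) ∧
      ∀ p, p < b + Z → s'.arr 4 p = s.arr 4 p) := by
  have hle : reducedLength N ≤ N := by unfold reducedLength; omega
  have hnn : 0 ≤ reducedLength N := by unfold reducedLength; omega
  have hZB : Z ≤ B := (le_cube (by omega)).trans hB
  have hQB : (N + 1) * (N + 1) * (N + 1) ≤ Z * Z * Z := by
    have h1 : N + 1 ≤ Z := by omega
    have h0 : 0 ≤ N + 1 := by omega
    have h2 : 0 ≤ Z := by omega
    gcongr
  set f := tripleCode σ (N + 1) with hfdef
  set Y := s.arr 7 with hYdef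
  simp only [nameTriples, wp_seq, wp_assign]
  refine ⟨by simp; omega, by simp; omega, ?_⟩
  refine wp_for (reducedLength N) (fun t s' τ' => τ' ≤ τ + 10 + 80 * t ∧
    (0 ≤ s'.reg 24 ∧ s'.reg 24 ≤ t) ∧ (t = 0 → s'.reg 25 = -1) ∧
    (0 < t → s'.reg 25 = f (Y (t - 1))) ∧
    (∀ u, 0 ≤ u → u < t → 1 ≤ s'.arr 4 (b + Z + sampleIndex N (Y u)) ∧
      s'.arr 4 (b + Z + sampleIndex N (Y u)) ≤ s'.reg 24) ∧
    (∀ u, 0 ≤ u → u < t → f (Y u) = s'.reg 25 →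
      s'.arr 4 (b + Z + sampleIndex N (Y u)) = s'.reg 24) ∧
    (∀ u u', 0 ≤ u → u < t → 0 ≤ u' → u' < t → f (Y u) < f (Y u') →
      s'.arr 4 (b + Z + sampleIndex N (Y u)) < s'.arr 4 (b + Z + sampleIndex N (Y u'))) ∧
    (∀ u u', 0 ≤ u → u < t → 0 ≤ u' → u' < t → f (Y u) = f (Y u') →
      s'.arr 4 (b + Z + sampleIndex N (Y u)) = s'.arr 4 (b + Z + sampleIndex N (Y u'))) ∧
    (∀ p, p < b + Z → s'.arr 4 p = s.arr 4 p) ∧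
    (∀ i, reducedLength N ≤ i → s'.arr 4 (b + Z + i) = 0))
    hnn (by omega) (by simp) ?_ ?_ ?_ ?_
  · intro s' hf; simp [hf.1 10 (by simp), h10]
  · refine ⟨by simp; omega, by simp, by simp, fun h => by omega, fun u _ _ => by omega,
      fun u _ _ => by omega, fun u u' _ _ _ => by omega, fun u u' _ _ _ => by omega,
      fun p _ => by simp, fun i hi => by simpa using h4' i (by omega)⟩
  · rintro t s' τ' ht0 htn hxt hf ⟨hτ, hc, hl0, hl, hg, hgl, hlt, heq, hlow, hhigh⟩
    have f3 := hf.1 3 (by simp)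
    have f11 := hf.1 11 (by simp)
    have f13 := hf.1 13 (by simp)
    have f14 := hf.1 14 (by simp)
    have f7 := hf.2 7 (by simp)
    simp at f3 f11 f13 f14 f7
    rw [← hYdef] at f7
    have hv : Sampled N (Y t) := h7.mem t ht0 htn
    have hv0 := hv.1
    have hvN : Y t ≤ N := by have := hv.2; omega
    have hcode : s'.arr 4 (b + Y t) * ((N + 1) * (N + 1)) +
       (s'.arr 4 (b + Y t + 1) * (N + 1) + s'.arr 4 (b + Y t + 2)) = f (Y t) := by
      rw [hlow _ (by omega), hlow _ (by omega), hlow _ (by omega), h4 _ (by omega) (by omega),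
        add_assoc b, h4 _ (by omega) (by omega), add_assoc b, h4 _ (by omega) (by omega)]
      simp only [hfdef, tripleCode]; ring
    have hidx : (1 - if Y t % 3 = 1 then 1 else 0) * ((N + 2) / 3) + Y t / 3
        = sampleIndex N (Y t) := by
      unfold sampleIndex; split_ifs <;> ring
    have hfb := tripleCode_bounds hσ (by omega) hv0
    rw [← hfdef] at hfb
    have him := hv.index_mem
    have hne : ∀ u, 0 ≤ u → u < t → sampleIndex N (Y u) ≠ sampleIndex N (Y t) :=
      fun u h0 h1 h => h7.inj u t h0 h1 htn ((h7.mem u h0 (by omega)).index_inj hv h)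
    have hmono : ∀ u, 0 ≤ u → u < t → f (Y u) ≤ f (Y t) := fun u h0 h1 => hsort u t h0 h1 htn
    simp only [wp_seq, wp_assign, wp_store]
    simp only [eval_reg, eval_cell, eval_add, eval_sub, eval_mul, eval_div, eval_mod, eval_equal,
      eval_one, eval_ofNat, State.reg_setReg, State.arr_setReg, hxt, f3, f11, f13, f14, f7, h11,
      h13, h14, h3, if_true, cost_reg, cost_cell, cost_add, cost_sub, cost_mul, cost_div, cost_mod,
      cost_equal, cost_one, cost_ofNat]
    norm_num only [if_true, if_false]
    rw [hcode, hidx]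
    simp only [State.reg_setArr, State.arr_setArr, State.reg_setReg, State.arr_setReg]
    norm_num only [if_true, if_false]
    simp only [Function.update_apply, add_right_inj]
    have hval : ∀ u, 0 ≤ u → u < t → (if sampleIndex N (Y u) = sampleIndex N (Y t) then
        s'.reg 24 + (1 - if f (Y t) = s'.reg 25 then 1 else 0) else
        s'.arr 4 (b + Z + sampleIndex N (Y u))) = s'.arr 4 (b + Z + sampleIndex N (Y u)) :=
      fun u h0 h1 => if_neg (hne u h0 h1)
    have hstep : ∀ u, 0 ≤ u → u < t + 1 → u < t ∨ u = t := fun u _ _ => by omega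
    have hc' : 0 ≤ s'.reg 24 + (1 - if f (Y t) = s'.reg 25 then 1 else 0) ∧
        s'.reg 24 + (1 - if f (Y t) = s'.reg 25 then 1 else 0) ≤ t + 1 ∧
        s'.reg 24 ≤ s'.reg 24 + (1 - if f (Y t) = s'.reg 25 then 1 else 0) := by
      split_ifs <;> omega
    have hlast : ∀ u, 0 ≤ u → u < t → f (Y u) ≤ s'.reg 25 := by
      intro u h0 h1
      rw [hl (by omega)]
      rcases eq_or_lt_of_le (show u ≤ t - 1 by omega) with h | h
      · rw [h]
      · exact hsort u (t - 1) h0 h (by omega)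
    have hnew : 1 ≤ s'.reg 24 + (1 - if f (Y t) = s'.reg 25 then 1 else 0) := by
      split_ifs with h
      · rcases eq_or_lt_of_le ht0 with h' | h'
        -- The first triple always counts as new, because no code equals the initial value `-1`.
        · rw [hl0 h'.symm] at h; omega
        · have := (hg (t - 1) (by omega) (by omega))
          omega
      · omega
    have hlt' : ∀ u, 0 ≤ u → u < t → f (Y u) < f (Y t) →
        s'.arr 4 (b + Z + sampleIndex N (Y u)) <
        s'.reg 24 + (1 - if f (Y t) = s'.reg 25 then 1 else 0) := by
      intro u h0 h1 h2
      split_ifs with h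
      · have e1 := hl (by omega)
        have := hlt u (t - 1) h0 h1 (by omega) (by omega) (by rw [← e1, ← h]; exact h2)
        rw [hgl (t - 1) (by omega) (by omega) e1.symm] at this
        omega
      · have := hg u h0 h1; omega
    have heq' : ∀ u, 0 ≤ u → u < t → f (Y u) = f (Y t) →
        s'.arr 4 (b + Z + sampleIndex N (Y u)) =
        s'.reg 24 + (1 - if f (Y t) = s'.reg 25 then 1 else 0) := by
      intro u h0 h1 h2
      rw [if_pos, hgl u h0 h1]
      · omega
      · have := hlast u h0 h1; have := hmono u h0 h1
        have hle' : s'.reg 25 ≤ f (Y t) := by rw [hl (by omega)]; exact hmono _ (by omega) (by omega)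
        omega
      · have := hlast u h0 h1; have := hmono u h0 h1
        have hle' : s'.reg 25 ≤ f (Y t) := by rw [hl (by omega)]; exact hmono _ (by omega) (by omega)
        omega
    refine ⟨by omega, by omega, by omega, by omega, by omega, by omega,
      ⟨hc'.1, hc'.2.1⟩, fun h => by omega, fun _ => by rw [show t + 1 - 1 = t by ring],
      fun u h0 h1 => ?_, fun u h0 h1 h2 => ?_, fun u u' h0 h1 h0' h1' h2 => ?_,
      fun u u' h0 h1 h0' h1' h2 => ?_, fun p hp => ?_, fun i hi => ?_⟩
    · rcases hstep u h0 h1 with h | h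
      · rw [hval u h0 h]; have := hg u h0 h; omega
      · rw [h, if_pos rfl]; exact ⟨hnew, le_rfl⟩
    · rcases hstep u h0 h1 with h | h
      · rw [hval u h0 h]; exact heq' u h0 h h2
      · rw [h, if_pos rfl]
    · rcases hstep u h0 h1 with h | h <;> rcases hstep u' h0' h1' with h' | h'
      · rw [hval u h0 h, hval u' h0' h']; exact hlt u u' h0 h h0' h' h2
      · rw [hval u h0 h, h', if_pos rfl]; rw [h'] at h2; exact hlt' u h0 h h2
      · rw [h] at h2; have := hmono u' h0' h'; omega
      · rw [h, h'] at h2; omega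
    · rcases hstep u h0 h1 with h | h <;> rcases hstep u' h0' h1' with h' | h'
      · rw [hval u h0 h, hval u' h0' h']; exact heq u u' h0 h h0' h' h2
      · rw [hval u h0 h, h', if_pos rfl]; rw [h'] at h2; exact heq' u h0 h h2
      · rw [hval u' h0' h', h, if_pos rfl]; rw [h] at h2; exact (heq' u' h0' h' h2.symm).symm
      · rw [h, h']
    · rw [if_neg (by omega)]; exact hlow p hp
    · rw [if_neg (by omega)]; exact hhigh i hi
  · rintro s' τ' hx hf ⟨hτ, hc, hl0, hl, hg, hgl, hlt, heq, hlow, hhigh⟩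
    simp only [cost_reg]
    have hpos : ∀ v, Sampled N v → ∃ u, 0 ≤ u ∧ u < reducedLength N ∧ Y u = v := h7.surj
    refine ⟨by push_cast; omega, ⟨⟨hhigh, fun i h0 h1 => ?_⟩, fun v w hv hw h => ?_,
      fun v w hv hw h => ?_⟩, hlow⟩
    · have : ∃ v, Sampled N v ∧ sampleIndex N v = i := by
        unfold reducedLength at h1
        by_cases h : i < (N + 2) / 3
        · exact ⟨3 * i + 1, ⟨by omega, by omega⟩, by unfold sampleIndex; split_ifs <;> omega⟩
        · exact ⟨3 * (i - (N + 2) / 3) + 2, ⟨by omega, by omega⟩, by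
            unfold sampleIndex; split_ifs <;> omega⟩
      obtain ⟨v, hv, rfl⟩ := this
      obtain ⟨u, hu0, hu, rfl⟩ := hpos v hv
      have := hg u hu0 hu
      omega
    · obtain ⟨u, hu0, hu, rfl⟩ := hpos v hv
      obtain ⟨u', hu0', hu', rfl⟩ := hpos w hw
      exact hlt u u' hu0 hu hu0' hu' h
    · obtain ⟨u, hu0, hu, rfl⟩ := hpos v hv
      obtain ⟨u', hu0', hu', rfl⟩ := hpos w hw
      exact heq u u' hu0 hu hu0' hu' h

end

end RAM

/-! ### The tower of reduced strings: the recursion unrolled into a loop -/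

namespace RAM

open RAM.Expr RAM.Program

/-- The string stored at level `e` of array contents `A`, with levels `Z` cells apart. -/
def level (A : ℤ → ℤ) (Z e : ℤ) : ℤ → ℤ := fun i => if 0 ≤ i ∧ i < Z then A (e * Z + i) else 0

/-- Levels `0, …, l` form a tower of reductions; `A` holds the strings and `L` their lengths. -/
structure Tower (A L : ℤ → ℤ) (Z N l : ℤ) : Prop where
  length_zero : L 0 = N
  padded : ∀ e, 0 ≤ e → e ≤ l → Padded (level A Z e) (L e)
  le : ∀ e, 0 ≤ e → e ≤ l → 0 ≤ L e ∧ e + L e ≤ N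
  two_le : ∀ e, 0 ≤ e → e < l → 2 ≤ L e
  length_succ : ∀ e, 0 ≤ e → e < l → L (e + 1) = reducedLength (L e)
  reduction : ∀ e, 0 ≤ e → e < l → IsReduction (level A Z e) (L e) (level A Z (e + 1))

theorem _root_.IsReduction.congr {s s' t' : ℤ → ℤ} {N : ℤ} (H : IsReduction s N s') (hN : 0 ≤ N)
    (h : ∀ i, 0 ≤ i → t' i = s' i) : IsReduction s N t' := by
  have hnn : 0 ≤ reducedLength N := by unfold reducedLength; omega
  refine ⟨⟨fun i hi => ?_, fun i h0 h1 => ?_⟩, fun v w hv hw hlt => ?_, fun v w hv hw he => ?_⟩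
  · rw [h i (by omega)]; exact H.padded.zero i hi
  · rw [h i h0]; exact H.padded.mem i h0 h1
  · rw [h _ hv.index_mem.1, h _ hw.index_mem.1]; exact H.lt v w hv hw hlt
  · rw [h _ hv.index_mem.1, h _ hw.index_mem.1]; exact H.eq v w hv hw he

/-- The drop in length is at least a quarter of the length. Work linear in the length of a level can
therefore be charged to the drop, and the charges telescope. -/
theorem reducedLength_lt {n : ℤ} (hn : 2 ≤ n) :
    reducedLength n + 1 ≤ n ∧ n ≤ 4 * (n - reducedLength n) := by
  unfold reducedLength
  rcases lt_or_ge n 8 with h | h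
  · interval_cases n <;> norm_num
  · omega

theorem level_congr {A A' : ℤ → ℤ} {Z e l : ℤ} (hZ : 0 ≤ Z) (he : e ≤ l)
    (h : ∀ p, p < (l + 1) * Z → A' p = A p) : level A' Z e = level A Z e := by
  funext i
  unfold level
  split_ifs with hi
  · refine h _ ?_
    have : e * Z ≤ l * Z := mul_le_mul_of_nonneg_right he hZ
    rw [add_mul, one_mul]; omega
  · rfl

/-- All new characters lie above the old levels, which stay as they are. A reduction loses at least
one character, so `e + L e ≤ N` persists; this also bounds the number of levels. -/
theorem Tower.push {A A' L L' : ℤ → ℤ} {Z N l : ℤ} (H : Tower A L Z N l) (hl : 0 ≤ l) (hZ : 0 ≤ Z)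
    (h2 : 2 ≤ L l) (hA : ∀ p, p < (l + 1) * Z → A' p = A p) (hL : ∀ e, e ≠ l + 1 → L' e = L e)
    (hL' : L' (l + 1) = reducedLength (L l))
    (hred : IsReduction (level A Z l) (L l) (level A' Z (l + 1))) :
    Tower A' L' Z N (l + 1) := by
  have hle := H.le l hl le_rfl
  refine ⟨?_, fun e h0 h1 => ?_, fun e h0 h1 => ?_, fun e h0 h1 => ?_, fun e h0 h1 => ?_,
    fun e h0 h1 => ?_⟩
  · rw [hL 0 (by omega)]; exact H.length_zero
  · rcases eq_or_lt_of_le h1 with h | h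
    · subst h; rw [hL']; exact hred.padded
    · rw [level_congr hZ (by omega) hA, hL e (by omega)]; exact H.padded e h0 (by omega)
  · rcases eq_or_lt_of_le h1 with h | h
    · subst h; rw [hL']; unfold reducedLength; omega
    · rw [hL e (by omega)]; exact H.le e h0 (by omega)
  · rw [hL e (by omega)]
    rcases eq_or_lt_of_le (show e ≤ l by omega) with h | h
    · rw [h]; exact h2
    · exact H.two_le e h0 h
  · rw [hL e (by omega)]
    rcases eq_or_lt_of_le (show e ≤ l by omega) with h | h
    · rw [h, hL']
    · rw [hL _ (by omega)]; exact H.length_succ e h0 h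
  · rw [level_congr hZ (by omega) hA, hL e (by omega)]
    rcases eq_or_lt_of_le (show e ≤ l by omega) with h | h
    · rw [h]; exact hred
    · rw [level_congr hZ (by omega) hA]; exact H.reduction e h0 h

@[simp] theorem regs_radixPass (ka src dst : ℕ) (off : ℤ) : (radixPass ka src dst off).regs =
    [20, 20, 20, 21, 20, 22, 20, 23, 22, 20, 20, 21, 20] := rfl
@[simp] theorem arrs_radixPass (ka src dst : ℕ) (off : ℤ) : (radixPass ka src dst off).arrs =
    [8, 8, 8, dst, 8] := rfl
@[simp] theorem regs_listSample : listSample.regs = [20, 20] := rfl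
@[simp] theorem arrs_listSample : listSample.arrs = [6, 6] := rfl
@[simp] theorem regs_nameTriples :
    nameTriples.regs = [24, 25, 20, 21, 23, 24, 25, 20] := rfl
@[simp] theorem arrs_nameTriples : nameTriples.arrs = [4] := rfl

/-- Build all levels. -/
def descendAll : Program :=
  assign 5 0 ;; loop ((1 : Expr).less (cell 5 (reg 5))) descend

section
variable {B : ℤ} {s : State} {τ : ℤ}

/-- Sort the sampled positions by their triples and name the triples. The distance `Z ≥ N + 5`
between levels leaves room for the padding that triples near the end read. -/
theorem descend_spec {σ : ℤ → ℤ} {N Z l : ℤ} (hσ : Padded σ N) (hN : 2 ≤ N) (hNZ : N + 5 ≤ Z)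
    (hB : Z * Z * Z ≤ B) (hl : 0 ≤ l) (hlZ : l < Z) (h3 : s.reg 3 = Z) (h5 : s.reg 5 = l)
    (hN5 : s.arr 5 l = N) (h4 : ∀ i, 0 ≤ i → i < Z → s.arr 4 (l * Z + i) = σ i)
    (h4' : ∀ i, 0 ≤ i → s.arr 4 (l * Z + Z + i) = 0) :
    wp B descend s τ (fun s' τ' => τ' ≤ τ + 1500 * (N + 1) ∧ s'.reg 5 = l + 1 ∧
      IsReduction σ N (fun i => s'.arr 4 (l * Z + Z + i)) ∧
      (∀ p, p < l * Z + Z → s'.arr 4 p = s.arr 4 p) ∧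
      s'.arr 5 = Function.update (s.arr 5) (l + 1) (reducedLength N)) := by
  have hle : reducedLength N ≤ N := by unfold reducedLength; omega
  have hnn : 0 ≤ reducedLength N := by unfold reducedLength; omega
  have hZB : Z ≤ B := (le_cube (by omega)).trans hB
  have hlB : l * Z ≤ B := by
    have h1 : l * Z ≤ Z * Z := mul_le_mul_of_nonneg_right hlZ.le (by omega)
    have h2 : Z * Z * 1 ≤ Z * Z * Z := mul_le_mul_of_nonneg_left (by omega) (mul_nonneg (by omega) (by omega))
    omega
  have hlB0 : 0 ≤ l * Z := mul_nonneg hl (by omega)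
  have hSB : ∀ v, Sampled N v → -B ≤ v ∧ v ≤ B := fun v hv => by
    have := hv.1; have := hv.2; omega
  have hkey : ∀ (s' : State) off, s'.reg 11 = l * Z → s'.arr 4 = s.arr 4 → 0 ≤ off → off ≤ 2 →
      ∀ v, Sampled N v → s'.arr 4 (s'.reg 11 + v + off) = σ (v + off) ∧ 0 ≤ σ (v + off) ∧
        σ (v + off) ≤ N := by
    intro s' off e11 e4 o0 o2 v hv
    have v0 := hv.1
    have v1 := hv.2
    rw [e11, e4, add_assoc, h4 _ (by omega) (by omega)]
    exact ⟨rfl, hσ.nonneg (by omega), hσ.le (by omega) (by omega)⟩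
  simp only [descend, wp_seq, wp_assign]
  simp only [eval_reg, eval_cell, eval_add, eval_mul, eval_div, eval_one, eval_ofNat,
    State.reg_setReg, State.arr_setReg, cost_reg, cost_cell, cost_add, cost_mul, cost_div,
    cost_ofNat, Nat.reduceEqDiff, if_true, if_false, h3, h5, hN5]
  refine ⟨by omega, by omega, by omega, by unfold reducedLength at hle; omega, by omega, ?_⟩
  refine wp_frame_mono (listSample_spec (N := N) (by omega) (by omega) (by simp [reducedLength])
    (by simp)) ?_
  rintro s₁ τ₁ hf₁ ⟨hτ₁, hX₁⟩
  have a3 : s₁.reg 3 = Z := by rw [hf₁.1 3 (by simp)]; simp [h3]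
  have a5 : s₁.reg 5 = l := by rw [hf₁.1 5 (by simp)]; simp [h5]
  have a10 : s₁.reg 10 = reducedLength N := by rw [hf₁.1 10 (by simp)]; simp [reducedLength]
  have a11 : s₁.reg 11 = l * Z := by rw [hf₁.1 11 (by simp)]; simp
  have a12 : s₁.reg 12 = N := by rw [hf₁.1 12 (by simp)]; simp
  have a13 : s₁.reg 13 = N := by rw [hf₁.1 13 (by simp)]; simp
  have a14 : s₁.reg 14 = (N + 2) / 3 := by rw [hf₁.1 14 (by simp)]; simp
  have b4 : s₁.arr 4 = s.arr 4 := by rw [hf₁.2 4 (by simp)]; simp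
  have b5 : s₁.arr 5 = s.arr 5 := by rw [hf₁.2 5 (by simp)]; simp
  clear hf₁
  -- Least significant character first. The scales `1`, `N + 1` and `(N + 1) * (N + 1)` make the
  -- accumulated key literally `tripleCode`, including its `* 1 + 0`.
  refine wp_frame_mono (radixPass_spec (n := reducedLength N) (K := N) (S := Sampled N)
    (key := fun v => σ (v + 2)) (f := fun _ => 0) (F := 1) (by simp) (by simp) (by simp) (by simp)
    (by simp) a10 a12 hnn (by omega) (by omega) (by omega) hX₁ hSB
    (hkey s₁ 2 a11 b4 (by simp) (by simp)) (fun _ _ _ _ _ => le_rfl) (by simp)) ?_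
  rintro s₂ τ₂ hf₂ ⟨hτ₂, hX₂, hS₂⟩
  replace a3 := (hf₂.1 3 (by simp)).trans a3
  replace a5 := (hf₂.1 5 (by simp)).trans a5
  replace a10 := (hf₂.1 10 (by simp)).trans a10
  replace a11 := (hf₂.1 11 (by simp)).trans a11
  replace a12 := (hf₂.1 12 (by simp)).trans a12
  replace a13 := (hf₂.1 13 (by simp)).trans a13
  replace a14 := (hf₂.1 14 (by simp)).trans a14
  replace b4 := (hf₂.2 4 (by simp)).trans b4
  replace b5 := (hf₂.2 5 (by simp)).trans b5
  clear hf₂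
  refine wp_frame_mono (radixPass_spec (n := reducedLength N) (K := N) (S := Sampled N)
    (key := fun v => σ (v + 1)) (F := N + 1) (by simp) (by simp) (by simp) (by simp)
    (by simp) a10 a12 hnn (by omega) (by omega) (by omega) hX₂ hSB
    (hkey s₂ 1 a11 b4 (by simp) (by simp)) hS₂ ?_) ?_
  · intro v hv
    have := (hkey s₂ 2 a11 b4 (by simp) (by simp) v hv).2
    omega
  rintro s₃ τ₃ hf₃ ⟨hτ₃, hX₃, hS₃⟩
  replace a3 := (hf₃.1 3 (by simp)).trans a3
  replace a5 := (hf₃.1 5 (by simp)).trans a5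
  replace a10 := (hf₃.1 10 (by simp)).trans a10
  replace a11 := (hf₃.1 11 (by simp)).trans a11
  replace a12 := (hf₃.1 12 (by simp)).trans a12
  replace a13 := (hf₃.1 13 (by simp)).trans a13
  replace a14 := (hf₃.1 14 (by simp)).trans a14
  replace b4 := (hf₃.2 4 (by simp)).trans b4
  replace b5 := (hf₃.2 5 (by simp)).trans b5
  clear hf₃
  refine wp_frame_mono (radixPass_spec (n := reducedLength N) (K := N) (S := Sampled N)
    (key := fun v => σ v) (F := (N + 1) * (N + 1)) (by simp) (by simp) (by simp) (by simp)
    (by simp) a10 a12 hnn (by omega) (by omega) (by omega) hX₃ hSB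
    (by simpa using hkey s₃ 0 a11 b4 (by simp) (by simp)) hS₃ ?_) ?_
  · intro v hv
    have h1 := (hkey s₃ 1 a11 b4 (by simp) (by simp) v hv).2
    have h2 := (hkey s₃ 2 a11 b4 (by simp) (by simp) v hv).2
    constructor
    · nlinarith
    · nlinarith
  rintro s₄ τ₄ hf₄ ⟨hτ₄, hX₄, hS₄⟩
  replace a3 := (hf₄.1 3 (by simp)).trans a3
  replace a5 := (hf₄.1 5 (by simp)).trans a5
  replace a10 := (hf₄.1 10 (by simp)).trans a10
  replace a11 := (hf₄.1 11 (by simp)).trans a11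
  replace a13 := (hf₄.1 13 (by simp)).trans a13
  replace a14 := (hf₄.1 14 (by simp)).trans a14
  replace b4 := (hf₄.2 4 (by simp)).trans b4
  replace b5 := (hf₄.2 5 (by simp)).trans b5
  clear hf₄
  refine wp_frame_mono (nameTriples_spec hσ (by omega) hNZ hB a3 a10 a11 a13 a14
    (by rw [b4]; exact h4) (by rw [b4]; exact h4') hX₄ hS₄) ?_
  rintro s₅ τ₅ hf₅ ⟨hτ₅, hred, hlow⟩
  replace a5 := (hf₅.1 5 (by simp)).trans a5
  replace a10 := (hf₅.1 10 (by simp)).trans a10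
  replace b5 := (hf₅.2 5 (by simp)).trans b5
  simp only [wp_store]
  simp [a5, a10, b5]
  rw [b4] at hlow
  refine ⟨⟨by omega, by omega⟩, ⟨by omega, by omega⟩, ?_, hred, hlow⟩
  omega

/-- The invariant bounds the time by a multiple of the length lost so far, `N` minus the current
length; `reducedLength_lt` pays for each round. The loop stops at length at most `1`, where ranking
is trivial. -/
theorem descendAll_spec {N Z : ℤ} (hN : 0 ≤ N) (hNZ : N + 5 ≤ Z)
    (hB : Z * Z * Z ≤ B) (h3 : s.reg 3 = Z) (hN5 : s.arr 5 0 = N)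
    (h4 : Padded (s.arr 4) N) :
    wp B descendAll s τ (fun s' τ' => τ' ≤ τ + 10000 * (N + 1) ∧ 0 ≤ s'.reg 5 ∧
      Tower (s'.arr 4) (s'.arr 5) Z N (s'.reg 5) ∧ s'.arr 5 (s'.reg 5) ≤ 1 ∧
      ∀ p, p < Z → s'.arr 4 p = s.arr 4 p) := by
  have hZB : Z ≤ B := (le_cube (by omega)).trans hB
  simp only [descendAll, wp_seq, wp_assign]
  refine ⟨by simp; omega, ?_⟩
  refine wp_loop (fun s' τ' => 0 ≤ s'.reg 5 ∧ Tower (s'.arr 4) (s'.arr 5) Z N (s'.reg 5) ∧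
    τ' ≤ τ + 2 + 10000 * (N - s'.arr 5 (s'.reg 5)) ∧
    (∀ i, s'.arr 5 (s'.reg 5) ≤ i → s'.arr 4 (s'.reg 5 * Z + i) = 0) ∧
    ∀ p, p < Z → s'.arr 4 p = s.arr 4 p) (τ + 2 + 10000 * N) ?_ ?_ ?_ ?_
  · simp only [eval_zero, State.reg_setReg, State.arr_setReg, if_true, cost_zero]
    refine ⟨le_rfl, ⟨hN5, fun e h0 h1 => ?_, fun e h0 h1 => ?_, fun e h0 h1 => by omega,
      fun e h0 h1 => by omega, fun e h0 h1 => by omega⟩, by push_cast; omega, fun i hi => ?_, fun p _ => trivial⟩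
    · have h : e = 0 := by omega
      subst h
      rw [hN5]
      refine ⟨fun i hi => ?_, fun i g0 g1 => ?_⟩
      · unfold level; split_ifs
        · simpa using h4.zero i hi
        · rfl
      · unfold level; rw [if_pos ⟨g0, by omega⟩]; simpa using h4.mem i g0 g1
    · have h : e = 0 := by omega
      subst h; omega
    · rw [hN5] at hi; simpa using h4.zero i hi
  · rintro s' τ' ⟨h5, hT, hτ, -⟩
    have := hT.le _ h5 le_rfl
    omega
  · rintro s' τ' hf ⟨h5, hT, hτ, hz, hlow⟩ hb
    rw [eval_less, flag_ne_zero] at hb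
    simp only [eval_one, eval_cell, eval_reg] at hb
    have hle := hT.le _ h5 le_rfl
    have e3 : s'.reg 3 = Z := by rw [hf.1 3 (by simp [descend])]; simp [h3]
    refine wp_frame_mono (descend_spec (hT.padded _ h5 le_rfl) (by omega) (by omega) hB h5 (by omega)
      e3 rfl rfl (fun i h0 h1 => by simp [level, h0, h1]) (fun i h0 => ?_)) ?_
    · rw [add_assoc]; exact hz _ (by omega)
    rintro s'' τ'' hf' ⟨hτ', g5, hred, hlow', hL⟩
    have hmul : (s'.reg 5 + 1) * Z = s'.reg 5 * Z + Z := by ring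
    have hr : reducedLength (s'.arr 5 (s'.reg 5)) + 1 ≤ s'.arr 5 (s'.reg 5) ∧
        s'.arr 5 (s'.reg 5) ≤
          4 * (s'.arr 5 (s'.reg 5) - reducedLength (s'.arr 5 (s'.reg 5))) :=
      reducedLength_lt hb
    have hL' : s''.arr 5 (s'.reg 5 + 1) = reducedLength (s'.arr 5 (s'.reg 5)) := by
      rw [hL]; simp
    rw [g5]
    refine ⟨by omega, hT.push h5 (by omega : 0 ≤ Z) (show 2 ≤ s'.arr 5 (s'.reg 5) from hb) (by rw [hmul]; exact hlow')
      (fun e he => by rw [hL]; simp [he]) hL' (hred.congr (by omega) fun i hi => ?_), ?_, ?_, ?_⟩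
    · unfold level
      rw [hmul]
      split_ifs with h
      · rfl
      · exact (hred.padded.zero i (by omega)).symm
    · rw [hL']
      simp only [cost_less, cost_one, cost_cell, cost_reg] at hτ'
      push_cast at hτ'
      omega
    · rw [hL', hmul]; exact hred.padded.zero
    · intro p hp
      rw [hlow' p (by have := mul_nonneg h5 (show 0 ≤ Z by omega); omega), hlow p hp]
  · rintro s' τ' hf ⟨h5, hT, hτ, hz, hlow⟩ hb
    rw [eval_less, flag_eq_zero, not_lt] at hb
    simp only [eval_one, eval_cell, eval_reg] at hb
    have := hT.le _ h5 le_rfl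
    simp only [cost_less, cost_one, cost_cell, cost_reg]
    exact ⟨by push_cast; omega, h5, hT, hb, hlow⟩

end

end RAM

/-! ### Merging the sampled and the other suffixes -/

namespace RAM

open RAM.Expr RAM.Program

/-- Move the ranks of the reduced string, stored one level up in array `9`, to the sampled
positions in array `10`, and list the sampled positions by rank in array `6`. -/
def spreadRanks : Program :=
  forLoop 20 (reg 15)
    (assign 21 (3 * (reg 20 - (1 - (reg 20).less (reg 14)) * reg 14) + 1 +
       (1 - (reg 20).less (reg 14))) ;;
     assign 22 (cell 9 (reg 11 + reg 3 + reg 20)) ;;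
     store 10 (reg 11 + reg 21) (reg 22) ;;
     store 6 (reg 22 - 1) (reg 21))

/-- List the positions divisible by `3` in array `7`. -/
def listOthers : Program := forLoop 20 (reg 10) (store 7 (reg 20) (3 * reg 20))

/-- Decide in register `23` whether the next item of the merge comes from array `6`. -/
def compareHeads : Program :=
  assign 21 (cell 6 (reg 16 * (reg 16).less (reg 15))) ;;
  assign 22 (cell 7 (reg 17 * (reg 17).less (reg 14))) ;;
  cond ((reg 17).equal (reg 14)) (assign 23 1)
    (cond ((reg 16).equal (reg 15)) (assign 23 0)
      (cond ((reg 21 % 3).equal 1)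
        (assign 23 ((cell 4 (reg 11 + reg 21) * (reg 13 + 1) + cell 10 (reg 11 + reg 21 + 1)).less
          (cell 4 (reg 11 + reg 22) * (reg 13 + 1) + cell 10 (reg 11 + reg 22 + 1))))
        (assign 23 (((cell 4 (reg 11 + reg 21) * (reg 13 + 1) + cell 4 (reg 11 + reg 21 + 1)) *
            (reg 13 + 1) + cell 10 (reg 11 + reg 21 + 2)).less
          ((cell 4 (reg 11 + reg 22) * (reg 13 + 1) + cell 4 (reg 11 + reg 22 + 1)) *
            (reg 13 + 1) + cell 10 (reg 11 + reg 22 + 2))))))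

/-- Merge the sorted lists in arrays `6` and `7` and write the ranks of all suffixes. -/
def mergeRanks : Program :=
  assign 16 0 ;;
  assign 17 0 ;;
  loop ((reg 16 + reg 17).less (reg 15 + reg 14))
    (compareHeads ;;
     cond (reg 23) (assign 16 (reg 16 + 1)) (assign 21 (reg 22) ;; assign 17 (reg 17 + 1)) ;;
     store 9 (reg 11 + reg 21) (reg 16 + reg 17 - (reg 13 % 3).equal 1))

/-- Compute the ranks of a level from the ranks of the next level. -/
def ascend : Program :=
  assign 5 (reg 5 - 1) ;;
  assign 13 (cell 5 (reg 5)) ;;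
  assign 11 (reg 5 * reg 3) ;;
  assign 14 ((reg 13 + 2) / 3) ;;
  assign 15 (reg 14 + reg 13 / 3) ;;
  assign 12 (reg 13) ;;
  assign 10 (reg 14) ;;
  spreadRanks ;;
  listOthers ;;
  radixPass 10 7 18 1 ;;
  radixPass 4 18 7 0 ;;
  mergeRanks

@[simp] theorem regs_compareHeads : compareHeads.regs = [21, 22, 23, 23, 23, 23] := rfl
@[simp] theorem arrs_compareHeads : compareHeads.arrs = [] := rfl
@[simp] theorem regs_spreadRanks : spreadRanks.regs = [20, 21, 22, 20] := rfl
@[simp] theorem arrs_spreadRanks : spreadRanks.arrs = [10, 6] := rfl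
@[simp] theorem regs_listOthers : listOthers.regs = [20, 20] := rfl
@[simp] theorem arrs_listOthers : listOthers.arrs = [7] := rfl
@[simp] theorem regs_mergeRanks :
    mergeRanks.regs = [16, 17, 21, 22, 23, 23, 23, 23, 16, 21, 17] := rfl
@[simp] theorem arrs_mergeRanks : mergeRanks.arrs = [9] := rfl

section
variable {B : ℤ} {s : State} {τ : ℤ}

theorem exists_sampleIndex {N i : ℤ} (h0 : 0 ≤ i) (h1 : i < reducedLength N) :
    ∃ v, Sampled N v ∧ sampleIndex N v = i ∧
      v = 3 * (i - (1 - if i < (N + 2) / 3 then 1 else 0) * ((N + 2) / 3)) + 1 +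
        (1 - if i < (N + 2) / 3 then 1 else 0) := by
  unfold reducedLength at h1
  by_cases h : i < (N + 2) / 3
  · simp only [if_pos h]
    exact ⟨3 * i + 1, ⟨by omega, by omega⟩, by unfold sampleIndex; split_ifs <;> omega, by ring⟩
  · simp only [if_neg h]
    exact ⟨3 * (i - (N + 2) / 3) + 2, ⟨by omega, by omega⟩, by
      unfold sampleIndex; split_ifs <;> omega, by ring⟩

/-- Ranks form a permutation, so writing each position into the cell of its rank lists the samples
in sorted order without sorting. Levels are treated from the highest addresses down, hence the cells
of array `10` at this level and below are still zero, as unsampled positions require. -/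
theorem spreadRanks_spec {N Z b : ℤ} {σ' : ℤ → ℤ} (hN : 1 ≤ N) (hNZ : N + 5 ≤ Z) (hZB : Z ≤ B)
    (hσ' : Padded σ' (reducedLength N))
    (h3 : s.reg 3 = Z) (h11 : s.reg 11 = b) (h14 : s.reg 14 = (N + 2) / 3)
    (h15 : s.reg 15 = reducedLength N)
    (hr : IsRank σ' (reducedLength N) (fun i => s.arr 9 (b + Z + i)))
    (h10 : ∀ p, p < b + Z → s.arr 10 p = 0) :
    wp B spreadRanks s τ (fun s' τ' => τ' ≤ τ + 100 * (N + 1) ∧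
      (∀ v, Sampled N v → s'.arr 10 (b + v) = s.arr 9 (b + Z + sampleIndex N v)) ∧
      (∀ v, v < Z → ¬ Sampled N v → s'.arr 10 (b + v) = 0) ∧
      Listing (Sampled N) (s'.arr 6) (reducedLength N) ∧
      ∀ p, 0 ≤ p → p < reducedLength N →
        s.arr 9 (b + Z + sampleIndex N (s'.arr 6 p)) = p + 1) := by
  have hle : reducedLength N ≤ N := by unfold reducedLength; omega
  have hnn : 0 ≤ reducedLength N := by unfold reducedLength; omega
  unfold spreadRanks
  refine wp_for (reducedLength N) (fun i s' τ' => τ' ≤ τ + 2 + 70 * i ∧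
    (∀ v, Sampled N v → sampleIndex N v < i →
      s'.arr 10 (b + v) = s.arr 9 (b + Z + sampleIndex N v) ∧
      s'.arr 6 (s.arr 9 (b + Z + sampleIndex N v) - 1) = v) ∧
    (∀ v, v < Z → ¬ Sampled N v → s'.arr 10 (b + v) = 0))
    hnn (by omega) (by simp) ?_ ?_ ?_ ?_
  · intro s' hf; simp [hf.1 15 (by simp), h15]
  · refine ⟨by simp, fun v hv h => ?_, fun v hv h => ?_⟩
    · have := hv.index_mem; omega
    · simpa using h10 _ (by omega)
  · rintro i s' τ' hi0 hin hxi hf ⟨hτ, hI, hJ⟩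
    obtain ⟨v, hv, hvi, hve⟩ := exists_sampleIndex hi0 hin
    have f3 := (hf.1 3 (by simp)).trans h3
    have f11 := (hf.1 11 (by simp)).trans h11
    have f14 := (hf.1 14 (by simp)).trans h14
    have f9 := hf.2 9 (by simp)
    have hv0 := hv.1
    have hv1 := hv.2
    have hri := hr.mem i hi0 hin
    simp only [wp_seq, wp_assign, wp_store]
    simp only [eval_reg, eval_cell, eval_add, eval_sub, eval_mul, eval_less,
      eval_one, eval_ofNat, State.reg_setReg, State.arr_setReg, hxi, f3, f11, f14, f9,
      State.reg_setArr, State.arr_setArr, Nat.reduceEqDiff, if_true, if_false, cost_reg, cost_cell,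
      cost_add, cost_sub, cost_mul, cost_less, cost_one, cost_ofNat, ← hve, Function.update_apply]
    refine ⟨by omega, by omega, by omega, by omega, by push_cast; omega, fun w hw hwi => ?_,
      fun w hwZ hw => ?_⟩
    · by_cases hwv : w = v
      · subst hwv; rw [hvi]; simp
      · have hne : sampleIndex N w ≠ i := fun h => hwv (hw.index_inj hv (h.trans hvi.symm))
        have hrne := hr.inj hσ' hw.index_mem.1 hw.index_mem.2 hi0 hin hne
        rw [if_neg (by omega), if_neg (by omega)]
        exact hI w hw (by omega)
    · rw [if_neg]
      · exact hJ w hwZ hw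
      · intro h
        have : w = v := by omega
        exact hw (this ▸ hv)
  · rintro s' τ' hx hf ⟨hτ, hI, hJ⟩
    have hall : ∀ p, 0 ≤ p → p < reducedLength N → ∃ v, Sampled N v ∧
        s.arr 9 (b + Z + sampleIndex N v) = p + 1 ∧ s'.arr 6 p = v := by
      intro p h0 h1
      obtain ⟨i, i0, i1, hi⟩ := hr.surj hσ' (p := p + 1) (by omega) (by omega)
      obtain ⟨v, hv, hvi, -⟩ := exists_sampleIndex i0 i1
      refine ⟨v, hv, by rw [hvi]; exact hi, ?_⟩
      have := (hI v hv (by omega)).2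
      rw [hvi] at this
      rwa [hi, add_sub_cancel_right] at this
    refine ⟨by simp only [cost_reg]; push_cast; omega,
      fun v hv => (hI v hv hv.index_mem.2).1, hJ, ⟨fun p h0 h1 => ?_, fun v hv => ?_,
        fun p q h0 h1 h2 he => ?_⟩, fun p h0 h1 => ?_⟩
    · obtain ⟨v, hv, -, h⟩ := hall p h0 h1
      rw [h]; exact hv
    · have := hr.mem _ hv.index_mem.1 hv.index_mem.2
      exact ⟨_, by omega, by omega, (hI v hv hv.index_mem.2).2⟩
    · obtain ⟨v, hv, h, h'⟩ := hall p h0 (by omega)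
      obtain ⟨w, hw, g, g'⟩ := hall q (by omega) h2
      have : v = w := by rw [← h', ← g', he]
      subst this
      omega
    · obtain ⟨v, hv, h, h'⟩ := hall p h0 h1
      rw [h', h]

theorem listOthers_spec {M : ℤ} (hM : 0 ≤ M) (hMB : 3 * M ≤ B) (h10 : s.reg 10 = M) :
    wp B listOthers s τ (fun s' τ' => τ' ≤ τ + 20 * (M + 1) ∧
      ∀ t, 0 ≤ t → t < M → s'.arr 7 t = 3 * t) := by
  unfold listOthers
  refine wp_for M (fun i s' τ' => τ' ≤ τ + 2 + 20 * i ∧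
    ∀ t, 0 ≤ t → t < i → s'.arr 7 t = 3 * t) hM (by omega) (by simp) ?_ ?_ ?_ ?_
  · intro s' hf; simp [hf.1 10 (by simp), h10]
  · exact ⟨by simp, fun t _ _ => by omega⟩
  · rintro i s' τ' hi0 hin hxi hf ⟨hτ, hI⟩
    simp only [wp_store]
    simp [Function.update_apply, hxi]
    refine ⟨⟨by omega, by omega⟩, by omega, fun t h0 h1 => ?_⟩
    split_ifs with h
    · rw [h]
    · exact hI t h0 (by omega)
  · rintro s' τ' hx hf ⟨hτ, hI⟩
    simp only [cost_reg]
    exact ⟨by push_cast; omega, hI⟩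

/-- The positions divisible by `3` in a string of length `N`. -/
def Unsampled (N v : ℤ) : Prop := 0 ≤ v ∧ v < N ∧ v % 3 = 0

/-- Both heads are read before it is known whether their lists are exhausted. Multiplying an index
by the test that it is in range redirects the read to cell `0`, so the value stays bounded; it is
not used in that case. The case distinction on residues selects the comparison whose rank is known
on both sides. -/
theorem compareHeads_spec {σ sr : ℤ → ℤ} {N b p q : ℤ} {X Y : ℤ → ℤ} (hσ : Padded σ N)
    (hN : 1 ≤ N) (hNB : N + 1 ≤ B)
    (hsr : SampleRank σ N sr) (h11 : s.reg 11 = b) (h13 : s.reg 13 = N)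
    (h14 : s.reg 14 = (N + 2) / 3) (h15 : s.reg 15 = reducedLength N)
    (h16 : s.reg 16 = p) (h17 : s.reg 17 = q)
    (h4 : ∀ i, 0 ≤ i → i ≤ N + 2 → s.arr 4 (b + i) = σ i)
    (h10 : ∀ i, 0 ≤ i → i ≤ N + 2 → s.arr 10 (b + i) = sr i)
    (h6 : s.arr 6 = X) (h7 : s.arr 7 = Y)
    (hX : Listing (Sampled N) X (reducedLength N)) (hY : Listing (Unsampled N) Y ((N + 2) / 3))
    (hp0 : 0 ≤ p) (hp : p ≤ reducedLength N) (hq0 : 0 ≤ q) (hq : q ≤ (N + 2) / 3)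
    (hpq : p + q < reducedLength N + (N + 2) / 3) :
    wp B compareHeads s τ (fun s' τ' => τ' ≤ τ + 120 ∧ 
      (p < reducedLength N → s'.reg 21 = X p) ∧ (q < (N + 2) / 3 → s'.reg 22 = Y q) ∧
      (s'.reg 23 ≠ 0 → p < reducedLength N ∧ (q < (N + 2) / 3 → SufLt σ (X p) (Y q))) ∧
      (s'.reg 23 = 0 → q < (N + 2) / 3 ∧ (p < reducedLength N → SufLt σ (Y q) (X p)))) := by
  have hN' : 0 < reducedLength N := by unfold reducedLength; omega
  have hx' : p * (if p < reducedLength N then 1 else 0) < reducedLength N ∧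
      0 ≤ p * (if p < reducedLength N then 1 else 0) ∧
      (p < reducedLength N → p * (if p < reducedLength N then 1 else 0) = p) := by
    split_ifs <;> simp <;> omega
  have hy' : q * (if q < (N + 2) / 3 then 1 else 0) < (N + 2) / 3 ∧
      0 ≤ q * (if q < (N + 2) / 3 then 1 else 0) ∧
      (q < (N + 2) / 3 → q * (if q < (N + 2) / 3 then 1 else 0) = q) := by
    split_ifs <;> simp <;> omega
  simp only [compareHeads, wp_seq, wp_assign, wp_cond]
  simp only [eval_reg, eval_cell, eval_equal, flag_ne_zero, flag_eq_zero, State.reg_setReg,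
    State.arr_setReg, Nat.reduceEqDiff, if_true, if_false, h11, h13, h14, h15, h16, h17, h6, h7,
    eval_mod, eval_ofNat, eval_add, eval_less, eval_mul, eval_one, eval_zero, cost_reg, cost_cell,
    cost_equal, cost_one, cost_zero, cost_less, cost_add, cost_mul, cost_mod, cost_ofNat]
  generalize p * (if p < reducedLength N then 1 else 0) = p' at hx' ⊢
  generalize q * (if q < (N + 2) / 3 then 1 else 0) = q' at hy' ⊢
  have hxs := hX.mem p' hx'.2.1 hx'.1
  have hys := hY.mem q' hy'.2.1 hy'.1
  have hx0 := hxs.1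
  have hx1 := hxs.2
  obtain ⟨hy0, hy1, hy2⟩ := hys
  have hxe : p < reducedLength N → X p' = X p := fun h => by rw [hx'.2.2 h]
  have hye : q < (N + 2) / 3 → Y q' = Y q := fun h => by rw [hy'.2.2 h]
  refine ⟨⟨by omega, by omega⟩, ⟨by omega, by omega⟩, fun hqe => ⟨by omega, by push_cast; omega,
    hxe, hye, fun _ => ⟨by omega, fun h => by omega⟩, fun h => by omega⟩,
    fun hqe => ⟨fun hpe => ⟨by omega, by push_cast; omega, hxe, hye, fun h => absurd rfl h,
        fun _ => ⟨by omega, fun h => by omega⟩⟩, fun hpe => ?_⟩⟩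
  rw [← hxe (by omega), ← hye (by omega)]
  have htot := SufLt.total hσ hx0 hy0 (by omega) (Or.inr hy1)
  have hb : ∀ c : Prop, ∀ [Decidable c], -B ≤ (if c then (1 : ℤ) else 0) ∧
      (if c then (1 : ℤ) else 0) ≤ B := by
    intro c _; split_ifs <;> omega
  refine ⟨fun hm => ⟨hb _, by push_cast; omega, fun _ => rfl, fun _ => rfl, ?_, ?_⟩,
    fun hm => ⟨hb _, by push_cast; omega, fun _ => rfl, fun _ => rfl, ?_, ?_⟩⟩
  all_goals
    intro hlt
    refine ⟨by omega, fun _ => ?_⟩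
    simp only [add_assoc b] at hlt
  · rw [h4 _ hx0 (by omega), h4 _ hy0 (by omega), h10 _ (by omega) (by omega),
      h10 _ (by omega) (by omega)] at hlt
    rcases htot with h | h
    · exact h
    · have := hsr.pair_lt hσ hy0 (by omega) hx0 (by omega) (by omega) (by omega) (F := N + 1)
        (fun v v0 v1 => by have := hsr.mem v v0 v1; omega) h
      omega
  · rw [h4 _ hx0 (by omega), h4 _ hy0 (by omega), h10 _ (by omega) (by omega),
      h10 _ (by omega) (by omega)] at hlt
    rcases htot with h | h
    · have := hsr.pair_lt hσ hx0 (by omega) hy0 (by omega) (by omega) (by omega) (F := N + 1)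
        (fun v v0 v1 => by have := hsr.mem v v0 v1; omega) h
      omega
    · exact h
  · rw [h4 _ hx0 (by omega), h4 _ hy0 (by omega), h4 _ (by omega) (by omega),
      h4 _ (by omega) (by omega), h10 _ (by omega) (by omega),
      h10 _ (by omega) (by omega)] at hlt
    rcases htot with h | h
    · exact h
    · have := hsr.triple_lt hσ (by omega) hy0 (by omega) hx0 (by omega) (by omega) (by omega) h
      omega
  · rw [h4 _ hx0 (by omega), h4 _ hy0 (by omega), h4 _ (by omega) (by omega),
      h4 _ (by omega) (by omega), h10 _ (by omega) (by omega),
      h10 _ (by omega) (by omega)] at hlt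
    rcases htot with h | h
    · have := hsr.triple_lt hσ (by omega) hx0 (by omega) hy0 (by omega) (by omega) (by omega) h
      omega
    · exact h

/-- The invariant says that the taken items precede all remaining ones and are numbered
increasingly. The sum of the two pointers is the number of items taken, which gives both the rank
and the clock. -/
theorem mergeRanks_spec {σ sr : ℤ → ℤ} {N b : ℤ} (hσ : Padded σ N)
    (hN : 1 ≤ N) (hNB : N + 1 ≤ B)
    (hsr : SampleRank σ N sr) (h11 : s.reg 11 = b) (h13 : s.reg 13 = N)
    (h14 : s.reg 14 = (N + 2) / 3) (h15 : s.reg 15 = reducedLength N)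
    (h4 : ∀ i, 0 ≤ i → i ≤ N + 2 → s.arr 4 (b + i) = σ i)
    (h10 : ∀ i, 0 ≤ i → i ≤ N + 2 → s.arr 10 (b + i) = sr i)
    (hX : Listing (Sampled N) (s.arr 6) (reducedLength N))
    (hY : Listing (Unsampled N) (s.arr 7) ((N + 2) / 3))
    (hXs : ∀ p p', 0 ≤ p → p < p' → p' < reducedLength N →
      SufLt σ (s.arr 6 p) (s.arr 6 p'))
    (hYs : ∀ p p', 0 ≤ p → p < p' → p' < (N + 2) / 3 → SufLt σ (s.arr 7 p) (s.arr 7 p')) :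
    wp B mergeRanks s τ (fun s' τ' => τ' ≤ τ + 500 * (N + 1) ∧
      IsRank σ N (fun i => s'.arr 9 (b + i))) := by
  set X := s.arr 6 with hXdef
  set Y := s.arr 7 with hYdef
  set M := (N + 2) / 3 with hM
  set N' := reducedLength N with hN'
  -- If `N` has residue `1`, the empty suffix at `N` is among the samples and takes one number that
  -- the ranks must not count.
  set z : ℤ := if N % 3 = 1 then 1 else 0 with hz
  have hM0 : 0 ≤ M := by omega
  have hN0 : 0 ≤ N' := by rw [hN']; unfold reducedLength; omega
  have hz01 : 0 ≤ z ∧ z ≤ 1 := by rw [hz]; split_ifs <;> omega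
  have htotal : N' + M = N + z := by
    rw [hN', hM, hz]; unfold reducedLength; split_ifs <;> omega
  have hdisj : ∀ p q, 0 ≤ p → p < N' → 0 ≤ q → q < M → X p ≠ Y q := by
    intro p q p0 p1 q0 q1 h
    have h1 := (hX.mem p p0 p1).2
    have h2 := (hY.mem q q0 q1).2.2
    omega
  simp only [mergeRanks, wp_seq, wp_assign]
  refine ⟨by simp; omega, by simp; omega, ?_⟩
  refine wp_loop (fun s' τ' => τ' ≤ τ + 10 + 200 * (s'.reg 16 + s'.reg 17) ∧
    (0 ≤ s'.reg 16 ∧ s'.reg 16 ≤ N') ∧ (0 ≤ s'.reg 17 ∧ s'.reg 17 ≤ M) ∧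
    ∃ taken : ℤ → Prop, (∀ v, taken v ↔ (∃ p, 0 ≤ p ∧ p < s'.reg 16 ∧ X p = v) ∨
        ∃ q, 0 ≤ q ∧ q < s'.reg 17 ∧ Y q = v) ∧
      (∀ v, taken v → 1 - z ≤ s'.arr 9 (b + v) ∧
        s'.arr 9 (b + v) ≤ s'.reg 16 + s'.reg 17 - z) ∧
      (∀ v w, taken v → taken w → SufLt σ v w → s'.arr 9 (b + v) < s'.arr 9 (b + w)) ∧
      (∀ v p, taken v → s'.reg 16 ≤ p → p < N' → SufLt σ v (X p)) ∧
      (∀ v q, taken v → s'.reg 17 ≤ q → q < M → SufLt σ v (Y q)))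
    (τ + 10 + 200 * (N' + M)) ?_ ?_ ?_ ?_
  · simp only [State.reg_setReg, State.arr_setReg, Nat.reduceEqDiff, if_true, if_false, eval_zero,
      cost_zero]
    refine ⟨by push_cast; omega, ⟨le_rfl, hN0⟩, ⟨le_rfl, hM0⟩, fun _ => False, fun v => ?_,
      fun _ h => h.elim, fun _ _ h => h.elim, fun _ _ h => h.elim, fun _ _ h => h.elim⟩
    constructor
    · exact fun h => h.elim
    · rintro (⟨p, h0, h1, -⟩ | ⟨p, h0, h1, -⟩) <;> omega
  · rintro s' τ' ⟨h, h', h'', -⟩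
    omega
  · rintro s' τ' hf ⟨hτ, hp, hq, taken, htk, hR, hlt, hun, hun'⟩ hb
    have e11 : s'.reg 11 = b := by rw [hf.1 11 (by simp)]; simp [h11]
    have e13 : s'.reg 13 = N := by rw [hf.1 13 (by simp)]; simp [h13]
    have e14 : s'.reg 14 = M := by rw [hf.1 14 (by simp)]; simp [h14]
    have e15 : s'.reg 15 = N' := by rw [hf.1 15 (by simp)]; simp [h15]
    have e4 : s'.arr 4 = s.arr 4 := by rw [hf.2 4 (by simp)]; simp
    have e10 : s'.arr 10 = s.arr 10 := by rw [hf.2 10 (by simp)]; simp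
    have e6 : s'.arr 6 = X := by rw [hf.2 6 (by simp)]; simp [hXdef]
    have e7 : s'.arr 7 = Y := by rw [hf.2 7 (by simp)]; simp [hYdef]
    rw [eval_less, flag_ne_zero] at hb
    simp only [eval_add, eval_reg, e14, e15] at hb
    rw [wp_seq]
    refine wp_frame_mono (compareHeads_spec (p := s'.reg 16) (q := s'.reg 17) hσ hN hNB hsr e11 e13
      e14 e15 rfl rfl (by rw [e4]; exact h4) (by rw [e10]; exact h10) e6 e7 hX hY hp.1 hp.2 hq.1
      hq.2 hb) ?_
    rintro s₁ τ₁ hf₁ ⟨hτ₁, h21, h22, hX₁, hY₁⟩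
    replace e11 := (hf₁.1 11 (by simp)).trans e11
    replace e13 := (hf₁.1 13 (by simp)).trans e13
    have e16 := hf₁.1 16 (by simp)
    have e17 := hf₁.1 17 (by simp)
    have e9 := hf₁.2 9 (by simp)
    simp only [wp_seq, wp_cond, wp_assign, wp_store]
    simp only [eval_reg, State.reg_setReg, State.arr_setReg, Nat.reduceEqDiff, if_true, if_false,
      State.reg_setArr, State.arr_setArr, eval_add, eval_sub, eval_mod, eval_equal, eval_one,
      eval_ofNat, e11, e13, e16, e17, e9, cost_reg, cost_less, cost_add, cost_sub, cost_equal,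
      cost_mod, cost_one, cost_ofNat, ← hz, Function.update_apply, add_right_inj] at hτ₁ ⊢
    push_cast at hτ₁ ⊢
    -- One step of the merge for a next item `x` from either list; only that `x` lies above all
    -- taken items and below all others matters.
    have step : ∀ x p' q', (p' = s'.reg 16 + 1 ∧ q' = s'.reg 17 ∧ p' ≤ N' ∧ x = X (s'.reg 16) ∨
        p' = s'.reg 16 ∧ q' = s'.reg 17 + 1 ∧ q' ≤ M ∧ x = Y (s'.reg 17)) →
        (∀ v, taken v → SufLt σ v x) →
        (∀ p, p' ≤ p → p < N' → SufLt σ x (X p)) → (∀ q, q' ≤ q → q < M → SufLt σ x (Y q)) →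
        ∃ taken' : ℤ → Prop, (∀ v, taken' v ↔ (∃ p, 0 ≤ p ∧ p < p' ∧ X p = v) ∨
            ∃ q, 0 ≤ q ∧ q < q' ∧ Y q = v) ∧
          (∀ v, taken' v → 1 - z ≤ (if v = x then p' + q' - z else s'.arr 9 (b + v)) ∧
            (if v = x then p' + q' - z else s'.arr 9 (b + v)) ≤ p' + q' - z) ∧
          (∀ v w, taken' v → taken' w → SufLt σ v w →
            (if v = x then p' + q' - z else s'.arr 9 (b + v)) <
              (if w = x then p' + q' - z else s'.arr 9 (b + w))) ∧
          (∀ v p, taken' v → p' ≤ p → p < N' → SufLt σ v (X p)) ∧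
          (∀ v q, taken' v → q' ≤ q → q < M → SufLt σ v (Y q)) := by
      intro x p' q' hx hbelow hx1 hx2
      have hsum : p' + q' = s'.reg 16 + s'.reg 17 + 1 := by omega
      have hnt : ∀ v, taken v → v ≠ x := fun v hv h => by
        have := hbelow v hv; rw [h] at this; exact SufLt.irrefl this
      refine ⟨fun v => taken v ∨ v = x, fun v => ?_, fun v hv => ?_, fun v w hv hw h => ?_,
        fun v p hv p0 p1 => ?_, fun v q hv q0 q1 => ?_⟩
      · show taken v ∨ v = x ↔ _
        rw [htk v]
        rcases hx with ⟨rfl, rfl, -, rfl⟩ | ⟨rfl, rfl, -, rfl⟩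
        · constructor
          · rintro ((⟨p, h0, h1, h2⟩ | h) | h)
            · exact Or.inl ⟨p, h0, by omega, h2⟩
            · exact Or.inr h
            · exact Or.inl ⟨_, hp.1, by omega, h.symm⟩
          · rintro (⟨p, h0, h1, h2⟩ | h)
            · rcases eq_or_lt_of_le (show p ≤ s'.reg 16 by omega) with h | h
              · subst h; exact Or.inr h2.symm
              · exact Or.inl (Or.inl ⟨p, h0, h, h2⟩)
            · exact Or.inl (Or.inr h)
        · constructor
          · rintro ((h | ⟨p, h0, h1, h2⟩) | h)
            · exact Or.inl h
            · exact Or.inr ⟨p, h0, by omega, h2⟩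
            · exact Or.inr ⟨_, hq.1, by omega, h.symm⟩
          · rintro (h | ⟨p, h0, h1, h2⟩)
            · exact Or.inl (Or.inl h)
            · rcases eq_or_lt_of_le (show p ≤ s'.reg 17 by omega) with h | h
              · subst h; exact Or.inr h2.symm
              · exact Or.inl (Or.inr ⟨p, h0, h, h2⟩)
      · split_ifs with h
        · omega
        · have := hR v (hv.resolve_right h); omega
      · rcases hv with hv | hv
        · rw [if_neg (hnt v hv)]
          split_ifs with h'
          · have := hR v hv; omega
          · exact hlt v w hv (hw.resolve_right h') h
        · subst hv
          rcases hw with hw | hw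
          · exact absurd (hbelow w hw) h.asymm
          · subst hw; exact absurd h SufLt.irrefl
      · rcases hv with hv | hv
        · exact hun v p hv (by omega) p1
        · subst hv; exact hx1 p p0 p1
      · rcases hv with hv | hv
        · exact hun' v q hv (by omega) q1
        · subst hv; exact hx2 q q0 q1
    refine ⟨fun h => ?_, fun h => ?_⟩
    · obtain ⟨hpl, hXq⟩ := hX₁ h
      refine ⟨by omega, by omega, by omega, by omega, by omega, ?_⟩
      rw [h21 hpl]
      refine step _ _ _ (Or.inl ⟨rfl, rfl, by omega, rfl⟩) (fun v hv => hun v _ hv le_rfl hpl)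
        (fun p p0 p1 => hXs _ p hp.1 (by omega) p1) (fun q q0 q1 => ?_)
      have h1 := hXq (by omega)
      rcases eq_or_lt_of_le q0 with h' | h'
      · rwa [← h']
      · exact h1.trans (hYs _ q hq.1 h' q1)
    · obtain ⟨hpl, hXq⟩ := hY₁ h
      have hys := hY.mem _ hq.1 hpl
      have hy0 := hys.1
      have hy1 := hys.2.1
      rw [h22 hpl]
      refine ⟨by omega, by omega, by omega, by omega, by omega, by omega, ?_⟩
      refine step _ _ _ (Or.inr ⟨rfl, rfl, by omega, rfl⟩) (fun v hv => hun' v _ hv le_rfl hpl)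
        (fun p p0 p1 => ?_) (fun q q0 q1 => hYs _ q hq.1 (by omega) q1)
      have h1 := hXq (by omega)
      rcases eq_or_lt_of_le p0 with h' | h'
      · rwa [← h']
      · exact h1.trans (hXs _ p hp.1 h' p1)
  · rintro s' τ' hf ⟨hτ, hp, hq, taken, htk, hR, hlt, -, -⟩ hb
    have e14 : s'.reg 14 = M := by rw [hf.1 14 (by simp)]; simp [h14]
    have e15 : s'.reg 15 = N' := by rw [hf.1 15 (by simp)]; simp [h15]
    rw [eval_less, flag_eq_zero] at hb
    simp only [eval_add, eval_reg, e14, e15] at hb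
    have hpe : s'.reg 16 = N' := by omega
    have hqe : s'.reg 17 = M := by omega
    have hS : ∀ v, Sampled N v → taken v := fun v hv => by
      obtain ⟨p, h0, h1, h2⟩ := hX.surj v hv
      exact (htk v).2 (Or.inl ⟨p, h0, by omega, h2⟩)
    have hall : ∀ v, 0 ≤ v → v < N → taken v := fun v h0 h1 => by
      by_cases h3 : v % 3 = 0
      · obtain ⟨p, g0, g1, g2⟩ := hY.surj v ⟨h0, h1, h3⟩
        exact (htk v).2 (Or.inr ⟨p, g0, by omega, g2⟩)
      · exact hS v ⟨h0, by omega⟩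
    refine ⟨by simp only [cost_less, cost_add, cost_reg]; push_cast; omega,
      ⟨fun i h0 h1 => ?_, fun i j h0 h1 g0 g1 h => hlt i j (hall i h0 h1) (hall j g0 g1) h⟩⟩
    have h2 := hR i (hall i h0 h1)
    refine ⟨?_, by omega⟩
    -- With the correction, numbers start at `0` when the empty suffix is present. It is smaller
    -- than every proper suffix, which pushes their ranks to at least `1`.
    by_cases h3 : N % 3 = 1
    · have hNS : Sampled N N := ⟨by omega, by omega⟩
      have h4 := hR N (hS N hNS)
      have h5 := hlt N i (hS N hNS) (hall i h0 h1) (SufLt.of_lt (by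
        rw [hσ.zero N le_rfl]; linarith [(hσ.mem i h0 h1).1]))
      omega
    · rw [hz, if_neg h3] at h2; exact h2.1

end

end RAM

/-! ### Suffix ranks of all levels, from the shortest string back to the first -/

namespace RAM

open RAM.Expr RAM.Program

@[simp] theorem regs_descend : descend.regs = [13, 11, 14, 10, 12] ++ listSample.regs ++
    (radixPass 4 6 7 2).regs ++ (radixPass 4 7 6 1).regs ++ (radixPass 4 6 7 0).regs ++
    nameTriples.regs ++ [5] := rfl
@[simp] theorem arrs_descend : descend.arrs = listSample.arrs ++
    (radixPass 4 6 7 2).arrs ++ (radixPass 4 7 6 1).arrs ++ (radixPass 4 6 7 0).arrs ++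
    nameTriples.arrs ++ [5] := rfl
@[simp] theorem regs_ascend : ascend.regs = [5, 13, 11, 14, 15, 12, 10] ++ spreadRanks.regs ++
    listOthers.regs ++ (radixPass 10 7 18 1).regs ++ (radixPass 4 18 7 0).regs ++
    mergeRanks.regs := rfl
@[simp] theorem arrs_ascend : ascend.arrs = spreadRanks.arrs ++
    listOthers.arrs ++ (radixPass 10 7 18 1).arrs ++ (radixPass 4 18 7 0).arrs ++
    mergeRanks.arrs := rfl

/-- Compute the ranks of all levels, starting from the last one. -/
def ascendAll : Program :=
  store 9 (reg 5 * reg 3) (cell 5 (reg 5)) ;; loop ((0 : Expr).less (reg 5)) ascend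

/-- Compute the ranks of the suffixes of the string in array `4` into array `9`. -/
def rankSuffixes : Program := descendAll ;; ascendAll

@[simp] theorem regs_descendAll : descendAll.regs = [5] ++ descend.regs := rfl
@[simp] theorem arrs_descendAll : descendAll.arrs = descend.arrs := rfl
@[simp] theorem regs_ascendAll : ascendAll.regs = ascend.regs := rfl
@[simp] theorem arrs_ascendAll : ascendAll.arrs = [9] ++ ascend.arrs := rfl
@[simp] theorem regs_rankSuffixes : rankSuffixes.regs = descendAll.regs ++ ascendAll.regs := rfl
@[simp] theorem arrs_rankSuffixes : rankSuffixes.arrs = descendAll.arrs ++ ascendAll.arrs := rfl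

section
variable {B : ℤ} {s : State} {τ : ℤ}

/-- The samples inherit their order from the next level. The multiples of three are sorted by two
passes, first by the rank at the following position and then by the character, which is the order of
`SampleRank.pair_lt`. -/
theorem ascend_spec {σ σ' : ℤ → ℤ} {N Z l : ℤ} (hσ : Padded σ N) (hN : 2 ≤ N) (hNZ : N + 5 ≤ Z)
    (hB : Z * Z * Z ≤ B) (hl : 0 ≤ l) (hlZ : l < Z) (h3 : s.reg 3 = Z) (h5 : s.reg 5 = l + 1)
    (hN5 : s.arr 5 l = N) (h4 : ∀ i, 0 ≤ i → i < Z → s.arr 4 (l * Z + i) = σ i)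
    (hred : IsReduction σ N σ')
    (hr : IsRank σ' (reducedLength N) (fun i => s.arr 9 (l * Z + Z + i)))
    (h10 : ∀ p, p < l * Z + Z → s.arr 10 p = 0) :
    wp B ascend s τ (fun s' τ' => τ' ≤ τ + 3000 * (N + 1) ∧ s'.reg 5 = l ∧
      IsRank σ N (fun i => s'.arr 9 (l * Z + i)) ∧ ∀ p, p < l * Z → s'.arr 10 p = 0) := by
  have hle : reducedLength N ≤ N := by unfold reducedLength; omega
  have hnn : 0 ≤ reducedLength N := by unfold reducedLength; omega
  have hZB : Z ≤ B := (le_cube (by omega)).trans hB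
  have hlB : l * Z ≤ B := by
    have h1 : l * Z ≤ Z * Z := mul_le_mul_of_nonneg_right hlZ.le (by omega)
    have h2 : Z * Z * 1 ≤ Z * Z * Z :=
      mul_le_mul_of_nonneg_left (by omega) (mul_nonneg (by omega) (by omega))
    omega
  have hlB0 : 0 ≤ l * Z := mul_nonneg hl (by omega)
  have hBZ : Z + Z ≤ B := by
    have h2 : Z * 2 ≤ Z * (Z * Z) := mul_le_mul_of_nonneg_left (by nlinarith) (by omega)
    nlinarith
  simp only [ascend, wp_seq, wp_assign]
  simp only [eval_reg, eval_cell, eval_add, eval_sub, eval_mul, eval_div, eval_one, eval_ofNat,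
    State.reg_setReg, State.arr_setReg, cost_reg, cost_cell, cost_add, cost_sub, cost_mul, cost_div,
    cost_ofNat, cost_one, Nat.reduceEqDiff, if_true, if_false, h3, h5, hN5, add_sub_cancel_right]
  refine ⟨by omega, by omega, by omega, by omega, by unfold reducedLength at hle; omega, by omega,
    by omega, ?_⟩
  refine wp_frame_mono (spreadRanks_spec (N := N) (Z := Z) (b := l * Z) (by omega) hNZ hZB
    hred.padded (by simp [h3])
    (by simp) (by simp) (by simp [reducedLength]) (by simpa using hr) (by simpa using h10)) ?_
  rintro s₁ τ₁ hf₁ ⟨hτ₁, hsr, hsr0, hX, hXr⟩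
  have a5 : s₁.reg 5 = l := by rw [hf₁.1 5 (by simp)]; simp
  have a10 : s₁.reg 10 = (N + 2) / 3 := by rw [hf₁.1 10 (by simp)]; simp
  have a11 : s₁.reg 11 = l * Z := by rw [hf₁.1 11 (by simp)]; simp
  have a12 : s₁.reg 12 = N := by rw [hf₁.1 12 (by simp)]; simp
  have a13 : s₁.reg 13 = N := by rw [hf₁.1 13 (by simp)]; simp
  have a14 : s₁.reg 14 = (N + 2) / 3 := by rw [hf₁.1 14 (by simp)]; simp
  have a15 : s₁.reg 15 = reducedLength N := by rw [hf₁.1 15 (by simp)]; simp [reducedLength]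
  have b4 : s₁.arr 4 = s.arr 4 := by rw [hf₁.2 4 (by simp)]; simp
  clear hf₁
  simp only [State.arr_setReg] at hsr hXr
  set sr : ℤ → ℤ := fun i => s₁.arr 10 (l * Z + i) with hsrdef
  have hSR : SampleRank σ N sr := hred.sampleRank hσ (by omega) hr hsr
    (fun v _ h1 hv => hsr0 v (by omega) hv)
  have hlow10 : ∀ p, p < l * Z → s₁.arr 10 p = 0 := fun p hp => by
    have h := hsr0 (p - l * Z) (by omega) (fun h => by have := h.1; omega)
    rwa [show l * Z + (p - l * Z) = p by ring] at h
  refine wp_frame_mono (listOthers_spec (M := (N + 2) / 3) (by omega) (by omega) a10) ?_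
  rintro s₂ τ₂ hf₂ ⟨hτ₂, hY₀⟩
  replace a5 := (hf₂.1 5 (by simp)).trans a5
  replace a10 := (hf₂.1 10 (by simp)).trans a10
  replace a11 := (hf₂.1 11 (by simp)).trans a11
  replace a12 := (hf₂.1 12 (by simp)).trans a12
  replace a13 := (hf₂.1 13 (by simp)).trans a13
  replace a14 := (hf₂.1 14 (by simp)).trans a14
  replace a15 := (hf₂.1 15 (by simp)).trans a15
  replace b4 := (hf₂.2 4 (by simp)).trans b4
  have b6 := (hf₂.2 6 (by simp))
  have b10 := (hf₂.2 10 (by simp))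
  clear hf₂
  have hY : Listing (Unsampled N) (s₂.arr 7) ((N + 2) / 3) := by
    refine ⟨fun p h0 h1 => ?_, fun v hv => ?_, fun p q h0 h1 h2 => ?_⟩
    · rw [hY₀ p h0 h1]; exact ⟨by omega, by omega, by omega⟩
    · obtain ⟨v0, v1, v2⟩ := hv
      exact ⟨v / 3, by omega, by omega, by rw [hY₀ _ (by omega) (by omega)]; omega⟩
    · rw [hY₀ p h0 (by omega), hY₀ q (by omega) h2]; omega
  have hSB : ∀ v, Unsampled N v → -B ≤ v ∧ v ≤ B := fun v hv => by
    have := hv.1; have := hv.2.1; omega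
  have hkey1 : ∀ v, Unsampled N v → 0 ≤ sr (v + 1) ∧ sr (v + 1) ≤ N := fun v hv =>
    hSR.mem _ (by have := hv.1; omega) (by have := hv.2.1; omega)
  refine wp_frame_mono (radixPass_spec (n := (N + 2) / 3) (K := N) (S := Unsampled N)
    (key := fun v => sr (v + 1)) (f := fun _ => 0) (F := 1) (by simp) (by simp) (by simp) (by simp)
    (by simp) a10 a12 (by omega) (by omega) (by omega) (by omega) hY hSB
    (fun v hv => ⟨by rw [a11, b10, add_assoc], hkey1 v hv⟩)
    (fun _ _ _ _ _ => le_rfl) (by simp)) ?_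
  rintro s₃ τ₃ hf₃ ⟨hτ₃, hY₃, hS₃⟩
  replace a5 := (hf₃.1 5 (by simp)).trans a5
  replace a10 := (hf₃.1 10 (by simp)).trans a10
  replace a11 := (hf₃.1 11 (by simp)).trans a11
  replace a12 := (hf₃.1 12 (by simp)).trans a12
  replace a13 := (hf₃.1 13 (by simp)).trans a13
  replace a14 := (hf₃.1 14 (by simp)).trans a14
  replace a15 := (hf₃.1 15 (by simp)).trans a15
  replace b4 := (hf₃.2 4 (by simp)).trans b4
  replace b6 := (hf₃.2 6 (by simp)).trans b6
  replace b10 := (hf₃.2 10 (by simp)).trans b10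
  clear hf₃
  refine wp_frame_mono (radixPass_spec (n := (N + 2) / 3) (K := N) (S := Unsampled N)
    (key := fun v => σ v) (F := N + 1) (by simp) (by simp) (by simp) (by simp)
    (by simp) a10 a12 (by omega) (by omega) (by omega) (by omega) hY₃ hSB
    (fun v hv => ?_) hS₃ (fun v hv => ?_)) ?_
  · have := hv.1
    have := hv.2.1
    rw [a11, b4, add_zero, h4 _ (by omega) (by omega)]
    exact ⟨rfl, hσ.nonneg (by omega), hσ.le (by omega) (by omega)⟩
  · have := hkey1 v hv
    omega
  rintro s₄ τ₄ hf₄ ⟨hτ₄, hY₄, hS₄⟩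
  replace a5 := (hf₄.1 5 (by simp)).trans a5
  replace a11 := (hf₄.1 11 (by simp)).trans a11
  replace a13 := (hf₄.1 13 (by simp)).trans a13
  replace a14 := (hf₄.1 14 (by simp)).trans a14
  replace a15 := (hf₄.1 15 (by simp)).trans a15
  replace b4 := (hf₄.2 4 (by simp)).trans b4
  replace b6 := (hf₄.2 6 (by simp)).trans b6
  replace b10 := (hf₄.2 10 (by simp)).trans b10
  clear hf₄
  refine wp_frame_mono (mergeRanks_spec hσ (by omega) (by omega) hSR a11 a13 a14 a15
    (fun i h0 h1 => by rw [b4]; exact h4 i h0 (by omega)) (fun i h0 h1 => by rw [b10])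
    (by rw [b6]; exact hX) hY₄ (fun p q h0 h1 h2 => ?_) (fun p q h0 h1 h2 => ?_)) ?_
  · rw [b6]
    have hp := hX.mem p h0 (by omega)
    have hq := hX.mem q (by omega) h2
    have hp1 := hp.2
    have hq1 := hq.2
    have hne := hX.inj p q h0 h1 h2
    rcases SufLt.total hσ hp.1 hq.1 hne (by omega) with h | h
    · exact h
    · have h6 := hr.lt _ _ hq.index_mem.1 hq.index_mem.2 hp.index_mem.1 hp.index_mem.2
        (hred.sufLt hσ hq hp h)
      rw [hXr q (by omega) h2, hXr p h0 (by omega)] at h6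
      omega
  · have hp := hY₄.mem p h0 (by omega)
    have hq := hY₄.mem q (by omega) h2
    obtain ⟨p0, p1, p2⟩ := hp
    obtain ⟨q0, q1, q2⟩ := hq
    have hne := hY₄.inj p q h0 h1 h2
    rcases SufLt.total hσ p0 q0 hne (Or.inl p1) with h | h
    · exact h
    · have h6 := hSR.pair_lt hσ q0 q1.le p0 p1.le (by omega) (by omega) (F := N + 1)
        (fun v v0 v1 => by have := hSR.mem v v0 v1; omega) h
      have h7 := hS₄ p q h0 h1 h2
      dsimp only at h7
      omega
  rintro s₅ τ₅ hf₅ ⟨hτ₅, hrank⟩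
  refine ⟨by push_cast at hτ₁; omega, (hf₅.1 5 (by simp)).trans a5, hrank, fun p hp => ?_⟩
  rw [hf₅.2 10 (by simp), b10]
  exact hlow10 p hp

/-- The last level has at most one character, so its length can serve as the only rank. The clock is
bounded by a multiple of the length of the current level: returning to a longer level pays for
itself by `reducedLength_lt`. -/
theorem ascendAll_spec {N Z l : ℤ} (hl : 0 ≤ l) (hNZ : N + 5 ≤ Z)
    (hB : Z * Z * Z ≤ B) (h3 : s.reg 3 = Z) (h5 : s.reg 5 = l)
    (hT : Tower (s.arr 4) (s.arr 5) Z N l) (htop : s.arr 5 l ≤ 1)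
    (h10 : ∀ p, s.arr 10 p = 0) :
    wp B ascendAll s τ (fun s' τ' => τ' ≤ τ + 20000 * (N + 1) ∧
      IsRank (level (s.arr 4) Z 0) N (s'.arr 9)) := by
  have hN : 0 ≤ N := by have := hT.le l hl le_rfl; omega
  have hZB : Z ≤ B := (le_cube (by omega)).trans hB
  have hle := hT.le l hl le_rfl
  simp only [ascendAll, wp_seq, wp_store]
  refine ⟨by simp [h5]; omega, ?_⟩
  refine wp_loop (fun s' τ' => 0 ≤ s'.reg 5 ∧ s'.reg 5 ≤ l ∧
    τ' ≤ τ + 10 + 20000 * s.arr 5 (s'.reg 5) ∧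
    IsRank (level (s.arr 4) Z (s'.reg 5)) (s.arr 5 (s'.reg 5))
      (fun i => s'.arr 9 (s'.reg 5 * Z + i)) ∧
    ∀ p, p < s'.reg 5 * Z → s'.arr 10 p = 0) (τ + 10 + 20000 * N) ?_ ?_ ?_ ?_
  · simp only [State.reg_setArr, State.arr_setArr, Nat.reduceEqDiff, if_true, if_false, eval_reg,
      eval_mul, eval_cell, h5, h3, cost_mul, cost_reg, cost_cell]
    refine ⟨hl, le_rfl, by push_cast; omega, ⟨fun i h0 h1 => ?_, fun i j h0 h1 g0 g1 h => ?_⟩,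
      fun p _ => h10 p⟩
    · have : i = 0 := by omega
      subst this
      simp; omega
    · have : i = j := by omega
      subst this
      exact absurd h SufLt.irrefl
  · rintro s' τ' ⟨h0, h1, hτ, -⟩
    have := hT.le _ h0 h1
    omega
  · rintro s' τ' hf ⟨h0, h1, hτ, hr, hz⟩ hb
    rw [eval_less, flag_ne_zero] at hb
    simp only [eval_zero, eval_reg] at hb
    have e3 : s'.reg 3 = Z := by rw [hf.1 3 (by simp)]; simp [h3]
    have e4 : s'.arr 4 = s.arr 4 := by rw [hf.2 4 (by simp)]; simp
    have e5 : s'.arr 5 = s.arr 5 := by rw [hf.2 5 (by simp)]; simp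
    set e := s'.reg 5 - 1 with he
    have he1 : s'.reg 5 = e + 1 := by omega
    have h2 := hT.two_le e (by omega) (by omega)
    have hles := hT.le e (by omega) (by omega)
    have hls := hT.length_succ e (by omega) (by omega)
    have hdec := reducedLength_lt h2
    rw [he1, hls] at hr hτ
    refine wp_frame_mono (ascend_spec (hT.padded e (by omega) (by omega)) h2 (by omega) hB
      (by omega) (by omega) e3 he1 (by rw [e5]) (fun i i0 i1 => by simp [e4, level, i0, i1])
      (hT.reduction e (by omega) (by omega)) ?_ (fun p hp => hz p ?_)) ?_
    · rwa [show e * Z + Z = (e + 1) * Z by ring]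
    · rw [he1]; have : (e + 1) * Z = e * Z + Z := by ring
      omega
    rintro s'' τ'' hf' ⟨hτ', g5, hr', hz'⟩
    simp only [cost_less, cost_zero, cost_reg] at hτ'
    push_cast at hτ'
    rw [g5]
    refine ⟨by omega, by omega, by omega, hr', hz'⟩
  · rintro s' τ' hf ⟨h0, h1, hτ, hr, hz⟩ hb
    rw [eval_less, flag_eq_zero] at hb
    simp only [eval_zero, eval_reg] at hb
    have h0' : s'.reg 5 = 0 := by omega
    rw [h0', hT.length_zero] at hr
    rw [h0', hT.length_zero] at hτ
    simp only [zero_mul, zero_add] at hr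
    exact ⟨by simp only [cost_less, cost_zero, cost_reg]; push_cast; omega, hr⟩

theorem _root_.IsRank.congr {σ σ' r : ℤ → ℤ} {N : ℤ} (hr : IsRank σ N r)
    (h : ∀ i, 0 ≤ i → σ' i = σ i) : IsRank σ' N r := by
  refine ⟨hr.mem, fun i j i0 i1 j0 j1 ⟨d, d0, ha, hd⟩ => hr.lt i j i0 i1 j0 j1 ⟨d, d0, ?_, ?_⟩⟩
  · intro e e0 e1
    rw [← h _ (by omega), ← h _ (by omega)]
    exact ha e e0 e1
  · rwa [← h _ (by omega), ← h _ (by omega)]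

theorem rankSuffixes_spec {N Z : ℤ} (hN : 0 ≤ N) (hNZ : N + 5 ≤ Z)
    (hB : Z * Z * Z ≤ B) (h3 : s.reg 3 = Z) (hN5 : s.arr 5 0 = N)
    (h4 : Padded (s.arr 4) N) (h10 : ∀ p, s.arr 10 p = 0) :
    wp B rankSuffixes s τ (fun s' τ' => τ' ≤ τ + 30000 * (N + 1) ∧
      IsRank (s.arr 4) N (s'.arr 9) ∧ ∀ p, p < Z → s'.arr 4 p = s.arr 4 p) := by
  simp only [rankSuffixes, wp_seq]
  refine wp_frame_mono (descendAll_spec hN hNZ hB h3 hN5 h4) ?_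
  rintro s₁ τ₁ hf₁ ⟨hτ₁, hl, hT, htop, h4'⟩
  refine wp_frame_mono (ascendAll_spec hl hNZ hB ((hf₁.1 3 (by simp)).trans h3) rfl hT htop
    (fun p => by rw [hf₁.2 10 (by simp)]; exact h10 p)) ?_
  rintro s₂ τ₂ hf₂ ⟨hτ₂, hr⟩
  refine ⟨by omega, hr.congr fun i hi => ?_, fun p hp => ?_⟩
  · unfold level
    split_ifs with h
    · simp only [zero_mul, zero_add]; exact (h4' i h.2).symm
    · exact h4.zero i (by omega)
  · rw [hf₂.2 4 (by simp)]; exact h4' p hp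

end

end RAM

/-! ### Longest common prefixes of neighbouring suffixes -/

/-- After the first character is removed the order persists, and a second common character keeps `j
+ 1` inside the string. So if a positive match length is carried to `i + 1`, this suffix is not the
first in order. -/
theorem IsRank.succ_lt_succ {s r : ℤ → ℤ} {N i j h : ℤ} (hr : IsRank s N r) (hs : Padded s N)
    (hi : 0 ≤ i) (hiN : i + 1 < N) (hj : 0 ≤ j) (hjN : j < N) (hji : r j < r i)
    (hag : Agree s i j h) (hh : 2 ≤ h) : 0 ≤ j + 1 ∧ j + 1 < N ∧ r (j + 1) < r (i + 1) := by
  have h0 : s i = s j := by simpa using hag 0 le_rfl (by omega)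
  have h1 := hag 1 (by omega) (by omega)
  have hj1 : j + 1 < N := hs.lt_of_pos (by
    rw [← h1]; linarith [(hs.mem (i + 1) (by omega) hiN).1])
  exact ⟨by omega, hj1, hr.lt _ _ (by omega) hj1 (by omega) hiN
    ((sufLt_succ h0.symm).2 (hr.sufLt hs hj hjN hi (by omega) hji))⟩

/-- A match cannot pass the end of the string, where padding would meet a positive character. This
bounds match lengths and keeps the comparisons inside the string with its first zero. -/
theorem Agree.add_le {s : ℤ → ℤ} {N i j h : ℤ} (hs : Padded s N) (hi : 0 ≤ i) (hj : 0 ≤ j)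
    (hiN : i < N) (hjN : j < N) (hij : i ≠ j) (hag : Agree s i j h) : i + h ≤ N ∧ j + h ≤ N := by
  rcases lt_or_gt_of_ne hij with h' | h'
  · obtain ⟨e, e0, e1, e2, e3⟩ := hs.exists_ne hi h' hiN
    have : h ≤ N - j := by
      by_contra hlt
      have h1 := hag (N - j) (by omega) (by omega)
      rw [show j + (N - j) = N by ring, hs.zero N le_rfl] at h1
      have := (hs.mem (i + (N - j)) (by omega) (by omega)).1
      omega
    omega
  · have : h ≤ N - i := by
      by_contra hlt
      have h1 := hag (N - i) (by omega) (by omega)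
      rw [show i + (N - i) = N by ring, hs.zero N le_rfl] at h1
      have := (hs.mem (j + (N - i)) (by omega) (by omega)).1
      omega
    omega

theorem Agree.succ {s : ℤ → ℤ} {i j h : ℤ} (hag : Agree s i j h) (he : s (i + h) = s (j + h)) :
    Agree s i j (h + 1) := fun e h0 h1 => by
  rcases eq_or_lt_of_le (show e ≤ h by omega) with h' | h'
  · rw [h']; exact he
  · exact hag e h0 h'

namespace RAM

open RAM.Expr RAM.Program

/-- Lengthen the common prefix of the suffixes at the positions in registers `20` and `22`. -/
def extendMatch : Program :=
  loop ((cell 4 (reg 20 + reg 24)).equal (cell 4 (reg 22 + reg 24))) (assign 24 (reg 24 + 1))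

/-- List the suffixes by rank in array `11`; compute the lengths of the longest common prefixes of
neighbouring suffixes in array `12`. -/
def neighbourPrefixes : Program :=
  forLoop 20 (reg 4) (store 11 (cell 9 (reg 20)) (reg 20)) ;;
  assign 24 0 ;;
  forLoop 20 (reg 4)
    (assign 21 (cell 9 (reg 20)) ;;
     cond ((1 : Expr).less (reg 21))
       (assign 22 (cell 11 (reg 21 - 1)) ;;
        extendMatch ;;
        store 12 (reg 21) (reg 24) ;;
        cond (reg 24) (assign 24 (reg 24 - 1)) skip)
       skip)

@[simp] theorem regs_extendMatch : extendMatch.regs = [24] := rfl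
@[simp] theorem arrs_extendMatch : extendMatch.arrs = [] := rfl
@[simp] theorem regs_neighbourPrefixes :
    neighbourPrefixes.regs = [20, 20, 24, 20, 21, 22, 24, 24, 20] := rfl
@[simp] theorem arrs_neighbourPrefixes : neighbourPrefixes.arrs = [11, 12] := rfl

section
variable {B : ℤ} {s : State} {τ : ℤ}

theorem extendMatch_spec {σ : ℤ → ℤ} {N i j : ℤ} (hσ : Padded σ N) (hNB : N < B)
    (hi : 0 ≤ i) (hiN : i < N) (hj : 0 ≤ j) (hjN : j < N) (hij : i ≠ j)
    (h4 : ∀ p, p ≤ N → s.arr 4 p = σ p) (h20 : s.reg 20 = i) (h22 : s.reg 22 = j)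
    (h0 : 0 ≤ s.reg 24) (hag : Agree σ i j (s.reg 24)) :
    wp B extendMatch s τ (fun s' τ' => τ' ≤ τ + 10 + 20 * (s'.reg 24 - s.reg 24) ∧
      IsLcp σ i j (s'.reg 24)) := by
  refine wp_loop (fun s' τ' => τ' ≤ τ + 20 * (s'.reg 24 - s.reg 24) ∧ 0 ≤ s'.reg 24 ∧
    Agree σ i j (s'.reg 24)) (τ + 20 * (N - s.reg 24)) ⟨by omega, h0, hag⟩ ?_ ?_ ?_
  · rintro s' τ' ⟨hτ, g0, g⟩
    have := g.add_le hσ hi hj hiN hjN hij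
    omega
  · rintro s' τ' hf ⟨hτ, g0, g⟩ hb
    have hle := g.add_le hσ hi hj hiN hjN hij
    have e20 := (hf.1 20 (by simp)).trans h20
    have e22 := (hf.1 22 (by simp)).trans h22
    have e4 := hf.2 4 (by simp)
    rw [eval_equal, flag_ne_zero] at hb
    simp only [eval_cell, eval_add, eval_reg, e20, e22, e4] at hb
    rw [h4 _ hle.1, h4 _ hle.2] at hb
    rw [wp_assign]
    simp
    exact ⟨⟨by omega, by omega⟩, by omega, by omega, g.succ hb⟩
  · rintro s' τ' hf ⟨hτ, g0, g⟩ hb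
    have hle := g.add_le hσ hi hj hiN hjN hij
    have e20 := (hf.1 20 (by simp)).trans h20
    have e22 := (hf.1 22 (by simp)).trans h22
    have e4 := hf.2 4 (by simp)
    rw [eval_equal, flag_eq_zero] at hb
    simp only [eval_cell, eval_add, eval_reg, e20, e22, e4] at hb
    rw [h4 _ hle.1, h4 _ hle.2] at hb
    simp only [cost_equal, cost_cell, cost_add, cost_reg]
    exact ⟨by push_cast; omega, g0, g, hb⟩

/-- By `IsRank.agree_succ` the match length drops by at most one from a position to the next, so the
successful comparisons total `O(N)`. The term `20 * s'.reg 24` in the clock expresses this: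
extensions raise it, and the decrement lets it fall by one per position. A suffix of rank `1` has no
predecessor, and the carried length is then zero. -/
theorem neighbourPrefixes_spec {σ : ℤ → ℤ} {N : ℤ} (hσ : Padded σ N) (hN : 0 ≤ N) (hNB : N < B)
    (hB : 1 ≤ B)
    (hr : IsRank σ N (s.arr 9)) (hreg : s.reg 4 = N) (h4 : ∀ p, p ≤ N → s.arr 4 p = σ p)
    (h12 : ∀ p, s.arr 12 p = 0) :
    wp B neighbourPrefixes s τ (fun s' τ' => τ' ≤ τ + 200 * (N + 1) ∧
      (∀ p, 0 ≤ s'.arr 12 p ∧ s'.arr 12 p ≤ N) ∧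
      ∀ i j, 0 ≤ i → i < N → 0 ≤ j → j < N → s.arr 9 j = s.arr 9 i - 1 →
        IsLcp σ i j (s'.arr 12 (s.arr 9 i))) := by
  set r := s.arr 9 with hrdef
  simp only [neighbourPrefixes, wp_seq]
  refine wp_for N (fun i s' τ' => τ' ≤ τ + 2 + 20 * i ∧
    ∀ t, 0 ≤ t → t < i → s'.arr 11 (r t) = t) hN hNB.le (by simp) ?_ ?_ ?_ ?_
  · intro s' hf; simp [hf.1 4 (by simp), hreg]
  · exact ⟨by simp, fun t _ _ => by omega⟩
  · rintro i s' τ' hi0 hin hxi hf ⟨hτ, hI⟩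
    have e9 := hf.2 9 (by simp)
    simp only [wp_store]
    simp [Function.update_apply, hxi, e9, ← hrdef]
    refine ⟨⟨by omega, by omega⟩, by omega, fun t h0 h1 => ?_⟩
    rcases eq_or_lt_of_le h1 with h | h
    · simp [h]
    · rw [if_neg (hr.inj hσ h0 (by omega) hi0 hin h.ne)]; exact hI t h0 h
  rintro s₁ τ₁ - hf₁ ⟨hτ₁, hSA⟩
  have a4 : s₁.reg 4 = N := (hf₁.1 4 (by simp)).trans hreg
  have b4 : s₁.arr 4 = s.arr 4 := hf₁.2 4 (by simp)
  have b9 : s₁.arr 9 = r := hf₁.2 9 (by simp)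
  have b12 : s₁.arr 12 = s.arr 12 := hf₁.2 12 (by simp)
  rw [wp_assign]
  refine ⟨by simp; omega, ?_⟩
  refine wp_for N (fun i s' τ' => τ' ≤ τ₁ + 10 + 100 * i + 20 * s'.reg 24 ∧
    (0 ≤ s'.reg 24 ∧ s'.reg 24 ≤ N) ∧
    (0 < s'.reg 24 → i < N → 1 < r i ∧
      ∀ j, 0 ≤ j → j < N → r j = r i - 1 → Agree σ i j (s'.reg 24)) ∧
    (∀ p, 0 ≤ s'.arr 12 p ∧ s'.arr 12 p ≤ N) ∧
    (∀ t j, 0 ≤ t → t < i → 0 ≤ j → j < N → r j = r t - 1 → IsLcp σ t j (s'.arr 12 (r t))))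
    hN hNB.le (by simp) ?_ ?_ ?_ ?_
  · intro s' hf; rw [eval_reg, hf.1 4 (by simp)]; simp [a4]
  · refine ⟨by simp; omega, by simp [hN], by simp, fun p => ?_, fun t j _ _ => by omega⟩
    simp [b12, h12, hN]
  · rintro i s' τ' hi0 hin hxi hf ⟨hτ, hh, hag, hb12, hI⟩
    have e9 : s'.arr 9 = r := by rw [hf.2 9 (by simp)]; simp [b9]
    have e4 : s'.arr 4 = s.arr 4 := by rw [hf.2 4 (by simp)]; simp [b4]
    have e11 : s'.arr 11 = s₁.arr 11 := by rw [hf.2 11 (by simp)]; simp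
    have hri := hr.mem i hi0 hin
    simp only [wp_seq, wp_assign, wp_cond]
    simp only [eval_reg, eval_cell, eval_less, flag_ne_zero, flag_eq_zero, State.reg_setReg,
      State.arr_setReg, Nat.reduceEqDiff, if_true, if_false, eval_one, eval_sub, cost_reg,
      cost_cell, cost_less, cost_one, cost_sub, hxi, e9, e11]
    refine ⟨by omega, fun hr1 => ?_, fun hr1 => ?_⟩
    · obtain ⟨j, hj0, hjN, hrj⟩ := hr.surj hσ (p := r i - 1) (by omega) (by omega)
      have hsa : s₁.arr 11 (r i - 1) = j := by rw [← hrj]; exact hSA j hj0 hjN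
      have hij : i ≠ j := by rintro rfl; omega
      rw [hsa]
      refine ⟨by omega, ?_⟩
      refine wp_frame_mono (extendMatch_spec (i := i) (j := j) hσ hNB hi0 hin hj0 hjN hij
        (by simpa [e4] using h4) (by simp [hxi]) (by simp) (by simpa using hh.1) ?_) ?_
      · simp only [State.reg_setReg, Nat.reduceEqDiff, if_false]
        rcases eq_or_lt_of_le hh.1 with h | h
        · rw [← h]; intro e _ _; omega
        · exact (hag h hin).2 j hj0 hjN hrj
      rintro s₂ τ₂ hf₂ ⟨hτ₂, hlcp⟩
      have c21 : s₂.reg 21 = r i := by rw [hf₂.1 21 (by simp)]; simp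
      have c12 : s₂.arr 12 = s'.arr 12 := by rw [hf₂.2 12 (by simp)]; simp
      have hle := hlcp.agree.add_le hσ hi0 hj0 hin hjN hij
      have hlc0 := hlcp.nonneg
      simp only [State.reg_setReg, Nat.reduceEqDiff, if_false] at hτ₂
      simp only [wp_store, wp_skip, State.reg_setArr, State.arr_setArr, eval_reg, c21, c12,
        if_true, cost_reg]
      push_cast at hτ₂ ⊢
      have hI' : ∀ t j, 0 ≤ t → t < i + 1 → 0 ≤ j → j < N → r j = r t - 1 →
          IsLcp σ t j (Function.update (s'.arr 12) (r i) (s₂.reg 24) (r t)) := by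
        intro t j' t0 t1 j0 j1 hrj'
        rcases eq_or_lt_of_le (show t ≤ i by omega) with h | h
        · subst h
          have hjj : j' = j := by
            by_contra hne
            exact hr.inj hσ j0 j1 hj0 hjN hne (by omega)
          subst hjj
          simpa using hlcp
        · rw [Function.update_of_ne (hr.inj hσ t0 (by omega) hi0 hin h.ne)]
          exact hI t j' t0 h j0 j1 hrj'
      have hb12' : ∀ p, 0 ≤ Function.update (s'.arr 12) (r i) (s₂.reg 24) p ∧
          Function.update (s'.arr 12) (r i) (s₂.reg 24) p ≤ N := by
        intro p
        rw [Function.update_apply]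
        split_ifs
        · omega
        · exact hb12 p
      refine ⟨by omega, fun hne => ⟨by omega, by omega, by omega, fun hpos hi1 => ⟨?_, ?_⟩,
        hb12', hI'⟩, fun h0 => ⟨by omega, by omega, by omega, hb12', hI'⟩⟩
      · have h1 := hr.succ_lt_succ hσ hi0 hi1 hj0 hjN (by omega) hlcp.agree (by omega)
        have := hr.mem _ h1.1 h1.2.1
        omega
      · intro j' j0 j1 hrj'
        exact hr.agree_succ hσ hi0 hi1 hj0 hjN j0 j1 (by omega) hrj' hlcp.agree
    · simp only [wp_skip, State.reg_setReg, State.arr_setReg, Nat.reduceEqDiff, if_false]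
      push_cast
      have h0 : s'.reg 24 = 0 := by
        by_contra hne
        exact hr1 (hag (by omega) hin).1
      refine ⟨by omega, hh, fun h => by omega, hb12, fun t j t0 t1 j0 j1 hrj => ?_⟩
      rcases eq_or_lt_of_le (show t ≤ i by omega) with h | h
      · subst h; have := hr.mem j j0 j1; omega
      · exact hI t j t0 h j0 j1 hrj
  · rintro s' τ' hx hf ⟨hτ, hh, hag, hb12, hI⟩
    simp only [cost_reg]
    exact ⟨by push_cast; omega, hb12, fun i j h0 h1 => hI i j h0 h1⟩

end

end RAM

/-! ### Range minima -/

/-- Powers of two with an integer exponent. -/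
def pow2 (j : ℤ) : ℤ := 2 ^ j.toNat

theorem pow2_zero : pow2 0 = 1 := rfl

theorem pow2_pos (j : ℤ) : 0 < pow2 j := by unfold pow2; positivity

theorem pow2_add {i j : ℤ} (hi : 0 ≤ i) (hj : 0 ≤ j) : pow2 (i + j) = pow2 i * pow2 j := by
  unfold pow2
  rw [Int.toNat_add hi hj, pow_add]

theorem pow2_succ {j : ℤ} (hj : 0 ≤ j) : pow2 (j + 1) = 2 * pow2 j := by
  rw [pow2_add hj (by norm_num), show pow2 1 = 2 from rfl, mul_comm]

theorem pow2_mono {i j : ℤ} (h : i ≤ j) : pow2 i ≤ pow2 j := by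
  unfold pow2
  exact pow_le_pow_right₀ (by norm_num) (Int.toNat_le_toNat h)

theorem lt_pow2 {j : ℤ} (hj : 0 ≤ j) : j < pow2 j := by
  unfold pow2
  have h := Nat.lt_two_pow_self (n := j.toNat)
  have h' : ((j.toNat : ℕ) : ℤ) < ((2 ^ j.toNat : ℕ) : ℤ) := by exact_mod_cast h
  push_cast at h'
  omega

/-- The binary digit of `x` at place `j`. -/
def digit (x j : ℤ) : ℤ := x / pow2 j % 2

theorem digit_zero (x : ℤ) : digit x 0 = x % 2 := by simp [digit, pow2_zero]

theorem digit_div (x : ℤ) {i j : ℤ} (hi : 0 ≤ i) (hj : 0 ≤ j) :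
    digit (x / pow2 i) j = digit x (i + j) := by
  unfold digit
  rw [Int.ediv_ediv_of_nonneg (pow2_pos i).le, ← pow2_add hi hj]

theorem digit_add_pow2 {m i j : ℤ} (hm0 : 0 ≤ m) (hm : m < pow2 i) (hi : 0 ≤ i) (hj : 0 ≤ j) :
    digit (pow2 i + m) j = if j = i then 1 else digit m j := by
  unfold digit
  rcases lt_trichotomy j i with h | h | h
  · rw [if_neg h.ne]
    have h1 : pow2 i = 2 * pow2 (i - j - 1) * pow2 j := by
      rw [← pow2_succ (by omega), ← pow2_add (by omega) hj]
      congr 1; ring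
    rw [h1, add_comm, Int.add_mul_ediv_right _ _ (pow2_pos j).ne']
    omega
  · subst h
    rw [if_pos rfl, Int.add_ediv_of_dvd_left (dvd_refl _), Int.ediv_self (pow2_pos j).ne',
      Int.ediv_eq_zero_of_lt hm0 hm]
    rfl
  · rw [if_neg h.ne']
    have h1 : 2 * pow2 i ≤ pow2 j := by
      rw [← pow2_succ hi]; exact pow2_mono (by omega)
    rw [Int.ediv_eq_zero_of_lt (by have := pow2_pos i; omega) (by omega),
      Int.ediv_eq_zero_of_lt hm0 (by omega)]

/-- The place of the lowest binary digit `1` of `x`. -/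
structure IsLowest (x j : ℤ) : Prop where
  nonneg : 0 ≤ j
  one : digit x j = 1
  zero : ∀ i, 0 ≤ i → i < j → digit x i = 0

theorem IsLowest.of_odd {x : ℤ} (h : x % 2 = 1) : IsLowest x 0 :=
  ⟨le_rfl, by rw [digit_zero, h], fun i h0 h1 => by omega⟩

theorem IsLowest.of_even {x j : ℤ} (h : x % 2 = 0) (hj : IsLowest (x / 2) j) :
    IsLowest x (j + 1) := by
  have hd : ∀ i, 0 ≤ i → digit (x / 2) i = digit x (i + 1) := fun i hi => by
    have := digit_div x (i := 1) (j := i) (by norm_num) hi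
    rwa [show pow2 1 = 2 from rfl, add_comm] at this
  refine ⟨by have := hj.nonneg; omega, by rw [← hd j hj.nonneg]; exact hj.one, fun i h0 h1 => ?_⟩
  rcases eq_or_lt_of_le h0 with h' | h'
  · rw [← h', digit_zero, h]
  · rw [show i = i - 1 + 1 by ring, ← hd _ (by omega)]
    exact hj.zero _ (by omega) (by omega)

/-! ### Visible positions and masks -/

/-- `p` is smaller than all later positions up to `r`, with respect to `a`. -/
def Visible (a : ℤ → ℤ) (r p : ℤ) : Prop := p ≤ r ∧ ∀ x, p < x → x ≤ r → a p < a x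

/-- The first visible position from `l` on is the place of the minimum. -/
theorem Visible.rangeMin {a : ℤ → ℤ} {l r p : ℤ} (hl : l ≤ p) (hp : Visible a r p)
    (hmin : ∀ q, l ≤ q → q < p → ¬ Visible a r q) : RangeMin a l (r + 1) (a p) := by
  refine ⟨⟨p, hl, by have := hp.1; omega, rfl⟩, ?_⟩
  -- A position before `p` is not visible, so some later value is no larger; following such
  -- positions leads to `p` or beyond, where visibility of `p` applies.
  suffices H : ∀ (n : ℕ) x, p - x ≤ n → l ≤ x → x < r + 1 → a p ≤ a x from
    fun x h0 h1 => H (p - x).toNat x (by omega) h0 h1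
  intro n
  induction n with
  | zero =>
    intro x hx h0 h1
    rcases eq_or_lt_of_le (show p ≤ x by push_cast at hx; omega) with h | h
    · rw [h]
    · exact (hp.2 x h (by omega)).le
  | succ n ih =>
    intro x hx h0 h1
    by_cases hxp : p ≤ x
    · exact ih x (by omega) h0 h1
    · have hnv := hmin x h0 (by omega)
      unfold Visible at hnv
      push Not at hnv
      obtain ⟨y, y0, y1, y2⟩ := hnv (by omega)
      exact (ih y (by push_cast at hx; omega) (by omega) (by omega)).trans y2

/-- `m` is the set of visible positions from `c` on, as a binary number. -/
structure IsMask (a : ℤ → ℤ) (c r m : ℤ) : Prop where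
  nonneg : 0 ≤ m
  lt : m < pow2 (r - c + 1)
  digit : ∀ p, c ≤ p → (digit m (p - c) = 1 ↔ Visible a r p)

/-- Dividing by a power of two removes the positions before `l`; the lowest remaining digit is the
first visible position from `l` on. -/
theorem IsMask.rangeMin {a : ℤ → ℤ} {c l r m j : ℤ} (hm : IsMask a c r m) (hcl : c ≤ l)
    (hj : IsLowest (m / pow2 (l - c)) j) : RangeMin a l (r + 1) (a (l + j)) := by
  have hd : ∀ i, 0 ≤ i → _root_.digit (m / pow2 (l - c)) i = _root_.digit m (l + i - c) :=
    fun i hi => by rw [digit_div _ (by omega) hi]; congr 1; ring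
  have hj0 := hj.nonneg
  refine Visible.rangeMin (by omega) ((hm.digit (l + j) (by omega)).1 ?_) fun q q0 q1 hv => ?_
  · rw [← hd j hj0]; exact hj.one
  · have h1 := (hm.digit q (by omega)).2 hv
    have h2 := hj.zero (q - l) (by omega) (by omega)
    rw [hd _ (by omega)] at h2
    rw [show l + (q - l) - c = q - c by ring] at h2
    omega

/-- Position `r` is visible from itself, so the shifted mask is nonzero and has a lowest digit to
look up. -/
theorem IsMask.div_pos {a : ℤ → ℤ} {c l r m : ℤ} (hm : IsMask a c r m) (hcl : c ≤ l) (hlr : l ≤ r) :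
    1 ≤ m / pow2 (l - c) ∧ m / pow2 (l - c) ≤ m := by
  refine ⟨?_, Int.ediv_le_self _ hm.nonneg⟩
  have h0 : 0 ≤ m / pow2 (l - c) := Int.ediv_nonneg hm.nonneg (pow2_pos _).le
  by_contra hlt
  have hz : m / pow2 (l - c) = 0 := by omega
  have h1 := (hm.digit r (by omega)).2 ⟨le_rfl, fun x _ _ => by omega⟩
  have h2 := digit_div m (i := l - c) (j := r - l) (by omega) (by omega)
  rw [hz, show l - c + (r - l) = r - c by ring, h1] at h2
  simp [_root_.digit] at h2

/-- `q` is the last position before `r` with a smaller value, or `-1`. -/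
structure IsPrev (a : ℤ → ℤ) (r q : ℤ) : Prop where
  ge : -1 ≤ q
  lt : q < r
  between : ∀ p, q < p → p < r → a r ≤ a p
  less : 0 ≤ q → a q < a r

/-- Position `r` hides everything strictly between `q` and itself, since the values there are no
smaller. It hides nothing visible from `q`, because such values are at most `a q < a r`. -/
theorem IsPrev.visible_iff {a : ℤ → ℤ} {r q p : ℤ} (h : IsPrev a r q) (hp0 : 0 ≤ p) :
    Visible a r p ↔ p = r ∨ Visible a q p := by
  constructor
  · rintro ⟨h1, h2⟩
    rcases eq_or_lt_of_le h1 with h3 | h3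
    · exact Or.inl h3
    · right
      have hpq : p ≤ q := by
        by_contra hlt
        have := h.between p (by omega) h3
        have := h2 r h3 le_rfl
        omega
      exact ⟨hpq, fun x x0 x1 => h2 x x0 (by have := h.lt; omega)⟩
  · rintro (h1 | ⟨h1, h2⟩)
    · subst h1; exact ⟨le_rfl, fun x _ _ => by omega⟩
    · have hq := h.less (by omega)
      have hpq : a p ≤ a q := by
        rcases eq_or_lt_of_le h1 with h3 | h3
        · rw [h3]
        · exact (h2 q h3 le_rfl).le
      refine ⟨by have := h.lt; omega, fun x x0 x1 => ?_⟩
      by_cases hx : x ≤ q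
      · exact h2 x x0 hx
      · rcases eq_or_lt_of_le x1 with h3 | h3
        · rw [h3]; omega
        · have := h.between x (by omega) h3; omega

/-- By `IsPrev.visible_iff` the mask at `r` is the mask at the previous smaller position plus the
digit of `r`. If that position lies before the block, nothing else of the block is visible. -/
theorem IsMask.step {a : ℤ → ℤ} {c r q m : ℤ} (hc : 0 ≤ c) (hcr : c ≤ r) (h : IsPrev a r q)
    (hm : c ≤ q → IsMask a c q m) :
    IsMask a c r (pow2 (r - c) + if c ≤ q then m else 0) := by
  have hq := h.lt
  have hb : 0 ≤ (if c ≤ q then m else 0) ∧ (if c ≤ q then m else 0) < pow2 (r - c) := by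
    split_ifs with hcq
    · exact ⟨(hm hcq).nonneg, (hm hcq).lt.trans_le (pow2_mono (by omega))⟩
    · exact ⟨le_rfl, pow2_pos _⟩
  have h2 := pow2_succ (j := r - c) (by omega)
  refine ⟨by have := pow2_pos (r - c); omega, by omega, fun p hp => ?_⟩
  rw [digit_add_pow2 hb.1 hb.2 (by omega) (by omega), h.visible_iff (by omega)]
  by_cases hpr : p = r
  · simp [hpr]
  · rw [if_neg (by omega)]
    simp only [hpr, false_or]
    split_ifs with hcq
    · exact (hm hcq).digit p hp
    · simp only [_root_.digit, Int.zero_ediv, Int.zero_emod, zero_ne_one, false_iff]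
      intro hv
      have := hv.1
      omega

/-! ### Tables for range minima inside blocks -/

namespace RAM

open RAM.Expr RAM.Program

/-- Tabulate powers of two; the block length goes to register `26`. -/
def tabulatePowers : Program :=
  assign 25 1 ;;
  assign 26 0 ;;
  store 16 0 1 ;;
  loop ((reg 25).less (reg 4 + 2))
    (assign 25 (reg 25 * 2) ;; assign 26 (reg 26 + 1) ;; store 16 (reg 26) (reg 25))

/-- Tabulate lowest digits and logarithms; compute the number of blocks in register `27`. -/
def tabulateDigits : Program :=
  assign 27 (reg 4 / reg 26 + 1) ;;
  forLoop 20 (reg 25)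
    (store 15 (reg 20) ((1 - reg 20 % 2) * (cell 15 (reg 20 / 2) + 1)) ;;
     store 17 (reg 20) ((1 : Expr).less (reg 20) * (cell 17 (reg 20 / 2) + 1)))

/-- Compute for every position the mask of visible positions in its block. -/
def tabulateMasks : Program :=
  forLoop 20 (reg 27 * reg 26)
    (assign 21 (reg 20 - 1) ;;
     loop ((const (-1)).less (reg 21) * (1 - (cell 12 (reg 21)).less (cell 12 (reg 20))))
       (assign 21 (cell 13 (reg 21))) ;;
     store 13 (reg 20) (reg 21) ;;
     store 20 (reg 20) (cell 20 (reg 21) + 1) ;;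
     store 14 (reg 20) (cell 16 (reg 20 % reg 26) +
       (reg 20 / reg 26 * reg 26 - 1).less (reg 21) * cell 14 (reg 21)))

section
variable {B : ℤ} {s : State} {τ : ℤ}

/-- The block length is the exponent of the first power of two that reaches `N + 2`. Masks of one
block then lie below a number that is linear in `N`, so tables indexed by masks have linear size. -/
theorem tabulatePowers_spec {N : ℤ} (hN : 0 ≤ N) (hNB : 2 * N + 10 ≤ B) (h4 : s.reg 4 = N) :
    wp B tabulatePowers s τ (fun s' τ' => τ' ≤ τ + 100 * (N + 3) ∧ 1 ≤ s'.reg 26 ∧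
      s'.reg 25 = pow2 (s'.reg 26) ∧ N + 2 ≤ s'.reg 25 ∧ s'.reg 25 ≤ 2 * N + 4 ∧
      s'.reg 26 ≤ N + 2 ∧
      ∀ j, 0 ≤ j → j ≤ s'.reg 26 → s'.arr 16 j = pow2 j) := by
  simp only [tabulatePowers, wp_seq, wp_assign, wp_store]
  refine ⟨by simp; omega, by simp; omega, by simp; omega, ?_⟩
  refine wp_loop (fun s' τ' => τ' ≤ τ + 10 + 50 * s'.reg 26 ∧ 0 ≤ s'.reg 26 ∧
    s'.reg 25 = pow2 (s'.reg 26) ∧ s'.reg 25 ≤ 2 * N + 4 ∧ s'.reg 26 ≤ N + 2 ∧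
    ∀ j, 0 ≤ j → j ≤ s'.reg 26 → s'.arr 16 j = pow2 j) (τ + 10 + 50 * (N + 2)) ?_ ?_ ?_ ?_
  · simp
    refine ⟨by omega, by simp [pow2_zero], by omega, by omega, fun j h0 h1 => ?_⟩
    have : j = 0 := by omega
    simp [this, pow2_zero]
  · rintro s' τ' ⟨h, h', -, -, h'', -⟩
    omega
  · rintro s' τ' hf ⟨hτ, h26, h25, hle, hle', hp⟩ hb
    have e4 : s'.reg 4 = N := by rw [hf.1 4 (by simp)]; simp [h4]
    rw [eval_less, flag_ne_zero] at hb
    simp only [eval_reg, eval_add, eval_ofNat, e4] at hb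
    have h2 := pow2_succ h26
    have h3 := lt_pow2 h26
    simp only [wp_seq, wp_assign, wp_store]
    simp [Function.update_apply]
    refine ⟨⟨by omega, by omega⟩, ⟨by omega, by omega⟩, ⟨by omega, by omega⟩, by omega, by omega,
      by omega, by omega, by omega, fun j h0 h1 => ?_⟩
    split_ifs with h
    · rw [h]; omega
    · exact hp j h0 (by omega)
  · rintro s' τ' hf ⟨hτ, h26, h25, hle, hle', hp⟩ hb
    have e4 : s'.reg 4 = N := by rw [hf.1 4 (by simp)]; simp [h4]
    rw [eval_less, flag_eq_zero] at hb
    simp only [eval_reg, eval_add, eval_ofNat, e4] at hb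
    simp only [cost_less, cost_add, cost_reg, cost_ofNat]
    refine ⟨by push_cast; omega, ?_, h25, by omega, hle, hle', hp⟩
    by_contra h
    have : s'.reg 26 = 0 := by omega
    rw [this, pow2_zero] at h25
    omega

/-- Both tables are filled from the entry at half the index: an even number has its lowest digit one
place further up, and doubling raises the logarithm by one. The entry for `0` in array `15` is
meaningless and is not read later with a nonzero factor. -/
theorem tabulateDigits_spec {N w : ℤ} (hN : 0 ≤ N) (hNB : 2 * N + 10 ≤ B) (h4 : s.reg 4 = N)
    (h26 : s.reg 26 = w) (hw : 1 ≤ w) (h25 : s.reg 25 = pow2 w) (hle : s.reg 25 ≤ 2 * N + 4)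
    (hz15 : s.arr 15 0 = 0) (hz17 : s.arr 17 0 = 0) :
    wp B tabulateDigits s τ (fun s' τ' => τ' ≤ τ + 200 * (N + 3) ∧ s'.reg 27 = N / w + 1 ∧
      (∀ x, 1 ≤ x → x < pow2 w → IsLowest x (s'.arr 15 x)) ∧
      ∀ x, 1 ≤ x → x < pow2 w → 0 ≤ s'.arr 17 x ∧ s'.arr 17 x < w ∧
        pow2 (s'.arr 17 x) ≤ x ∧ x < 2 * pow2 (s'.arr 17 x)) := by
  have hd : N / w ≤ N := Int.ediv_le_self _ hN
  have hd0 : 0 ≤ N / w := Int.ediv_nonneg hN (by omega)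
  simp only [tabulateDigits, wp_seq, wp_assign]
  refine ⟨by simp [h4, h26]; omega, ?_⟩
  refine wp_for (pow2 w) (fun i s' τ' => τ' ≤ τ + 20 + 60 * i ∧
    (∀ x, 1 ≤ x → x < i → IsLowest x (s'.arr 15 x) ∧ s'.arr 15 x ≤ x) ∧
    (i = 0 → s'.arr 15 0 = 0) ∧ s'.arr 17 0 = 0 ∧
    ∀ x, 1 ≤ x → x < i → 0 ≤ s'.arr 17 x ∧ s'.arr 17 x ≤ x ∧
        pow2 (s'.arr 17 x) ≤ x ∧ x < 2 * pow2 (s'.arr 17 x))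
    (pow2_pos w).le (by omega) (by simp) ?_ ?_ ?_ ?_
  · intro s' hf; rw [eval_reg, hf.1 25 (by simp)]; simp [h25]
  · refine ⟨by simp; omega, fun x _ _ => by omega, ?_, ?_, fun x _ _ => by omega⟩
    · simp [hz15]
    · simp [hz17]
  · rintro i s' τ' hi0 hin hxi hf ⟨hτ, h15, h15', h17', h17⟩
    simp only [wp_seq, wp_store]
    simp only [eval_reg, eval_cell, eval_add, eval_sub, eval_mul, eval_div, eval_mod, eval_less,
      eval_one, eval_ofNat, State.reg_setReg, State.arr_setReg, State.reg_setArr,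
      State.arr_setArr, hxi, Nat.reduceEqDiff, if_true, if_false, Function.update_apply,
      cost_reg, cost_cell, cost_add, cost_sub, cost_mul, cost_div, cost_mod, cost_less,
      cost_one, cost_ofNat]
    obtain ⟨u, hu⟩ : ∃ u, u = (1 - i % 2) * (s'.arr 15 (i / 2) + 1) := ⟨_, rfl⟩
    obtain ⟨v, hv⟩ : ∃ v, v = (if 1 < i then 1 else 0) * (s'.arr 17 (i / 2) + 1) := ⟨_, rfl⟩
    rw [← hu, ← hv]
    have hu' : (0 ≤ u ∧ u ≤ i + 1) ∧ (1 ≤ i → IsLowest i u ∧ u ≤ i) ∧ (i = 0 → u ≤ 1) := by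
      rcases Int.emod_two_eq_zero_or_one i with h | h
      · rw [h] at hu
        rcases eq_or_lt_of_le hi0 with h' | h'
        · have := h15' h'.symm
          rw [← h'] at hu; norm_num at hu; omega
        · have h2 := h15 (i / 2) (by omega) (by omega)
          have := h2.1.nonneg
          have h3 := h2.1.of_even h
          have h4 : s'.arr 15 (i / 2) + 1 = u := by omega
          rw [h4] at h3
          exact ⟨by omega, fun _ => ⟨h3, by omega⟩, by omega⟩
      · rw [h] at hu
        have h4 : 0 = u := by omega
        have h3 := IsLowest.of_odd h
        rw [h4] at h3
        exact ⟨by omega, fun _ => ⟨h3, by omega⟩, by omega⟩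
    have hv' : (0 ≤ v ∧ v ≤ i) ∧ (1 ≤ i → pow2 v ≤ i ∧ i < 2 * pow2 v) := by
      by_cases h : 1 < i
      · rw [if_pos h] at hv
        have h2 := h17 (i / 2) (by omega) (by omega)
        have h3 := pow2_succ h2.1
        have h4 : s'.arr 17 (i / 2) + 1 = v := by omega
        rw [h4] at h3
        omega
      · rw [if_neg h] at hv
        have h4 : v = 0 := by omega
        rw [h4, pow2_zero]
        omega
    push_cast
    refine ⟨by omega, by omega, by omega, fun x x0 x1 => ?_, ?_, ?_, fun x x0 x1 => ?_⟩
    · split_ifs with h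
      · rw [h]; exact hu'.2.1 (by omega)
      · exact h15 x x0 (by omega)
    · intro h; omega
    · split_ifs with h
      · omega
      · exact h17'
    · split_ifs with h
      · have := hv'.2 (by omega); rw [h]; omega
      · exact h17 x x0 (by omega)
  · rintro s' τ' hx hf ⟨hτ, h15, -, -, h17⟩
    have e27 : s'.reg 27 = N / w + 1 := by
      rw [hf.1 27 (by simp)]; simp [h4, h26]
    simp only [cost_reg]
    refine ⟨by push_cast; omega, e27, fun x x0 x1 => (h15 x x0 x1).1, fun x x0 x1 => ?_⟩
    have h := h17 x x0 x1
    refine ⟨h.1, ?_, h.2.2⟩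
    by_contra hlt
    have := pow2_mono (show w ≤ s'.arr 17 x by omega)
    omega

end

end RAM

namespace RAM

open RAM.Expr RAM.Program

section
variable {B : ℤ} {s : State} {τ : ℤ}

theorem flag_mul_ne_zero {p q : Prop} [Decidable p] [Decidable q] :
    (if p then (1 : ℤ) else 0) * (1 - if q then 1 else 0) ≠ 0 ↔ p ∧ ¬q := by
  split_ifs <;> simp_all

/-- Go back along array `13` to the last position with a value smaller than at register `20`. -/
def findPrev : Program :=
  loop ((const (-1)).less (reg 21) * (1 - (cell 12 (reg 21)).less (cell 12 (reg 20))))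
    (assign 21 (cell 13 (reg 21)))

@[simp] theorem regs_findPrev : findPrev.regs = [21] := rfl
@[simp] theorem arrs_findPrev : findPrev.arrs = [] := rfl

/-- All positions passed over carry values that are no smaller, so jumping along previous smaller
positions misses nothing. `D` is the length of the chain of jumps, and each jump shortens it by one.
-/
theorem findPrev_spec {a D : ℤ → ℤ} {r : ℤ} (h12 : s.arr 12 = a) (h20 : s.reg 20 = r)
    (h21 : s.reg 21 = r - 1) (hr : 0 ≤ r) (hrB : r ≤ B)
    (hprev : ∀ q, 0 ≤ q → q < r → IsPrev a q (s.arr 13 q))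
    (hD : ∀ q, 0 ≤ q → q < r → D q = D (s.arr 13 q) + 1) (hD0 : ∀ q, -1 ≤ q → q < r → 0 ≤ D q) :
    wp B findPrev s τ (fun s' τ' => τ' ≤ τ + 20 + 30 * (D (r - 1) - D (s'.reg 21)) ∧
      IsPrev a r (s'.reg 21)) := by
  refine wp_loop (fun s' τ' => τ' ≤ τ + 30 * (D (r - 1) - D (s'.reg 21)) ∧
    (-1 ≤ s'.reg 21 ∧ s'.reg 21 < r) ∧ ∀ p, s'.reg 21 < p → p < r → a r ≤ a p)
    (τ + 30 * D (r - 1)) ?_ ?_ ?_ ?_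
  · rw [h21]; exact ⟨by omega, by omega, fun p _ _ => by omega⟩
  · rintro s' τ' ⟨h, h', -⟩
    have := hD0 _ h'.1 h'.2
    omega
  · rintro s' τ' hf ⟨hτ, hq, hI⟩ hb
    have e12 := (hf.2 12 (by simp)).trans h12
    have e13 := hf.2 13 (by simp)
    have e20 := (hf.1 20 (by simp)).trans h20
    rw [eval_mul, eval_sub, eval_less, eval_less, eval_one, flag_mul_ne_zero] at hb
    simp only [eval_const, eval_reg, eval_cell, e12, e20] at hb
    obtain ⟨q, hqe⟩ : ∃ q, q = s'.reg 21 := ⟨_, rfl⟩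
    rw [← hqe] at hb hq hI hτ
    obtain ⟨hb0, hb1⟩ := hb
    have hp := hprev q (by omega) hq.2
    have h1 := hp.ge
    have h2 := hp.lt
    have h3 := hD q (by omega) hq.2
    rw [wp_assign]
    simp only [eval_cell, eval_reg, e13, ← hqe, State.reg_setReg, if_true, cost_mul, cost_less,
      cost_const, cost_reg, cost_sub, cost_one, cost_cell]
    push_cast
    refine ⟨by omega, by omega, by omega, fun p p0 p1 => ?_⟩
    rcases lt_trichotomy p q with h | h | h
    · have := hp.between p p0 h; omega
    · rw [h]; omega
    · exact hI p h p1
  · rintro s' τ' hf ⟨hτ, hq, hI⟩ hb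
    have e12 := (hf.2 12 (by simp)).trans h12
    have e20 := (hf.1 20 (by simp)).trans h20
    rw [eval_mul, eval_sub, eval_less, eval_less, eval_one, ← not_ne_iff, flag_mul_ne_zero] at hb
    simp only [eval_const, eval_reg, eval_cell, e12, e20] at hb
    simp only [cost_mul, cost_less, cost_const, cost_reg, cost_sub, cost_one, cost_cell]
    refine ⟨by push_cast; omega, hq.1, hq.2, hI, fun h => ?_⟩
    by_contra hlt
    exact hb ⟨by omega, hlt⟩

theorem tabulateMasks_eq : tabulateMasks = forLoop 20 (reg 27 * reg 26)
    (assign 21 (reg 20 - 1) ;; findPrev ;; store 13 (reg 20) (reg 21) ;;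
     store 20 (reg 20) (cell 20 (reg 21) + 1) ;;
     store 14 (reg 20) (cell 16 (reg 20 % reg 26) +
       (reg 20 / reg 26 * reg 26 - 1).less (reg 21) * cell 14 (reg 21))) := rfl

theorem tabulateMasks_spec {a : ℤ → ℤ} {w M : ℤ} (h12 : s.arr 12 = a) (h26 : s.reg 26 = w)
    (hw : 1 ≤ w) (hM : s.reg 27 * w = M) (hM0 : 0 ≤ M) (hMB : M < B) (hpB : pow2 w ≤ B)
    (h16 : ∀ j, 0 ≤ j → j ≤ w → s.arr 16 j = pow2 j) (h20 : s.arr 20 (-1) = 0) :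
    wp B tabulateMasks s τ (fun s' τ' => τ' ≤ τ + 200 * (M + 1) ∧
      ∀ r, 0 ≤ r → r < M → IsMask a (r / w * w) r (s'.arr 14 r)) := by
  rw [tabulateMasks_eq]
  -- Amortisation: the chain length stored in array `20` grows by at most one per position, and
  -- every jump shrinks it. It enters the clock with a negative sign; array `20` affects no other
  -- value and exists for this count only.
  refine wp_for M (fun i s' τ' => τ' ≤ τ + 2 + 150 * i - 30 * s'.arr 20 (i - 1) ∧
    s'.arr 20 (-1) = 0 ∧
    (∀ r, 0 ≤ r → r < i → IsPrev a r (s'.arr 13 r)) ∧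
    (∀ r, 0 ≤ r → r < i → s'.arr 20 r = s'.arr 20 (s'.arr 13 r) + 1) ∧
    (∀ r, 0 ≤ r → r < i → 0 ≤ s'.arr 20 r ∧ s'.arr 20 r ≤ r + 1) ∧
    ∀ r, 0 ≤ r → r < i → IsMask a (r / w * w) r (s'.arr 14 r)) hM0 hMB.le (by simp) ?_ ?_ ?_ ?_
  · intro s' hf; simp [hf.1 27 (by simp), hf.1 26 (by simp), hM, h26]
  · refine ⟨?_, by simpa using h20, ?_, ?_, ?_, ?_⟩
    · simp [h20]
    all_goals intro r _ _; omega
  · rintro i s' τ' hi0 hin hxi hf ⟨hτ, hneg, hP, hD, hDb, hK⟩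
    have e12 := (hf.2 12 (by simp)).trans h12
    have e16 := hf.2 16 (by simp)
    have e26 := (hf.1 26 (by simp)).trans h26
    simp only [wp_seq, wp_assign]
    refine ⟨by simp [hxi]; omega, ?_⟩
    have hDb' : ∀ q, -1 ≤ q → q < i → 0 ≤ s'.arr 20 q ∧ s'.arr 20 q ≤ q + 1 := fun q q0 q1 => by
      rcases eq_or_lt_of_le q0 with h | h
      · rw [← h, hneg]; omega
      · exact hDb q (by omega) q1
    refine wp_frame_mono (findPrev_spec (a := a) (D := s'.arr 20) (r := i) (by simpa using e12)
      (by simpa using hxi) (by simp [hxi]) hi0 (by omega) (by simpa using hP) (by simpa using hD)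
      (fun q q0 q1 => (hDb' q q0 q1).1)) ?_
    rintro s₁ τ₁ hf₁ ⟨hτ₁, hq⟩
    have f20 : s₁.reg 20 = i := by rw [hf₁.1 20 (by simp)]; simp [hxi]
    have f26 : s₁.reg 26 = w := by rw [hf₁.1 26 (by simp)]; simp [e26]
    have g20 : s₁.arr 20 = s'.arr 20 := by rw [hf₁.2 20 (by simp)]; simp
    have g14 : s₁.arr 14 = s'.arr 14 := by rw [hf₁.2 14 (by simp)]; simp
    have g13 : s₁.arr 13 = s'.arr 13 := by rw [hf₁.2 13 (by simp)]; simp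
    have g16 : s₁.arr 16 = s.arr 16 := by rw [hf₁.2 16 (by simp)]; simp [e16]
    obtain ⟨q, hqe⟩ : ∃ q, q = s₁.reg 21 := ⟨_, rfl⟩
    rw [← hqe] at hq hτ₁
    have hq0 := hq.ge
    have hq1 := hq.lt
    have hdm := Int.emod_add_mul_ediv i w
    have hmod0 := Int.emod_nonneg i (show w ≠ 0 by omega)
    have hmod1 := Int.emod_lt_of_pos i (show 0 < w by omega)
    have hdiv0 : 0 ≤ i / w := Int.ediv_nonneg hi0 (by omega)
    have hc0 : 0 ≤ i / w * w := mul_nonneg hdiv0 (by omega)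
    rw [mul_comm w] at hdm
    have hpw : s.arr 16 (i % w) = pow2 (i - i / w * w) := by
      rw [h16 _ hmod0 hmod1.le]; congr 1; omega
    have hmask := IsMask.step (c := i / w * w) (m := s'.arr 14 q) hc0 (by omega) hq fun hcq => by
      have := hK q (by omega) hq1
      have h1 : i / w ≤ q / w := (Int.le_ediv_iff_mul_le (by omega)).2 hcq
      have h2 : q / w ≤ i / w := Int.ediv_le_ediv (by omega) (by omega)
      rwa [show q / w = i / w by omega] at this
    have hval : pow2 (i - i / w * w) + (if i / w * w - 1 < q then 1 else 0) * s'.arr 14 q =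
        pow2 (i - i / w * w) + if i / w * w ≤ q then s'.arr 14 q else 0 := by
      by_cases h : i / w * w ≤ q
      · rw [if_pos h, if_pos (by omega), one_mul]
      · rw [if_neg h, if_neg (by omega), zero_mul]
    have hmlt := hmask.lt.trans_le (pow2_mono (show i - i / w * w + 1 ≤ w by omega))
    have hm0 := hmask.nonneg
    have hdq := hDb' q hq0 hq1
    simp only [wp_store, State.reg_setArr, State.arr_setArr, State.arr_setReg,
      Nat.reduceEqDiff, if_true, if_false, eval_reg, eval_cell, eval_add, eval_sub, eval_mul,
      eval_div, eval_mod, eval_less, eval_one, f20, f26, g20, g14, g13, g16, ← hqe, hpw, hval,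
      cost_reg, cost_cell, cost_add, cost_sub, cost_mul, cost_div, cost_mod, cost_less, cost_one]
    simp only [cost_mul, cost_reg, cost_sub, cost_one] at hτ₁
    push_cast at hτ₁ ⊢
    have hold : ∀ {α : ℤ → ℤ → Prop} {g : ℤ → ℤ} {v : ℤ}, α i v →
        (∀ r, 0 ≤ r → r < i → α r (g r)) → ∀ r, 0 ≤ r → r < i + 1 →
        α r (Function.update g i v r) := by
      intro α g v hv hg r r0 r1
      rcases eq_or_lt_of_le (show r ≤ i by omega) with h | h
      · subst h; simpa using hv
      · rw [Function.update_of_ne h.ne]; exact hg r r0 h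
    refine ⟨by omega, by omega, by omega, ?_, ?_, hold (α := fun r v => IsPrev a r v) hq hP, ?_,
      hold (α := fun r v => 0 ≤ v ∧ v ≤ r + 1) (by omega) hDb,
      hold (α := fun r v => IsMask a (r / w * w) r v) hmask hK⟩
    · rw [show i + 1 - 1 = i by ring, Function.update_self]
      omega
    · rw [Function.update_of_ne (by omega)]; exact hneg
    · intro r r0 r1
      rcases eq_or_lt_of_le (show r ≤ i by omega) with h | h
      · subst h; rw [Function.update_self, Function.update_self, Function.update_of_ne hq1.ne]
      · have h1 := (hP r r0 h).lt
        rw [Function.update_of_ne h.ne, Function.update_of_ne h.ne,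
          Function.update_of_ne (by omega)]
        exact hD r r0 h
  · rintro s' τ' hx hf ⟨hτ, hneg, hP, hD, hDb, hK⟩
    simp only [cost_mul, cost_reg]
    refine ⟨?_, hK⟩
    have : 0 ≤ s'.arr 20 (M - 1) := by
      rcases eq_or_lt_of_le hM0 with h | h
      · rw [← h]; norm_num [hneg]
      · exact (hDb _ (by omega) (by omega)).1
    push_cast; omega

end

end RAM

/-! ### Minima of runs of blocks -/

/-- Minima of all runs of `2 ^ e` blocks of length `w`. -/
def SparseRow (a : ℤ → ℤ) (w nb : ℤ) (f : ℤ → ℤ) (e : ℤ) : Prop :=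
  ∀ b, 0 ≤ b → b + pow2 e ≤ nb → RangeMin a (b * w) ((b + pow2 e) * w) (f b)

theorem SparseRow.union {a f : ℤ → ℤ} {w nb e b : ℤ} (h : SparseRow a w nb f e) (hw : 0 ≤ w)
    (he : 0 ≤ e) (hb : 0 ≤ b) (hbn : b + pow2 (e + 1) ≤ nb) :
    RangeMin a (b * w) ((b + pow2 (e + 1)) * w) (min (f b) (f (b + pow2 e))) := by
  have h2 := pow2_succ he
  have h0 := pow2_pos e
  have := (h b hb (by omega)).union (h (b + pow2 e) (by omega) (by omega))
    (by nlinarith) le_rfl (by nlinarith)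
  rwa [show b + pow2 e + pow2 e = b + pow2 (e + 1) by rw [h2]; ring] at this

/-- Tables that answer range minimum queries on the first `nb * w` values of `a`. -/
structure RmqTables (a : ℤ → ℤ) (w nb Z : ℤ) (mask lsb pw lg sp : ℤ → ℤ) : Prop where
  one_le : 1 ≤ w
  mask : ∀ r, 0 ≤ r → r < nb * w → IsMask a (r / w * w) r (mask r)
  lsb : ∀ x, 1 ≤ x → x < pow2 w → IsLowest x (lsb x)
  pow : ∀ j, 0 ≤ j → j ≤ w → pw j = pow2 j
  log : ∀ x, 1 ≤ x → x < pow2 w → 0 ≤ lg x ∧ lg x < w ∧ pow2 (lg x) ≤ x ∧ x < 2 * pow2 (lg x)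
  sparse : ∀ e, 0 ≤ e → pow2 e ≤ nb → SparseRow a w nb (fun b => sp (e * Z + b)) e
  blocks_lt : nb < pow2 w

namespace RAM

open RAM.Expr RAM.Program

/-- Compute the row in register `21` of the table of minima of runs of blocks. -/
def doubleRuns : Program :=
  forLoop 20 (reg 27 + 1 - cell 16 (reg 21))
    (assign 22 (cell 19 ((reg 21 - 1) * reg 3 + reg 20)) ;;
     assign 23 (cell 19 ((reg 21 - 1) * reg 3 + reg 20 + cell 16 (reg 21 - 1))) ;;
     cond ((reg 23).less (reg 22)) (assign 22 (reg 23)) skip ;;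
     store 19 (reg 21 * reg 3 + reg 20) (reg 22))

/-- Compute the minima of all blocks. -/
def blockMinima : Program :=
  forLoop 20 (reg 27)
    (store 19 (reg 20) (cell 12 (reg 20 * reg 26 +
      cell 15 (cell 14 (reg 20 * reg 26 + reg 26 - 1)))))

/-- Compute the minima of all runs of blocks whose length is a power of two. -/
def tabulateRuns : Program :=
  blockMinima ;;
  assign 21 1 ;;
  loop ((cell 16 (reg 21)).less (reg 27 + 1)) (doubleRuns ;; assign 21 (reg 21 + 1))

@[simp] theorem regs_doubleRuns : doubleRuns.regs = [20, 22, 23, 22, 20] := rfl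
@[simp] theorem arrs_doubleRuns : doubleRuns.arrs = [19] := rfl
@[simp] theorem regs_blockMinima : blockMinima.regs = [20, 20] := rfl
@[simp] theorem arrs_blockMinima : blockMinima.arrs = [19] := rfl

section
variable {B : ℤ} {s : State} {τ : ℤ}

theorem doubleRuns_spec {a : ℤ → ℤ} {w nb Z e N : ℤ} (h3 : s.reg 3 = Z) (h21 : s.reg 21 = e + 1)
    (h27 : s.reg 27 = nb) (he : 0 ≤ e) (hw : 0 ≤ w) (h16 : s.arr 16 e = pow2 e)
    (h16' : s.arr 16 (e + 1) = pow2 (e + 1)) (hnb : pow2 (e + 1) ≤ nb) (hnbZ : nb ≤ Z)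
    (hZB : Z ≤ B) (ha : ∀ p, 0 ≤ a p ∧ a p ≤ N) (hNB : N ≤ B)
    (hrow : SparseRow a w nb (fun b => s.arr 19 (e * Z + b)) e) :
    wp B doubleRuns s τ (fun s' τ' => τ' ≤ τ + 20 + 100 * nb ∧
      SparseRow a w nb (fun b => s'.arr 19 ((e + 1) * Z + b)) (e + 1) ∧
      ∀ p, p < (e + 1) * Z → s'.arr 19 p = s.arr 19 p) := by
  have hp2 := pow2_succ he
  have hp0 := pow2_pos e
  have hmul : (e + 1) * Z = e * Z + Z := by ring
  refine wp_for (nb + 1 - pow2 (e + 1)) (fun i s' τ' => τ' ≤ τ + 2 + 80 * i ∧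
    (∀ b, 0 ≤ b → b < i →
      RangeMin a (b * w) ((b + pow2 (e + 1)) * w) (s'.arr 19 ((e + 1) * Z + b))) ∧
    ∀ p, p < (e + 1) * Z → s'.arr 19 p = s.arr 19 p) (by omega) (by omega) (by simp) ?_ ?_ ?_ ?_
  · intro s' hf
    simp only [eval_sub, eval_add, eval_reg, eval_one, eval_cell]
    rw [hf.1 27 (by simp), hf.1 21 (by simp), hf.2 16 (by simp), h27, h21, h16']
  · exact ⟨by omega, fun b _ _ => by omega, fun p _ => by simp⟩
  · rintro i s' τ' hi0 hin hxi hf ⟨hτ, hI, hlow⟩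
    have e3 := (hf.1 3 (by simp)).trans h3
    have e21 := (hf.1 21 (by simp)).trans h21
    have e16 := hf.2 16 (by simp)
    have g1 : s'.arr 19 (e * Z + i) = s.arr 19 (e * Z + i) := hlow _ (by omega)
    have g2 : s'.arr 19 (e * Z + i + pow2 e) = s.arr 19 (e * Z + (i + pow2 e)) := by
      rw [hlow _ (by omega), add_assoc]
    obtain ⟨u, hu⟩ : ∃ u, u = s.arr 19 (e * Z + i) := ⟨_, rfl⟩
    obtain ⟨v, hv⟩ : ∃ v, v = s.arr 19 (e * Z + (i + pow2 e)) := ⟨_, rfl⟩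
    have hR := hrow.union hw he hi0 (by omega)
    have hu' : 0 ≤ u ∧ u ≤ N := by
      obtain ⟨x, -, -, hx⟩ := (hrow i hi0 (by omega)).attained
      have := ha x; rw [hu]; dsimp only at hx; omega
    have hv' : 0 ≤ v ∧ v ≤ N := by
      obtain ⟨x, -, -, hx⟩ := (hrow (i + pow2 e) (by omega) (by omega)).attained
      have := ha x; rw [hv]; dsimp only at hx; omega
    rw [← hu, ← hv] at hR
    have fin : ∀ z, z = min u v →
        (∀ b, 0 ≤ b → b < i + 1 → RangeMin a (b * w) ((b + pow2 (e + 1)) * w)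
          (Function.update (s'.arr 19) ((e + 1) * Z + i) z ((e + 1) * Z + b))) ∧
        ∀ p, p < (e + 1) * Z →
          Function.update (s'.arr 19) ((e + 1) * Z + i) z p = s.arr 19 p := by
      intro z hz
      refine ⟨fun b b0 b1 => ?_, fun p hp => ?_⟩
      · rcases eq_or_lt_of_le (show b ≤ i by omega) with h | h
        · rw [h, Function.update_self, hz]; exact hR
        · rw [Function.update_of_ne (by omega)]; exact hI b b0 h
      · rw [Function.update_of_ne (by omega)]; exact hlow p hp
    simp only [wp_seq, wp_assign, wp_cond, wp_skip, wp_store]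
    simp only [eval_reg, eval_cell, eval_add, eval_sub, eval_mul, eval_less, eval_one,
      flag_ne_zero, flag_eq_zero, State.reg_setReg, State.arr_setReg, State.arr_setArr,
      Nat.reduceEqDiff, if_true, if_false, e3, e21, e16, hxi, add_sub_cancel_right, h16, g1, g2,
      ← hu, ← hv, cost_reg, cost_cell, cost_add, cost_sub, cost_mul, cost_less, cost_one]
    push_cast
    exact ⟨by omega, by omega,
      fun h => ⟨by omega, by omega, by omega, fin v (by omega)⟩,
      fun h => ⟨by omega, by omega, fin u (by omega)⟩⟩
  · rintro s' τ' hx hf ⟨hτ, hI, hlow⟩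
    simp only [cost_sub, cost_add, cost_reg, cost_one, cost_cell]
    exact ⟨by push_cast; omega, fun b b0 b1 => hI b b0 (by omega), hlow⟩

/-- The mask at the last position of a block describes the whole block, so its lowest digit is the
place of the minimum. -/
theorem blockMinima_spec {a : ℤ → ℤ} {w nb N : ℤ} (h26 : s.reg 26 = w)
    (h27 : s.reg 27 = nb) (hw : 1 ≤ w) (hnb : 0 ≤ nb) (hnbB : nb ≤ B) (h12 : s.arr 12 = a)
    (ha : ∀ p, 0 ≤ a p ∧ a p ≤ N) (hNB : N ≤ B)
    (hmask : ∀ r, 0 ≤ r → r < nb * w → IsMask a (r / w * w) r (s.arr 14 r))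
    (hlsb : ∀ x, 1 ≤ x → x < pow2 w → IsLowest x (s.arr 15 x)) :
    wp B blockMinima s τ (fun s' τ' => τ' ≤ τ + 20 + 100 * nb ∧
      SparseRow a w nb (s'.arr 19) 0) := by
  refine wp_for nb (fun i s' τ' => τ' ≤ τ + 2 + 80 * i ∧
    ∀ b, 0 ≤ b → b < i → RangeMin a (b * w) ((b + 1) * w) (s'.arr 19 b))
    hnb hnbB (by simp) ?_ ?_ ?_ ?_
  · intro s' hf; rw [eval_reg, hf.1 27 (by simp), h27]
  · exact ⟨by omega, fun b _ _ => by omega⟩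
  · rintro i s' τ' hi0 hin hxi hf ⟨hτ, hI⟩
    have e26 := (hf.1 26 (by simp)).trans h26
    have e12 := (hf.2 12 (by simp)).trans h12
    have e14 := hf.2 14 (by simp)
    have e15 := hf.2 15 (by simp)
    have hiw : 0 ≤ i * w := mul_nonneg hi0 (by omega)
    have hiw' : (i + 1) * w ≤ nb * w := mul_le_mul_of_nonneg_right (by omega) (by omega)
    have hdiv : (i * w + w - 1) / w = i := by
      rw [show i * w + w - 1 = w - 1 + i * w by ring, Int.add_mul_ediv_right _ _ (by omega),
        Int.ediv_eq_zero_of_lt (by omega) (by omega), zero_add]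
    have hsucc : (i + 1) * w = i * w + w := by ring
    have hm := hmask (i * w + w - 1) (by omega) (by omega)
    rw [hdiv] at hm
    have hpos := hm.div_pos le_rfl (by omega)
    rw [sub_self, pow2_zero, Int.ediv_one] at hpos
    have hlt := hm.lt
    rw [show i * w + w - 1 - i * w + 1 = w by ring] at hlt
    have hR := hm.rangeMin (j := s.arr 15 (s.arr 14 (i * w + w - 1))) le_rfl (by
      rw [sub_self, pow2_zero, Int.ediv_one]; exact hlsb _ hpos.1 hlt)
    rw [show i * w + w - 1 + 1 = (i + 1) * w by ring] at hR
    have hb := ha (i * w + s.arr 15 (s.arr 14 (i * w + w - 1)))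
    simp only [wp_store]
    simp only [eval_reg, eval_cell, eval_add, eval_sub, eval_mul, eval_one, State.arr_setReg,
      State.arr_setArr, if_true, e26, e12, e14, e15, hxi, cost_reg, cost_cell, cost_add, cost_sub,
      cost_mul, cost_one]
    push_cast
    refine ⟨by omega, by omega, fun b b0 b1 => ?_⟩
    rcases eq_or_lt_of_le (show b ≤ i by omega) with h | h
    · rw [h, Function.update_self]; exact hR
    · rw [Function.update_of_ne (by omega)]; exact hI b b0 h
  · rintro s' τ' hx hf ⟨hτ, hI⟩
    simp only [cost_reg]
    exact ⟨by push_cast; omega, fun b b0 b1 => hI b b0 (by rw [pow2_zero] at b1; omega)⟩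

/-- There are at most `w` rows because `2 ^ e ≤ nb < 2 ^ w`, and a row takes `O(nb)` steps. As `nb *
w` is about the length of the array, the table costs linear time; this is the reason for using
blocks. -/
theorem tabulateRuns_spec {a : ℤ → ℤ} {w nb Z N : ℤ} (h3 : s.reg 3 = Z) (h26 : s.reg 26 = w)
    (h27 : s.reg 27 = nb) (hw : 1 ≤ w) (hnb : 1 ≤ nb) (hnbZ : nb ≤ Z) (hZB : Z ≤ B)
    (hwB : w < B) (hnbw : nb < pow2 w) (h12 : s.arr 12 = a)
    (ha : ∀ p, 0 ≤ a p ∧ a p ≤ N) (hNB : N ≤ B)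
    (h16 : ∀ j, 0 ≤ j → j ≤ w → s.arr 16 j = pow2 j)
    (hmask : ∀ r, 0 ≤ r → r < nb * w → IsMask a (r / w * w) r (s.arr 14 r))
    (hlsb : ∀ x, 1 ≤ x → x < pow2 w → IsLowest x (s.arr 15 x)) :
    wp B tabulateRuns s τ (fun s' τ' => τ' ≤ τ + 200 * (nb * w + w + nb + 1) ∧
      ∀ e, 0 ≤ e → pow2 e ≤ nb → SparseRow a w nb (fun b => s'.arr 19 (e * Z + b)) e) := by
  simp only [tabulateRuns, wp_seq]
  refine wp_frame_mono (blockMinima_spec h26 h27 hw (by omega) (by omega) h12 ha hNB hmask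
    hlsb) ?_
  rintro s₁ τ₁ hf₁ ⟨hτ₁, h0⟩
  replace h3 := (hf₁.1 3 (by simp)).trans h3
  replace h27 := (hf₁.1 27 (by simp)).trans h27
  have b16 := hf₁.2 16 (by simp)
  rw [wp_assign]
  refine ⟨by simp; omega, ?_⟩
  have hlt : ∀ e, 0 ≤ e → pow2 e ≤ nb → e < w := fun e e0 he => by
    by_contra h
    have := pow2_mono (show w ≤ e by omega)
    omega
  refine wp_loop (fun s' τ' => τ' ≤ τ₁ + 2 + (s'.reg 21 - 1) * (100 * nb + 100) ∧
    1 ≤ s'.reg 21 ∧ pow2 (s'.reg 21 - 1) ≤ nb ∧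
    ∀ e, 0 ≤ e → e < s'.reg 21 → SparseRow a w nb (fun b => s'.arr 19 (e * Z + b)) e)
    (τ₁ + 2 + w * (100 * nb + 100)) ?_ ?_ ?_ ?_
  · refine ⟨by simp, by simp, by simpa [pow2_zero] using hnb, fun e e0 e1 => ?_⟩
    have : e = 0 := by simp at e1; omega
    subst this
    simpa using h0
  · rintro s' τ' ⟨hτ, hj, hp, -⟩
    have h1 := hlt _ (by omega) hp
    have := mul_le_mul_of_nonneg_right (show s'.reg 21 - 1 ≤ w by omega)
      (show 0 ≤ 100 * nb + 100 by omega)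
    omega
  · rintro s' τ' hf ⟨hτ, hj, hp, hI⟩ hb
    have e3 : s'.reg 3 = Z := by rw [hf.1 3 (by simp)]; simp [h3]
    have e27 : s'.reg 27 = nb := by rw [hf.1 27 (by simp)]; simp [h27]
    have e16 : s'.arr 16 = s.arr 16 := by rw [hf.2 16 (by simp)]; simp [b16]
    obtain ⟨e, he⟩ : ∃ e, s'.reg 21 = e + 1 := ⟨s'.reg 21 - 1, by ring⟩
    rw [he] at hτ hj hp hI
    rw [add_sub_cancel_right] at hτ hp
    have hew := hlt e (by omega) hp
    rw [eval_less, flag_ne_zero] at hb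
    simp only [eval_cell, eval_reg, eval_add, eval_one, e27, he, e16] at hb
    rw [h16 _ (by omega) (by omega)] at hb
    rw [wp_seq]
    refine wp_frame_mono (doubleRuns_spec e3 he e27 (by omega) (by omega : (0 : ℤ) ≤ w)
      (by rw [e16]; exact h16 _ (by omega) (by omega))
      (by rw [e16]; exact h16 _ (by omega) (by omega)) (by omega) hnbZ hZB ha hNB
      (hI e (by omega) (by omega))) ?_
    rintro s₂ τ₂ hf₂ ⟨hτ₂, hrow, hlow⟩
    have g21 := (hf₂.1 21 (by simp)).trans he
    rw [wp_assign]
    simp only [eval_add, eval_reg, eval_one, g21, State.reg_setReg, State.arr_setReg, if_true,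
      add_sub_cancel_right, cost_add, cost_reg, cost_one]
    simp only [cost_less, cost_cell, cost_reg, cost_add, cost_one] at hτ₂
    push_cast at hτ₂ ⊢
    have hmul : (e + 1) * (100 * nb + 100) = e * (100 * nb + 100) + (100 * nb + 100) := by ring
    refine ⟨by omega, by omega, by omega, by omega, fun e' e0 e1 => ?_⟩
    rcases eq_or_lt_of_le (show e' ≤ e + 1 by omega) with h | h
    · subst h; exact hrow
    · intro b b0 b1
      have h1 : (e' + 1) * Z ≤ (e + 1) * Z := mul_le_mul_of_nonneg_right (by omega) (by omega)
      have h2 : (e' + 1) * Z = e' * Z + Z := by ring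
      have := pow2_pos e'
      dsimp only
      rw [hlow _ (by omega)]
      exact hI e' e0 h b b0 b1
  · rintro s' τ' hf ⟨hτ, hj, hp, hI⟩ hb
    have e27 : s'.reg 27 = nb := by rw [hf.1 27 (by simp)]; simp [h27]
    have e16 : s'.arr 16 = s.arr 16 := by rw [hf.2 16 (by simp)]; simp [b16]
    have hjw := hlt _ (by omega) hp
    rw [eval_less, flag_eq_zero] at hb
    simp only [eval_cell, eval_reg, eval_add, eval_one, e27, e16] at hb
    rw [h16 _ (by omega) (by omega)] at hb
    simp only [cost_less, cost_cell, cost_reg, cost_add, cost_one]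
    have hm := mul_le_mul_of_nonneg_right (show s'.reg 21 - 1 ≤ w by omega)
      (show 0 ≤ 100 * nb + 100 by omega)
    have hm' : w * (100 * nb + 100) = 100 * (nb * w) + 100 * w := by ring
    have hnw : 0 ≤ nb * w := mul_nonneg (by omega) (by omega)
    refine ⟨by push_cast; omega, fun e e0 e1 => hI e e0 ?_⟩
    by_contra h
    have := pow2_mono (show s'.reg 21 ≤ e by omega)
    omega

end

end RAM

/-! ### Range minimum queries -/

theorem RmqTables.inBlock {a : ℤ → ℤ} {w nb Z : ℤ} {mask lsb pw lg sp : ℤ → ℤ}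
    (h : RmqTables a w nb Z mask lsb pw lg sp) {l r : ℤ} (hl : 0 ≤ l) (hlr : l ≤ r)
    (hr : r < nb * w) (hb : l / w = r / w) :
    RangeMin a l (r + 1) (a (l + lsb (mask r / pw (l % w)))) := by
  have hw := h.one_le
  have hdm := Int.emod_add_mul_ediv l w
  have hdm' := Int.emod_add_mul_ediv r w
  have hmod0 := Int.emod_nonneg l (show w ≠ 0 by omega)
  have hmod1 := Int.emod_lt_of_pos l (show 0 < w by omega)
  have hmod1' := Int.emod_lt_of_pos r (show 0 < w by omega)
  rw [mul_comm w] at hdm hdm'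
  rw [hb] at hdm
  have hm := h.mask r (by omega) hr
  have hp := hm.div_pos (l := l) (by omega) hlr
  have hlt := hm.lt.trans_le (pow2_mono (show r - r / w * w + 1 ≤ w by omega))
  -- Both positions lie in the same block, so `l % w` is the distance of `l` from the start of the
  -- block in which the mask of `r` is counted.
  rw [h.pow _ hmod0 hmod1.le, show l % w = l - r / w * w by omega]
  exact hm.rangeMin (by omega) (h.lsb _ hp.1 (by omega))

namespace RAM

open RAM.Expr RAM.Program

/-- The minimum between two positions in the same block. -/
def inBlockMin (l r : Expr) : Expr :=
  cell 12 (l + cell 15 (cell 14 r / cell 16 (l % reg 26)))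

/-- Replace register `32` by its minimum with register `36`. -/
def lower : Program := cond ((reg 36).less (reg 32)) (assign 32 (reg 36)) skip

/-- The minimum of the values at the positions in registers `30` to `31`. -/
def rangeMinimum : Program :=
  assign 33 (reg 30 / reg 26) ;;
  assign 34 (reg 31 / reg 26) ;;
  cond ((reg 33).equal (reg 34))
    (assign 32 (inBlockMin (reg 30) (reg 31)))
    (assign 32 (inBlockMin (reg 30) (reg 33 * reg 26 + reg 26 - 1)) ;;
     assign 36 (inBlockMin (reg 34 * reg 26) (reg 31)) ;;
     lower ;;
     cond ((reg 33 + 1).less (reg 34))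
       (assign 35 (cell 17 (reg 34 - reg 33 - 1)) ;;
        assign 36 (cell 19 (reg 35 * reg 3 + (reg 33 + 1))) ;;
        lower ;;
        assign 36 (cell 19 (reg 35 * reg 3 + (reg 34 - cell 16 (reg 35)))) ;;
        lower)
       skip)

@[simp] theorem regs_lower : lower.regs = [32] := rfl
@[simp] theorem arrs_lower : lower.arrs = [] := rfl
@[simp] theorem regs_rangeMinimum :
    rangeMinimum.regs = [33, 34, 32, 32, 36, 32, 35, 36, 32, 36, 32] := rfl
@[simp] theorem arrs_rangeMinimum : rangeMinimum.arrs = [] := rfl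

section
variable {B : ℤ} {s : State} {τ : ℤ}

theorem lower_spec (h0 : 0 ≤ s.reg 36) (h1 : s.reg 36 ≤ B) :
    wp B lower s τ (fun s' τ' => τ' ≤ τ + 10 ∧ s'.reg 32 = min (s.reg 32) (s.reg 36)) := by
  simp only [lower, wp_cond, wp_assign, wp_skip, eval_less, flag_ne_zero, flag_eq_zero, eval_reg,
    cost_less, cost_reg, State.reg_setReg, if_true]
  push_cast
  exact ⟨fun h => ⟨by omega, by omega, by omega⟩, fun h => ⟨by omega, by omega⟩⟩

/-- A range over several blocks splits into the end of the first block, the beginning of the last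
one and whole blocks between; the latter are covered by two overlapping runs of `2 ^ e` blocks. -/
theorem rangeMinimum_spec {a : ℤ → ℤ} {w nb Z N l r : ℤ} (h3 : s.reg 3 = Z) (h26 : s.reg 26 = w)
    (h12 : s.arr 12 = a)
    (ht : RmqTables a w nb Z (s.arr 14) (s.arr 15) (s.arr 16) (s.arr 17) (s.arr 19))
    (ha : ∀ p, 0 ≤ a p ∧ a p ≤ N) (hNB : N ≤ B) (hwB : w ≤ B)
    (h30 : s.reg 30 = l) (h31 : s.reg 31 = r) (hl : 0 ≤ l) (hlr : l ≤ r) (hr : r < nb * w)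
    (hrB : r ≤ B) :
    wp B rangeMinimum s τ (fun s' τ' => τ' ≤ τ + 200 ∧ RangeMin a l (r + 1) (s'.reg 32)) := by
  have hw := ht.one_le
  have hdl : 0 ≤ l / w ∧ l / w ≤ l := ⟨Int.ediv_nonneg hl (by omega), Int.ediv_le_self _ hl⟩
  have hdr : r / w ≤ r := Int.ediv_le_self _ (by omega)
  have hdlr : l / w ≤ r / w := Int.ediv_le_ediv (by omega) hlr
  simp only [rangeMinimum, wp_seq, wp_assign, wp_cond]
  simp only [inBlockMin, eval_reg, eval_cell, eval_add, eval_sub, eval_mul, eval_div, eval_mod,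
    eval_equal, eval_one, flag_ne_zero, flag_eq_zero, State.reg_setReg, State.arr_setReg,
    Nat.reduceEqDiff, if_true, if_false, h26, h30, h31, h12, cost_reg, cost_cell, cost_add,
    cost_sub, cost_mul, cost_div, cost_mod, cost_equal, cost_one]
  push_cast
  refine ⟨by omega, by omega, fun hb => ?_, fun hb => ?_⟩
  · have hbd := ha (l + s.arr 15 (s.arr 14 r / s.arr 16 (l % w)))
    exact ⟨by omega, by omega, ht.inBlock hl hlr hr hb⟩
  obtain ⟨u, hu⟩ : ∃ u, u = l / w := ⟨_, rfl⟩
  obtain ⟨v, hv⟩ : ∃ v, v = r / w := ⟨_, rfl⟩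
  have hsub := ht.inBlock (l := l) (r := u * w + w - 1)
  have hpre := ht.inBlock (l := v * w) (r := r)
  have hdm := Int.emod_add_mul_ediv l w
  have hdm' := Int.emod_add_mul_ediv r w
  have hmod0 := Int.emod_nonneg l (show w ≠ 0 by omega)
  have hmod1 := Int.emod_lt_of_pos l (show 0 < w by omega)
  have hmod0' := Int.emod_nonneg r (show w ≠ 0 by omega)
  have hmod1' := Int.emod_lt_of_pos r (show 0 < w by omega)
  rw [mul_comm w] at hdm hdm'
  rw [← hu] at hdm hdl hdlr hb ⊢
  rw [← hv] at hdm' hdlr hdr hb ⊢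
  have huv : u * w + w ≤ v * w := by
    have : (u + 1) * w ≤ v * w := mul_le_mul_of_nonneg_right (by omega) (by omega)
    linarith [add_mul u 1 w]
  have hvn : v < nb := by
    by_contra h
    have : nb * w ≤ v * w := mul_le_mul_of_nonneg_right (by omega) (by omega)
    omega
  have hnb := ht.blocks_lt
  replace hsub := hsub hl (by omega) (by omega) (by
    rw [← hu, show u * w + w - 1 = w - 1 + u * w by ring, Int.add_mul_ediv_right _ _ (by omega),
      Int.ediv_eq_zero_of_lt (by omega) (by omega), zero_add])
  replace hpre := hpre (by have := mul_nonneg hdl.1 (show 0 ≤ w by omega); omega) (by omega) hr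
    (by rw [Int.mul_ediv_cancel _ (by omega), hv])
  rw [show u * w + w - 1 + 1 = u * w + w by ring] at hsub
  obtain ⟨x, hx⟩ : ∃ x, x = a (l + s.arr 15 (s.arr 14 (u * w + w - 1) / s.arr 16 (l % w))) :=
    ⟨_, rfl⟩
  obtain ⟨y, hy⟩ : ∃ y, y = a (v * w + s.arr 15 (s.arr 14 r / s.arr 16 (v * w % w))) :=
    ⟨_, rfl⟩
  have hxb : 0 ≤ x ∧ x ≤ N := hx ▸ ha _
  have hyb : 0 ≤ y ∧ y ≤ N := hy ▸ ha _
  rw [← hx] at hsub ⊢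
  rw [← hy] at hpre ⊢
  refine ⟨by omega, by omega, ?_⟩
  refine wp_frame_mono (lower_spec (by simp; omega) (by simp; omega)) ?_
  rintro s₁ τ₁ hf₁ ⟨hτ₁, h32⟩
  simp only [State.reg_setReg, Nat.reduceEqDiff, if_true, if_false] at h32
  have e33 : s₁.reg 33 = u := by rw [hf₁.1 33 (by simp)]; simp
  have e34 : s₁.reg 34 = v := by rw [hf₁.1 34 (by simp)]; simp
  have e3 : s₁.reg 3 = Z := by rw [hf₁.1 3 (by simp)]; simp [h3]
  have e16 : s₁.arr 16 = s.arr 16 := by rw [hf₁.2 16 (by simp)]; simp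
  have e17 : s₁.arr 17 = s.arr 17 := by rw [hf₁.2 17 (by simp)]; simp
  have e19 : s₁.arr 19 = s.arr 19 := by rw [hf₁.2 19 (by simp)]; simp
  simp only [wp_cond, wp_skip, wp_seq, wp_assign]
  simp only [eval_reg, eval_cell, eval_add, eval_sub, eval_mul, eval_less, eval_one,
    flag_ne_zero, flag_eq_zero, State.reg_setReg, State.arr_setReg, Nat.reduceEqDiff, if_true,
    if_false, e33, e34, e3, e17, e19, cost_reg, cost_cell, cost_add, cost_sub, cost_mul,
    cost_less, cost_one]
  push_cast
  refine ⟨fun hlt => ?_, fun hlt => ?_⟩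
  · obtain ⟨g0, g1, g2, g3⟩ := ht.log (v - u - 1) (by omega) (by omega)
    obtain ⟨e, he⟩ : ∃ e, e = s.arr 17 (v - u - 1) := ⟨_, rfl⟩
    rw [← he] at g0 g1 g2 g3 ⊢
    have hR1 := ht.sparse e g0 (by omega) (u + 1) (by omega) (by omega)
    have hR2 := ht.sparse e g0 (by omega) (v - pow2 e) (by omega) (by omega)
    dsimp only at hR1 hR2
    obtain ⟨p, hp⟩ : ∃ p, p = s.arr 19 (e * Z + (u + 1)) := ⟨_, rfl⟩
    obtain ⟨q, hq⟩ : ∃ q, q = s.arr 19 (e * Z + (v - pow2 e)) := ⟨_, rfl⟩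
    rw [← hp] at hR1 ⊢
    rw [← hq] at hR2
    have hpb : 0 ≤ p ∧ p ≤ N := by
      obtain ⟨z, -, -, hz⟩ := hR1.attained; have := ha z; omega
    have hqb : 0 ≤ q ∧ q ≤ N := by
      obtain ⟨z, -, -, hz⟩ := hR2.attained; have := ha z; omega
    refine ⟨by omega, by omega, ?_⟩
    refine wp_frame_mono (lower_spec (by simp; omega) (by simp; omega)) ?_
    rintro s₂ τ₂ hf₂ ⟨hτ₂, k32⟩
    simp only [State.reg_setReg, Nat.reduceEqDiff, if_true, if_false, h32] at k32
    have f34 : s₂.reg 34 = v := by rw [hf₂.1 34 (by simp)]; simp [e34]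
    have f35 : s₂.reg 35 = e := by rw [hf₂.1 35 (by simp)]; simp
    have f3 : s₂.reg 3 = Z := by rw [hf₂.1 3 (by simp)]; simp [e3]
    have f16 : s₂.arr 16 = s.arr 16 := by rw [hf₂.2 16 (by simp)]; simp [e16]
    have f19 : s₂.arr 19 = s.arr 19 := by rw [hf₂.2 19 (by simp)]; simp [e19]
    rw [f34, f35, f3, f16, f19, ht.pow e g0 (by omega), ← hq]
    refine ⟨by omega, ?_⟩
    refine wp_frame_mono (lower_spec (by simp; omega) (by simp; omega)) ?_
    rintro s₃ τ₃ hf₃ ⟨hτ₃, m32⟩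
    simp only [State.reg_setReg, Nat.reduceEqDiff, if_true, if_false, k32] at m32
    refine ⟨by omega, ?_⟩
    have h5 : (u + 1) * w = u * w + w := by ring
    have h6 : (u + 1) * w ≤ (v - pow2 e) * w := mul_le_mul_of_nonneg_right (by omega) (by omega)
    -- The runs overlap because `e` is the logarithm of the number of blocks between, which is below
    -- `2 * 2 ^ e`.
    have h7 : (v - pow2 e) * w ≤ (u + 1 + pow2 e) * w :=
      mul_le_mul_of_nonneg_right (by omega) (by omega)
    have h8 : (u + 1 + pow2 e) * w ≤ v * w := mul_le_mul_of_nonneg_right (by omega) (by omega)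
    rw [sub_add_cancel] at hR2
    have := ((hsub.union hR1 (by omega) (by omega) (by omega)).union hR2 (by omega) h7 h8).union
      hpre (by omega) le_rfl (by omega)
    rw [m32]
    convert this using 1
    omega
  · have : u + 1 = v := by omega
    have h5 : v * w = u * w + w := by rw [← this]; ring
    rw [h32]
    exact ⟨by omega, hsub.union hpre (by omega) (by omega) (by omega)⟩

end

end RAM

/-! ### Longest common prefix queries -/

namespace RAM

open RAM.Expr RAM.Program

@[simp] theorem regs_tabulatePowers : tabulatePowers.regs = [25, 26, 25, 26] := rfl
@[simp] theorem arrs_tabulatePowers : tabulatePowers.arrs = [16, 16] := rfl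
@[simp] theorem regs_tabulateDigits : tabulateDigits.regs = [27, 20, 20] := rfl
@[simp] theorem arrs_tabulateDigits : tabulateDigits.arrs = [15, 17] := rfl
@[simp] theorem regs_tabulateMasks : tabulateMasks.regs = [20, 21, 21, 20] := rfl
@[simp] theorem arrs_tabulateMasks : tabulateMasks.arrs = [13, 20, 14] := rfl
@[simp] theorem regs_tabulateRuns : tabulateRuns.regs = [20, 20, 21, 20, 22, 23, 22, 20, 21] := rfl
@[simp] theorem arrs_tabulateRuns : tabulateRuns.arrs = [19, 19] := rfl

/-- Compute all tables that range minimum queries on array `12` need. -/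
def tabulateMinima : Program :=
  tabulatePowers ;; tabulateDigits ;; tabulateMasks ;; tabulateRuns

@[simp] theorem regs_tabulateMinima : tabulateMinima.regs =
    [25, 26, 25, 26, 27, 20, 20, 20, 21, 21, 20, 20, 20, 21, 20, 22, 23, 22, 20, 21] := rfl
@[simp] theorem arrs_tabulateMinima :
    tabulateMinima.arrs = [16, 16, 15, 17, 13, 20, 14, 19, 19] := rfl

/-- A state whose tables answer queries for longest common prefixes of suffixes of `σ`. -/
structure State.HasLcp (σ : ℤ → ℤ) (N : ℤ) (s : State) : Prop where
  padded : Padded σ N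
  rank : IsRank σ N (s.arr 9)
  lcp_mem : ∀ p, 0 ≤ s.arr 12 p ∧ s.arr 12 p ≤ N
  lcp : ∀ i j, 0 ≤ i → i < N → 0 ≤ j → j < N → s.arr 9 j = s.arr 9 i - 1 →
    IsLcp σ i j (s.arr 12 (s.arr 9 i))
  tables : RmqTables (s.arr 12) (s.reg 26) (s.reg 27) (s.reg 3) (s.arr 14) (s.arr 15) (s.arr 16)
    (s.arr 17) (s.arr 19)
  width_le : s.reg 26 ≤ N + 2
  lt_size : N < s.reg 27 * s.reg 26

theorem State.HasLcp.congr {σ : ℤ → ℤ} {N : ℤ} {s s' : State} (h : s.HasLcp σ N)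
    (h3 : s'.reg 3 = s.reg 3) (h26 : s'.reg 26 = s.reg 26) (h27 : s'.reg 27 = s.reg 27)
    (h9 : s'.arr 9 = s.arr 9) (h12 : s'.arr 12 = s.arr 12) (h14 : s'.arr 14 = s.arr 14)
    (h15 : s'.arr 15 = s.arr 15) (h16 : s'.arr 16 = s.arr 16) (h17 : s'.arr 17 = s.arr 17)
    (h19 : s'.arr 19 = s.arr 19) : s'.HasLcp σ N := by
  obtain ⟨a, b, c, d, e, f, g⟩ := h
  refine ⟨a, ?_, ?_, ?_, ?_, ?_, ?_⟩
  · rwa [h9]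
  · rwa [h12]
  · rwa [h9, h12]
  · rwa [h3, h26, h27, h12, h14, h15, h16, h17, h19]
  · rwa [h26]
  · rwa [h26, h27]

/-- The length of the longest common prefix of the suffixes at the positions in registers `37` and
`38`. -/
def commonExtension : Program :=
  assign 30 (cell 9 (reg 37)) ;;
  assign 31 (cell 9 (reg 38)) ;;
  cond ((reg 31).less (reg 30))
    (assign 36 (reg 30) ;; assign 30 (reg 31) ;; assign 31 (reg 36)) skip ;;
  assign 30 (reg 30 + 1) ;;
  rangeMinimum

@[simp] theorem regs_commonExtension : commonExtension.regs =
    [30, 31, 36, 30, 31, 30, 33, 34, 32, 32, 36, 32, 35, 36, 32, 36, 32] := rfl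
@[simp] theorem arrs_commonExtension : commonExtension.arrs = [] := rfl

section
variable {B : ℤ} {s : State} {τ : ℤ}

/-- `N / w + 1` blocks cover all ranks up to `N`. The last block may extend further; the values
there only need to be bounded. -/
theorem tabulateMinima_spec {σ : ℤ → ℤ} {N : ℤ} (hσ : Padded σ N) (hN : 0 ≤ N)
    (hNB : 2 * N + 10 ≤ B) (hr : IsRank σ N (s.arr 9))
    (hm : ∀ p, 0 ≤ s.arr 12 p ∧ s.arr 12 p ≤ N)
    (hl : ∀ i j, 0 ≤ i → i < N → 0 ≤ j → j < N → s.arr 9 j = s.arr 9 i - 1 →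
      IsLcp σ i j (s.arr 12 (s.arr 9 i)))
    (h4 : s.reg 4 = N) (h3 : N + 1 ≤ s.reg 3) (h3B : s.reg 3 ≤ B) (h15 : s.arr 15 0 = 0)
    (h17 : s.arr 17 0 = 0) (h20 : s.arr 20 (-1) = 0) :
    wp B tabulateMinima s τ (fun s' τ' => τ' ≤ τ + 2000 * (N + 3) ∧ s'.HasLcp σ N) := by
  simp only [tabulateMinima, wp_seq]
  refine wp_frame_mono (tabulatePowers_spec hN hNB h4) ?_
  rintro s₁ τ₁ hf₁ ⟨hτ₁, w1, e25, p1, p2, w2, h16⟩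
  obtain ⟨w, hw⟩ : ∃ w, s₁.reg 26 = w := ⟨_, rfl⟩
  rw [hw] at w1 e25 w2 h16
  refine wp_frame_mono (tabulateDigits_spec hN hNB ((hf₁.1 4 (by simp)).trans h4) hw w1 e25 p2
    (by rw [hf₁.2 15 (by simp), h15]) (by rw [hf₁.2 17 (by simp), h17])) ?_
  rintro s₂ τ₂ hf₂ ⟨hτ₂, e27, hlow, hlog⟩
  replace hw := (hf₂.1 26 (by simp)).trans hw
  have b16 := hf₂.2 16 (by simp)
  have b12 : s₂.arr 12 = s.arr 12 := (hf₂.2 12 (by simp)).trans (hf₁.2 12 (by simp))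
  have b20 : s₂.arr 20 = s.arr 20 := (hf₂.2 20 (by simp)).trans (hf₁.2 20 (by simp))
  have b9 : s₂.arr 9 = s.arr 9 := (hf₂.2 9 (by simp)).trans (hf₁.2 9 (by simp))
  have b3 : s₂.reg 3 = s.reg 3 := (hf₂.1 3 (by simp)).trans (hf₁.1 3 (by simp))
  have hd : N / w ≤ N := Int.ediv_le_self _ hN
  have hd0 : 0 ≤ N / w := Int.ediv_nonneg hN (by omega)
  have hdm := Int.emod_add_mul_ediv N w
  have hmod0 := Int.emod_nonneg N (show w ≠ 0 by omega)
  have hmod1 := Int.emod_lt_of_pos N (show 0 < w by omega)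
  have hnw : (N / w + 1) * w = w * (N / w) + w := by ring
  have hM0 : 0 ≤ (N / w + 1) * w := by positivity
  refine wp_frame_mono (tabulateMasks_spec (M := (N / w + 1) * w) rfl hw w1 (by rw [e27]) hM0
    (by omega) (by omega) (by rwa [b16]) (by rw [b20, h20])) ?_
  rintro s₃ τ₃ hf₃ ⟨hτ₃, hmask⟩
  replace hw := (hf₃.1 26 (by simp)).trans hw
  replace e27 := (hf₃.1 27 (by simp)).trans e27
  replace b16 := (hf₃.2 16 (by simp)).trans b16
  replace b9 := (hf₃.2 9 (by simp)).trans b9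
  replace b3 := (hf₃.1 3 (by simp)).trans b3
  have c12 := hf₃.2 12 (by simp)
  have c15 := hf₃.2 15 (by simp)
  have c17 := hf₃.2 17 (by simp)
  rw [← c15] at hlow
  rw [← c17] at hlog
  rw [← b16] at h16
  rw [b12] at hmask c12
  refine wp_frame_mono (tabulateRuns_spec b3 hw e27 w1 (by omega) (by omega) h3B (by omega)
    (by omega) c12 hm (by omega) h16 hmask hlow) ?_
  rintro s₄ τ₄ hf₄ ⟨hτ₄, hsp⟩
  replace hw := (hf₄.1 26 (by simp)).trans hw
  replace e27 := (hf₄.1 27 (by simp)).trans e27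
  replace b3 := (hf₄.1 3 (by simp)).trans b3
  replace b9 := (hf₄.2 9 (by simp)).trans b9
  replace c12 := (hf₄.2 12 (by simp)).trans c12
  refine ⟨by omega, hσ, by rwa [b9], by rwa [c12], by rwa [c12, b9], ?_, by omega,
    by rw [e27, hw]; omega⟩
  rw [c12, hw, e27, b3, hf₄.2 14 (by simp), hf₄.2 15 (by simp), hf₄.2 16 (by simp),
    hf₄.2 17 (by simp)]
  exact ⟨w1, hmask, hlow, h16, hlog, hsp, by omega⟩

/-- The query starts one above the smaller rank, because the entry at a rank belongs to the pair
formed with its predecessor. The swap orders the ranks, and `IsLcp` is symmetric. -/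
theorem commonExtension_spec {σ : ℤ → ℤ} {N i j : ℤ} (h : s.HasLcp σ N) (hNB : 2 * N + 10 ≤ B)
    (h37 : s.reg 37 = i) (h38 : s.reg 38 = j) (hi : 0 ≤ i) (hiN : i < N) (hj : 0 ≤ j)
    (hjN : j < N) (hij : i ≠ j) :
    wp B commonExtension s τ (fun s' τ' => τ' ≤ τ + 300 ∧ IsLcp σ i j (s'.reg 32)) := by
  have key : ∀ (s₁ : State) (τ₁ : ℤ) (i j : ℤ), 0 ≤ i → i < N → 0 ≤ j → j < N →
      s.arr 9 i < s.arr 9 j → s₁.reg 3 = s.reg 3 → s₁.reg 26 = s.reg 26 → s₁.arr = s.arr →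
      s₁.reg 30 = s.arr 9 i + 1 → s₁.reg 31 = s.arr 9 j → τ₁ ≤ τ + 50 →
      wp B rangeMinimum s₁ τ₁ (fun s' τ' => τ' ≤ τ + 300 ∧ IsLcp σ i j (s'.reg 32)) := by
    intro s₁ τ₁ i j hi hiN hj hjN hlt e3 e26 ea e30 e31 hτ₁
    have hri := h.rank.mem i hi hiN
    have hrj := h.rank.mem j hj hjN
    have hw := h.width_le
    have hsz := h.lt_size
    refine wp_frame_mono (rangeMinimum_spec (nb := s.reg 27) (N := N) e3 e26 rfl
      (by rw [ea]; exact h.tables)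
      (by rw [ea]; exact h.lcp_mem) (by omega) (by omega) e30 e31 (by omega) (by omega)
      (by omega) (by omega)) ?_
    rintro s' τ' - ⟨hτ, hR⟩
    rw [ea] at hR
    exact ⟨by omega, h.rank.isLcp_of_rangeMin h.padded h.lcp hi hiN hj hjN hlt hR⟩
  have hri := h.rank.mem i hi hiN
  have hrj := h.rank.mem j hj hjN
  have hne := h.rank.inj h.padded hi hiN hj hjN hij
  simp only [commonExtension, wp_seq, wp_assign, wp_cond, wp_skip]
  simp only [eval_reg, eval_cell, eval_add, eval_less, eval_one, flag_ne_zero, flag_eq_zero,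
    State.reg_setReg, State.arr_setReg, Nat.reduceEqDiff, if_true, if_false, h37, h38, cost_reg,
    cost_cell, cost_add, cost_less, cost_one]
  push_cast
  refine ⟨by omega, by omega, fun hlt => ⟨by omega, by omega, by omega, by omega, ?_⟩,
    fun hlt => ⟨by omega, ?_⟩⟩
  · refine wp_frame_mono (key _ _ j i hj hjN hi hiN hlt (by simp) (by simp) (by simp) (by simp)
      (by simp) (by omega)) ?_
    rintro s' τ' - ⟨hτ, hR⟩
    exact ⟨hτ, hR.symm⟩
  · exact key _ _ i j hi hiN hj hjN (by omega) (by simp) (by simp) (by simp) (by simp) (by simp)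
      (by omega)

end

end RAM

/-! ### Naming the differences and preparing the queries -/

/-- The consecutive differences of a text `T` of length `n`, followed by those of a pattern. -/
def differences (P T : ℤ → ℤ) (n i : ℤ) : ℤ :=
  if i < n - 1 then T (i + 1) - T i else P (i - n + 2) - P (i - n + 1)

namespace RAM

open RAM.Expr RAM.Program

/-- The name in array `3` of the number in register `22`, a new one if necessary. -/
def lookUpName : Program :=
  cond ((cell 3 (reg 22)).equal 0)
    (assign 21 (reg 21 + 1) ;; store 3 (reg 22) (reg 21)) skip

/-- Write the names of the differences of text and pattern to array `4`. -/
def nameDifferences : Program :=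
  assign 3 (reg 1 * 2 + 10) ;;
  assign 4 (reg 0 + reg 1 - 2) ;;
  store 5 0 (reg 4) ;;
  assign 21 0 ;;
  forLoop 20 (reg 4)
    (cond ((reg 20).less (reg 1 - 1))
      (assign 22 (cell 1 (reg 20 + 1) - cell 1 (reg 20)))
      (assign 22 (cell 0 (reg 20 - reg 1 + 2) - cell 0 (reg 20 - reg 1 + 1))) ;;
     lookUpName ;;
     store 4 (reg 20) (cell 3 (reg 22)))

@[simp] theorem regs_lookUpName : lookUpName.regs = [21] := rfl
@[simp] theorem arrs_lookUpName : lookUpName.arrs = [3] := rfl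
@[simp] theorem regs_nameDifferences :
    nameDifferences.regs = [3, 4, 21, 20, 22, 22, 21, 20] := rfl
@[simp] theorem arrs_nameDifferences : nameDifferences.arrs = [5, 3, 4] := rfl

section
variable {B : ℤ} {s : State} {τ : ℤ}

/-- `f` gives different names from `{1, …, c}` to some numbers, and `0` to all others. -/
structure Names (f : ℤ → ℤ) (c : ℤ) : Prop where
  mem : ∀ v, 0 ≤ f v ∧ f v ≤ c
  inj : ∀ v w, f v = f w → f v ≠ 0 → v = w

theorem lookUpName_spec (h : Names (s.arr 3) (s.reg 21)) (h0 : 0 ≤ s.reg 21)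
    (hB : s.reg 21 < B) :
    wp B lookUpName s τ (fun s' τ' => τ' ≤ τ + 30 ∧ Names (s'.arr 3) (s'.reg 21) ∧
      s.reg 21 ≤ s'.reg 21 ∧ s'.reg 21 ≤ s.reg 21 + 1 ∧ s'.arr 3 (s.reg 22) ≠ 0 ∧
      ∀ v, s.arr 3 v ≠ 0 → s'.arr 3 v = s.arr 3 v) := by
  rw [lookUpName, wp_cond, eval_equal, flag_ne_zero, flag_eq_zero]
  simp only [wp_seq, wp_assign, wp_store, wp_skip]
  simp only [eval_cell, eval_reg, eval_add, eval_one, eval_zero, State.reg_setReg, State.arr_setReg, State.reg_setArr, State.arr_setArr,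
    Nat.reduceEqDiff, if_true, if_false, cost_equal, cost_cell, cost_reg, cost_add, cost_one,
    cost_zero]
  push_cast
  refine ⟨fun hz => ⟨by omega, by omega, by omega, ?_, by omega, by omega, ?_, fun v hv => ?_⟩,
    fun hz => ⟨by omega, h, by omega, by omega, hz, fun _ _ => trivial⟩⟩
  · refine ⟨fun v => ?_, fun v w => ?_⟩
    · have := h.mem v
      rw [Function.update_apply]
      split_ifs <;> omega
    · have := h.mem v
      have := h.mem w
      have := h.inj v w
      rw [Function.update_apply, Function.update_apply]
      split_ifs with h1 h2 h2
      · intros; omega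
      · intros; omega
      · intros; omega
      · assumption
  · rw [Function.update_self]; omega
  · rw [Function.update_of_ne]; rintro rfl; exact hv hz

/-- Array `3` is addressed by the difference itself and starts with zeros, so a zero marks a
difference without a name. At most one name is spent per position; hence the names lie between `1`
and the length, which is what `Padded` demands, without any sorting of the input. -/
theorem nameDifferences_spec {P T : ℤ → ℤ} {m n : ℤ} (hm : 1 ≤ m) (hmn : m ≤ n)
    (h0 : s.reg 0 = m) (h1 : s.reg 1 = n) (hP : s.arr 0 = P) (hT : s.arr 1 = T)
    (h3 : ∀ p, s.arr 3 p = 0) (h4 : ∀ p, s.arr 4 p = 0) (hB : 2 * n + 10 < B)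
    (hdB : ∀ i, -B ≤ differences P T n i ∧ differences P T n i ≤ B) :
    wp B nameDifferences s τ (fun s' τ' => τ' ≤ τ + 200 * (m + n) ∧ s'.reg 3 = 2 * n + 10 ∧
      s'.arr 5 0 = m + n - 2 ∧ Padded (s'.arr 4) (m + n - 2) ∧
      ∀ x y, 0 ≤ x → x < m + n - 2 → 0 ≤ y → y < m + n - 2 →
        (s'.arr 4 x = s'.arr 4 y ↔ differences P T n x = differences P T n y)) := by
  set δ := differences P T n with hδ
  simp only [nameDifferences, wp_seq, wp_assign, wp_store]
  simp only [eval_reg, eval_add, eval_mul, eval_sub, eval_ofNat, eval_zero, State.reg_setReg,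
    State.reg_setArr, Nat.reduceEqDiff, if_true, if_false, h0, h1, cost_reg, cost_add, cost_mul,
    cost_sub, cost_ofNat, cost_zero]
  push_cast
  refine ⟨by omega, by omega, by omega, by omega, ?_⟩
  refine wp_for (m + n - 2) (fun i s' τ' => τ' ≤ τ + 50 + 100 * i ∧
    Names (s'.arr 3) (s'.reg 21) ∧ (0 ≤ s'.reg 21 ∧ s'.reg 21 ≤ i) ∧
    (∀ x, 0 ≤ x → x < i → s'.arr 4 x = s'.arr 3 (δ x) ∧ s'.arr 3 (δ x) ≠ 0) ∧
    ∀ p, i ≤ p → s'.arr 4 p = 0) (by omega) (by omega) (by simp) ?_ ?_ ?_ ?_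
  · intro s' hf; rw [eval_reg, hf.1 4 (by simp)]; simp
  · refine ⟨by omega, ⟨fun v => ?_, fun v w => ?_⟩, by simp, fun x _ _ => by omega, fun p _ => ?_⟩
      <;> simp [h3, h4]
  · rintro i s' τ' hi0 hin hxi hf ⟨hτ, hN, hc, hI, hz⟩
    have e1 : s'.reg 1 = n := by rw [hf.1 1 (by simp)]; simp [h1]
    have eP : s'.arr 0 = P := by rw [hf.2 0 (by simp)]; simp [hP]
    have eT : s'.arr 1 = T := by rw [hf.2 1 (by simp)]; simp [hT]
    have key : ∀ τ₁, τ₁ ≤ τ' + 30 → wp B (lookUpName ;; store 4 (reg 20) (cell 3 (reg 22)))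
        (s'.setReg 22 (δ i)) τ₁ (fun s'' τ'' => τ'' + 4 ≤ τ + 50 + 100 * (i + 1) ∧
          Names (s''.arr 3) (s''.reg 21) ∧ (0 ≤ s''.reg 21 ∧ s''.reg 21 ≤ i + 1) ∧
          (∀ x, 0 ≤ x → x < i + 1 → s''.arr 4 x = s''.arr 3 (δ x) ∧ s''.arr 3 (δ x) ≠ 0) ∧
          ∀ p, i + 1 ≤ p → s''.arr 4 p = 0) := by
      intro τ₁ hτ₁
      rw [wp_seq]
      refine wp_frame_mono (lookUpName_spec (by simpa using hN) (by simpa using hc.1)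
        (by simp; omega)) ?_
      rintro s₂ τ₂ hf₂ ⟨hτ₂, hN₂, c1, c2, hne, hold⟩
      simp only [State.reg_setReg, State.arr_setReg, Nat.reduceEqDiff, if_true, if_false]
        at c1 c2 hne hold
      have e20 : s₂.reg 20 = i := by rw [hf₂.1 20 (by simp)]; simp [hxi]
      have e22 : s₂.reg 22 = δ i := by rw [hf₂.1 22 (by simp)]; simp
      have e4 : s₂.arr 4 = s'.arr 4 := by rw [hf₂.2 4 (by simp)]; simp
      have hm := hN₂.mem (δ i)
      rw [wp_store]
      simp only [eval_reg, eval_cell, State.reg_setArr, State.arr_setArr, Nat.reduceEqDiff,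
        if_true, if_false, e20, e22, e4, cost_reg, cost_cell]
      push_cast
      refine ⟨by omega, by omega, hN₂, by omega, fun x x0 x1 => ?_, fun p hp => ?_⟩
      · rcases eq_or_lt_of_le (show x ≤ i by omega) with h | h
        · rw [h, Function.update_self]; exact ⟨rfl, hne⟩
        · have := hI x x0 h
          rw [Function.update_of_ne h.ne, hold _ this.2]; exact this
      · rw [Function.update_of_ne (by omega)]; exact hz p (by omega)
    have hd := hdB i
    rw [wp_seq, wp_cond]
    simp only [wp_assign, eval_less, flag_ne_zero, flag_eq_zero, eval_reg, eval_sub, eval_one,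
      eval_cell, eval_add, eval_ofNat, hxi, e1, eP, eT, cost_less, cost_reg, cost_sub, cost_one,
      cost_cell, cost_add, cost_ofNat, State.reg_setReg, State.arr_setReg, Nat.reduceEqDiff,
      if_false]
    refine ⟨fun hlt => ?_, fun hlt => ?_⟩
    · have : δ i = T (i + 1) - T i := by rw [hδ, differences, if_pos hlt]
      rw [← this]
      exact ⟨hd, key _ (by push_cast; omega)⟩
    · have : δ i = P (i - n + 2) - P (i - n + 1) := by rw [hδ, differences, if_neg hlt]
      rw [← this]
      exact ⟨hd, key _ (by push_cast; omega)⟩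
  · rintro s' τ' hx hf ⟨hτ, hN, hc, hI, hz⟩
    have e3 : s'.reg 3 = 2 * n + 10 := by rw [hf.1 3 (by simp)]; simp; ring
    have e5 : s'.arr 5 0 = m + n - 2 := by rw [hf.2 5 (by simp)]; simp
    simp only [cost_reg]
    refine ⟨by push_cast; omega, e3, e5, ⟨hz, fun i i0 i1 => ?_⟩, fun x y x0 x1 y0 y1 => ?_⟩
    · have := hN.mem (δ i)
      have := hI i i0 i1
      omega
    · rw [(hI x x0 x1).1, (hI y y0 y1).1]
      exact ⟨fun h => hN.inj _ _ h (hI x x0 x1).2, fun h => by rw [h]⟩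

/-- Prepare queries for longest common prefixes of suffixes of text and pattern. -/
def preprocess : Program :=
  nameDifferences ;; rankSuffixes ;; assign 4 (reg 0 + reg 1 - 2) ;; neighbourPrefixes ;;
  tabulateMinima

@[simp] theorem regs_preprocess : preprocess.regs = nameDifferences.regs ++
    (rankSuffixes.regs ++ (4 :: (neighbourPrefixes.regs ++ tabulateMinima.regs))) := rfl
@[simp] theorem arrs_preprocess : preprocess.arrs = nameDifferences.arrs ++
    (rankSuffixes.arrs ++ (neighbourPrefixes.arrs ++ tabulateMinima.arrs)) := rfl

theorem preprocess_spec {P T : ℤ → ℤ} {m n : ℤ} (hm : 1 ≤ m) (hmn : m ≤ n)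
    (h0 : s.reg 0 = m) (h1 : s.reg 1 = n) (hP : s.arr 0 = P) (hT : s.arr 1 = T)
    (hz : ∀ a, 2 ≤ a → ∀ p, s.arr a p = 0)
    (hB : (2 * n + 10) * (2 * n + 10) * (2 * n + 10) ≤ B)
    (hdB : ∀ i, -B ≤ differences P T n i ∧ differences P T n i ≤ B) :
    wp B preprocess s τ (fun s' τ' => τ' ≤ τ + 80000 * n ∧ s'.reg 3 = 2 * n + 10 ∧
      ∃ σ, s'.HasLcp σ (m + n - 2) ∧
        ∀ x y, 0 ≤ x → x < m + n - 2 → 0 ≤ y → y < m + n - 2 →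
          (σ x = σ y ↔ differences P T n x = differences P T n y)) := by
  have hB' : 6 * (2 * n + 10) ≤ B := by nlinarith
  have frame : ∀ {s₁ s₂ : State} {c : Program} {x : ℕ}, Frame c s₁ s₂ → x ∉ c.arrs →
      (∀ p, s₁.arr x p = 0) → ∀ p, s₂.arr x p = 0 := fun hf hx h p => by rw [hf.2 _ hx, h]
  simp only [preprocess, wp_seq]
  refine wp_frame_mono (nameDifferences_spec hm hmn h0 h1 hP hT (hz 3 (by norm_num))
    (hz 4 (by norm_num)) (by omega) hdB) ?_
  rintro s₁ τ₁ hf₁ ⟨hτ₁, e3, e5, hpad, hiff⟩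
  refine wp_frame_mono (rankSuffixes_spec (N := m + n - 2) (Z := 2 * n + 10) (by omega) (by omega)
    hB e3 e5 hpad (frame hf₁ (by simp) (hz 10 (by norm_num)))) ?_
  rintro s₂ τ₂ hf₂ ⟨hτ₂, hr, h4⟩
  replace e3 := (hf₂.1 3 (by simp)).trans e3
  replace h0 := (hf₂.1 0 (by simp)).trans ((hf₁.1 0 (by simp)).trans h0)
  replace h1 := (hf₂.1 1 (by simp)).trans ((hf₁.1 1 (by simp)).trans h1)
  have hz₂ : ∀ a, 12 ≤ a → a ∉ rankSuffixes.arrs → ∀ p, s₂.arr a p = 0 := fun a ha ha' =>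
    frame hf₂ ha' (frame hf₁ (by simp; omega) (hz a (by omega)))
  rw [wp_assign]
  simp only [eval_sub, eval_add, eval_reg, eval_ofNat, h0, h1, cost_sub, cost_add, cost_reg,
    cost_ofNat]
  refine ⟨by omega, ?_⟩
  refine wp_frame_mono (neighbourPrefixes_spec hpad (by omega) (by omega) (by omega) hr (by simp)
    (fun p hp => h4 p (by omega)) (hz₂ 12 (by norm_num) (by simp))) ?_
  rintro s₃ τ₃ hf₃ ⟨hτ₃, hmem, hlcp⟩
  simp only [State.arr_setReg] at hlcp
  replace e3 : s₃.reg 3 = 2 * n + 10 := by rw [hf₃.1 3 (by simp)]; simp [e3]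
  have e4 : s₃.reg 4 = m + n - 2 := by rw [hf₃.1 4 (by simp)]; simp
  have e9 : s₃.arr 9 = s₂.arr 9 := by rw [hf₃.2 9 (by simp)]; simp
  rw [← e9] at hr hlcp
  have hz₃ : ∀ a, 13 ≤ a → a ∉ rankSuffixes.arrs → ∀ p, s₃.arr a p = 0 := fun a ha ha' =>
    frame hf₃ (by simp; omega) (by simpa using hz₂ a (by omega) ha')
  refine wp_frame_mono (tabulateMinima_spec hpad (by omega) (by omega) hr hmem hlcp e4 (by omega)
    (by omega) (hz₃ 15 (by norm_num) (by simp) _) (hz₃ 17 (by norm_num) (by simp) _)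
    (hz₃ 20 (by norm_num) (by simp) _)) ?_
  rintro s₄ τ₄ hf₄ ⟨hτ₄, hL⟩
  push_cast at hτ₃
  exact ⟨by omega, (hf₄.1 3 (by simp)).trans e3, _, hL, hiff⟩

end

end RAM

/-! ### Mismatches at one alignment -/

theorem countBelow_add_of_const (f : ℤ → ℤ) (α : ℤ) {c L : ℤ} (hc : 0 ≤ c) (hL : 0 ≤ L)
    (h : ∀ j, c ≤ j → j < c + L → f j = f c) :
    countBelow (fun j => f j = α) (c + L) =
      countBelow (fun j => f j = α) c + if α = f c then L else 0 := by
  obtain ⟨n, rfl⟩ := Int.eq_ofNat_of_zero_le hL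
  induction n with
  | zero => simp
  | succ n ih =>
    push_cast at h ⊢
    have ih := ih (by omega) fun j h0 h1 => h j h0 (by omega)
    have hn := h (c + n) (by omega) (by omega)
    rw [← add_assoc, countBelow_succ _ (by omega), ih, hn]
    by_cases hα : α = f c
    · rw [if_pos hα, if_pos hα, if_pos hα.symm, add_assoc]
    · rw [if_neg hα, if_neg hα, if_neg (Ne.symm hα), add_zero]

theorem countBelow_le_of_le (p : ℤ → Prop) {c d : ℤ} (hc : 0 ≤ c) (h : c ≤ d) :
    countBelow p c ≤ countBelow p d ∧ countBelow p d - countBelow p c ≤ d - c := by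
  classical
  obtain ⟨n, rfl⟩ : ∃ n : ℕ, d = c + n := ⟨(d - c).toNat, by omega⟩
  clear h
  induction n with
  | zero => simp
  | succ n ih =>
    push_cast
    rw [← add_assoc, countBelow_succ _ (by omega)]
    split_ifs <;> omega

/-- The number of positions below `x` at which `f` changes. -/
noncomputable def changes (f : ℤ → ℤ) (x : ℤ) : ℤ :=
  countBelow (fun j => 1 ≤ j ∧ f j ≠ f (j - 1)) x

/-- At a change, the two neighbouring values cannot both equal `α`. Charge the change to one that
does not; each such position is charged at most twice. The induction counts a mismatch once as a
right and once as a left neighbour. -/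
theorem changes_le (f : ℤ → ℤ) (α : ℤ) {x : ℤ} (hx : 0 ≤ x) :
    changes f (x + 1) ≤ 2 * (x + 1 - countBelow (fun j => f j = α) (x + 1)) := by
  classical
  suffices H : ∀ n : ℕ, changes f (n + 1) ≤ (n + 1 - countBelow (fun j => f j = α) (n + 1)) +
      (n - countBelow (fun j => f j = α) n) by
    have h1 := H x.toNat
    rw [Int.toNat_of_nonneg hx] at h1
    have := countBelow_le_of_le (fun j => f j = α) hx (show x ≤ x + 1 by omega)
    omega
  intro n
  induction n with
  | zero =>
    have h1 : changes f ((0 : ℕ) + 1) = 0 := by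
      rw [changes, Nat.cast_zero, countBelow_succ _ le_rfl, countBelow_zero]; simp
    have := countBelow_le (fun j => f j = α) (i := 1) (by norm_num)
    rw [h1]; simp [countBelow_zero]; omega
  | succ n ih =>
    have e1 : changes f ((n + 1 : ℕ) + 1) = changes f (n + 1) +
        if (1 : ℤ) ≤ n + 1 ∧ f (n + 1) ≠ f (n + 1 - 1) then 1 else 0 := by
      rw [changes, Nat.cast_succ, countBelow_succ _ (by omega), changes]
      congr
    have e2 := countBelow_succ (fun j => f j = α) (i := n + 1) (by omega)
    have e3 := countBelow_succ (fun j => f j = α) (i := n) (by omega)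
    rw [e1]
    push_cast
    rw [add_sub_cancel_right]
    split_ifs at e2 e3 ⊢ <;> omega

/-- `v` is the least number of positions below `m` at which `f` differs from a constant, cut off
at `k + 1`. -/
structure IsDistance (f : ℤ → ℤ) (m k v : ℤ) : Prop where
  le : v ≤ k + 1
  le_sub : ∀ α, v ≤ m - countBelow (fun j => f j = α) m
  attained : v = k + 1 ∨ ∃ α, v = m - countBelow (fun j => f j = α) m

/-- By `changes_le`, `2 * k + 1` changes force more than `k` mismatches for every constant. -/
theorem isDistance_of_changes {f : ℤ → ℤ} {m k c : ℤ} (hc : 0 ≤ c) (hcm : c < m)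
    (h : 2 * k + 1 ≤ changes f (c + 1)) : IsDistance f m k (k + 1) := by
  refine ⟨le_rfl, fun α => ?_, Or.inl rfl⟩
  have h1 := changes_le f α hc
  have h2 := countBelow_le_of_le (fun j => f j = α) (show 0 ≤ c + 1 by omega)
    (show c + 1 ≤ m by omega)
  omega

theorem isDistance_of_max {f : ℤ → ℤ} {m k b : ℤ}
    (h : ∀ α, countBelow (fun j => f j = α) m ≤ b) (h' : ∃ α, countBelow (fun j => f j = α) m = b) :
    IsDistance f m k (min (m - b) (k + 1)) := by
  refine ⟨by omega, fun α => by have := h α; omega, ?_⟩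
  obtain ⟨α, hα⟩ := h'
  by_cases hk : k + 1 < m - b
  · left; omega
  · right; exact ⟨α, by omega⟩

/-- The difference of text and pattern at position `j` of alignment `i`. -/
def offset (P T : ℤ → ℤ) (i j : ℤ) : ℤ := T (i + j) - P j

/-- Rearranging `T (i+j+1) - P (j+1) = T (i+j) - P j` separates text from pattern. The differences
of the pattern begin at position `n - 1` of the joint string. -/
theorem offset_add_one {P T : ℤ → ℤ} {m n i j : ℤ} (hj : 0 ≤ j) (hjm : j + 1 < m)
    (hin : i + m ≤ n) :
    offset P T i (j + 1) = offset P T i j ↔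
      differences P T n (i + j) = differences P T n (n - 1 + j) := by
  rw [differences, differences, if_pos (by omega), if_neg (by omega), offset, offset,
    show n - 1 + j - n + 2 = j + 1 by ring, show n - 1 + j - n + 1 = j by ring,
    show i + (j + 1) = i + j + 1 by ring]
  omega

/-- A match of `v` differences yields `v + 1` equal offsets, hence the bound on `L`. The joint
string has no separator, so a match may run past the differences that belong to this alignment; the
condition `c + L ≤ m` discards that part. -/
theorem IsLcp.segment {P T σ : ℤ → ℤ} {m n i c v : ℤ}
    (hσ : ∀ x y, 0 ≤ x → x < m + n - 2 → 0 ≤ y → y < m + n - 2 →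
      (σ x = σ y ↔ differences P T n x = differences P T n y))
    (hi : 0 ≤ i) (hin : i + m ≤ n) (hc : 0 ≤ c) (h : IsLcp σ (i + c) (n - 1 + c) v) {L : ℤ}
    (hLv : L ≤ v + 1) (hcm : c + L ≤ m) :
    (∀ j, c ≤ j → j < c + L → offset P T i j = offset P T i c) ∧
      (L = v + 1 → c + L < m → offset P T i (c + L) ≠ offset P T i (c + L - 1)) := by
  have h0 := h.nonneg
  constructor
  · intro j hj hjL
    obtain ⟨e, rfl⟩ : ∃ e : ℕ, j = c + e := ⟨(j - c).toNat, by omega⟩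
    induction e with
    | zero => simp
    | succ e ih =>
      push_cast at hj hjL ⊢
      rw [← ih (by omega) (by omega), ← add_assoc,
        offset_add_one (m := m) (n := n) (by omega) (by omega) hin,
        ← hσ _ _ (by omega) (by omega) (by omega) (by omega)]
      have := h.agree e (by omega) (by omega)
      rwa [add_assoc, add_assoc] at this
  · intro hL hlt heq
    have h1 := offset_add_one (P := P) (T := T) (m := m) (n := n) (i := i) (j := c + v)
      (by omega) (by omega) hin
    rw [show c + v + 1 = c + L by omega, show c + v = c + L - 1 by omega] at h1
    rw [h1, ← hσ _ _ (by omega) (by omega) (by omega) (by omega)] at heq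
    apply h.ne
    rw [show i + c + v = i + (c + L - 1) by omega, show n - 1 + c + v = n - 1 + (c + L - 1) by omega]
    exact heq

/-- Uniqueness of quotient and remainder, also for negative quotients: the counters of different
offsets and alignments occupy different cells. -/
theorem mul_add_inj {Z a b i j : ℤ} (hi : 0 ≤ i) (hiZ : i < Z) (hj : 0 ≤ j) (hjZ : j < Z)
    (h : a * Z + i = b * Z + j) : a = b ∧ i = j := by
  have h1 : (i + a * Z) % Z = (j + b * Z) % Z := by rw [add_comm i, add_comm j, h]
  rw [Int.add_mul_emod_self_right, Int.add_mul_emod_self_right, Int.emod_eq_of_lt hi hiZ,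
    Int.emod_eq_of_lt hj hjZ] at h1
  subst h1
  exact ⟨mul_right_cancel₀ (by omega : Z ≠ 0) (by omega), rfl⟩

/-! ### Jumping along one alignment -/

namespace RAM

open RAM.Expr RAM.Program

/-- The length of the longest run of equal offsets from position `41` of alignment `40` on. -/
def segmentLength : Program :=
  assign 45 (reg 0 - reg 41) ;;
  cond ((1 : Expr).less (reg 45))
    (assign 37 (reg 40 + reg 41) ;;
     assign 38 (reg 1 - 1 + reg 41) ;;
     commonExtension ;;
     cond ((reg 32 + 1).less (reg 45)) (assign 45 (reg 32 + 1)) skip)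
    skip

/-- Count the offset of the next run of equal offsets. -/
def countSegment : Program :=
  segmentLength ;;
  assign 44 ((cell 1 (reg 40 + reg 41) - cell 0 (reg 41)) * reg 3 + reg 40) ;;
  store 21 (reg 44) (cell 21 (reg 44) + reg 45) ;;
  cond ((reg 43).less (cell 21 (reg 44))) (assign 43 (cell 21 (reg 44))) skip ;;
  assign 41 (reg 41 + reg 45) ;;
  assign 42 (reg 42 + 1)

/-- Compute the distance at the alignment in register `40`. -/
def alignmentDistance : Program :=
  assign 41 0 ;;
  assign 42 0 ;;
  assign 43 0 ;;
  loop ((reg 41).less (reg 0) * (reg 42).less (reg 2 * 2 + 1)) countSegment ;;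
  assign 45 (reg 2 + 1) ;;
  cond ((reg 41).less (reg 0)) skip
    (cond ((reg 0 - reg 43).less (reg 45)) (assign 45 (reg 0 - reg 43)) skip) ;;
  store 2 (reg 40) (reg 45)

@[simp] theorem regs_segmentLength :
    segmentLength.regs = 45 :: 37 :: 38 :: (commonExtension.regs ++ [45]) := rfl
@[simp] theorem arrs_segmentLength : segmentLength.arrs = [] := rfl
@[simp] theorem regs_countSegment :
    countSegment.regs = segmentLength.regs ++ [44, 43, 41, 42] := rfl
@[simp] theorem arrs_countSegment : countSegment.arrs = [21] := rfl
@[simp] theorem regs_alignmentDistance :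
    alignmentDistance.regs = 41 :: 42 :: 43 :: (countSegment.regs ++ [45, 45]) := rfl
@[simp] theorem arrs_alignmentDistance : alignmentDistance.arrs = [21, 2] := rfl

/-- A state that is ready for the computation of distances. -/
structure State.Ready (P T : ℤ → ℤ) (m n k Z : ℤ) (s : State) : Prop where
  h0 : s.reg 0 = m
  h1 : s.reg 1 = n
  h2 : s.reg 2 = k
  h3 : s.reg 3 = Z
  hP : s.arr 0 = P
  hT : s.arr 1 = T
  lcp : ∃ σ, s.HasLcp σ (m + n - 2) ∧
    ∀ x y, 0 ≤ x → x < m + n - 2 → 0 ≤ y → y < m + n - 2 →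
      (σ x = σ y ↔ differences P T n x = differences P T n y)

theorem State.Ready.congr {P T : ℤ → ℤ} {m n k Z : ℤ} {s s' : State}
    (h : s.Ready P T m n k Z) (hr : ∀ x, x ≤ 29 → s'.reg x = s.reg x)
    (ha : ∀ a, a ≤ 20 → a ≠ 2 → s'.arr a = s.arr a) : s'.Ready P T m n k Z := by
  obtain ⟨a, b, c, d, e, f, σ, g, g'⟩ := h
  refine ⟨?_, ?_, ?_, ?_, ?_, ?_, σ, g.congr ?_ ?_ ?_ ?_ ?_ ?_ ?_ ?_ ?_ ?_, g'⟩
  all_goals first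
    | exact hr _ (by norm_num)
    | exact ha _ (by norm_num) (by norm_num)
    | (rw [hr _ (by norm_num)]; assumption)
    | (rw [ha _ (by norm_num) (by norm_num)]; assumption)

section
variable {B : ℤ} {s : State} {τ : ℤ}

/-- At the last position of the pattern no difference is left and `n - 1 + c` would lie outside the
joint string; the run then has length `1` and no query is made. -/
theorem segmentLength_spec {P T : ℤ → ℤ} {m n k Z i c : ℤ} (h : s.Ready P T m n k Z)
    (hm : 1 ≤ m) (hB : 4 * n + 10 ≤ B)
    (h40 : s.reg 40 = i) (hi : 0 ≤ i) (hin : i + m ≤ n) (h41 : s.reg 41 = c) (hc : 0 ≤ c)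
    (hcm : c < m) :
    wp B segmentLength s τ (fun s' τ' => τ' ≤ τ + 400 ∧ 1 ≤ s'.reg 45 ∧ c + s'.reg 45 ≤ m ∧
      (∀ j, c ≤ j → j < c + s'.reg 45 → offset P T i j = offset P T i c) ∧
      (c + s'.reg 45 < m → offset P T i (c + s'.reg 45) ≠ offset P T i (c + s'.reg 45 - 1))) := by
  obtain ⟨σ, hL, hσ⟩ := h.lcp
  simp only [segmentLength, wp_seq, wp_assign, wp_cond, wp_skip]
  simp only [eval_reg, eval_add, eval_sub, eval_less, eval_one, flag_ne_zero, flag_eq_zero,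
    State.reg_setReg, Nat.reduceEqDiff, if_true, if_false, h.h0, h.h1, h40, h41, cost_reg,
    cost_add, cost_sub, cost_less, cost_one]
  push_cast
  refine ⟨by omega, fun hlt => ⟨by omega, by omega, ?_⟩, fun hlt => ?_⟩
  · refine wp_frame_mono (commonExtension_spec (i := i + c) (j := n - 1 + c)
      (hL.congr (by simp) (by simp) (by simp) (by simp) (by simp) (by simp) (by simp) (by simp)
        (by simp) (by simp)) (by omega) (by simp) (by simp) (by omega) (by omega) (by omega)
      (by omega) (by omega)) ?_
    rintro s₁ τ₁ hf₁ ⟨hτ₁, hlcp⟩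
    have e45 : s₁.reg 45 = m - c := by rw [hf₁.1 45 (by simp)]; simp
    have hv0 := hlcp.nonneg
    refine ⟨fun hb => ?_, fun hb => ?_⟩
    · have hlt' := flag_ne_zero.1 hb
      refine ⟨by omega, by omega, by omega, by omega, ?_⟩
      have := IsLcp.segment hσ hi hin hc hlcp le_rfl (by omega)
      exact ⟨this.1, this.2 rfl⟩
    · have hlt' := flag_eq_zero.1 hb
      rw [e45] at hlt' ⊢
      exact ⟨by omega, by omega, by omega,
        (IsLcp.segment hσ hi hin hc hlcp (by omega) (by omega)).1, by omega⟩
  · refine ⟨by omega, by omega, by omega, fun j j0 j1 => ?_, by omega⟩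
    rw [show j = c by omega]

/-- A run changes the counter of a single offset, so comparing this counter with the old maximum
keeps the maximum exact. -/
theorem countSegment_spec {P T : ℤ → ℤ} {m n k Z i c b : ℤ} (h : s.Ready P T m n k Z)
    (hm : 1 ≤ m) (hB : 4 * n + 10 ≤ B)
    (hPT : ∀ x y, -B ≤ (T x - P y) * Z + i ∧ (T x - P y) * Z + i ≤ B)
    (h40 : s.reg 40 = i) (hi : 0 ≤ i) (hin : i + m ≤ n) (hnZ : n < Z) (h41 : s.reg 41 = c)
    (hc : 0 ≤ c) (hcm : c < m) (h43 : s.reg 43 = b) (h42 : 0 ≤ s.reg 42 ∧ s.reg 42 < B)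
    (h21 : ∀ α, s.arr 21 (α * Z + i) = countBelow (fun j => offset P T i j = α) c)
    (hb : ∀ α, countBelow (fun j => offset P T i j = α) c ≤ b)
    (hb' : ∃ α, countBelow (fun j => offset P T i j = α) c = b) :
    wp B countSegment s τ (fun s' τ' => τ' ≤ τ + 500 ∧ c < s'.reg 41 ∧ s'.reg 41 ≤ m ∧
      (s'.reg 41 < m → offset P T i (s'.reg 41) ≠ offset P T i (s'.reg 41 - 1)) ∧
      s'.reg 42 = s.reg 42 + 1 ∧
      (∀ α, s'.arr 21 (α * Z + i) = countBelow (fun j => offset P T i j = α) (s'.reg 41)) ∧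
      (∀ α, countBelow (fun j => offset P T i j = α) (s'.reg 41) ≤ s'.reg 43) ∧
      (∃ α, countBelow (fun j => offset P T i j = α) (s'.reg 41) = s'.reg 43) ∧
      ∀ α i', 0 ≤ i' → i' < Z → i' ≠ i → s'.arr 21 (α * Z + i') = s.arr 21 (α * Z + i')) := by
  simp only [countSegment, wp_seq]
  refine wp_frame_mono (segmentLength_spec h hm hB h40 hi hin h41 hc hcm) ?_
  rintro s₁ τ₁ hf₁ ⟨hτ₁, hL1, hL2, hconst, hne⟩
  obtain ⟨L, hL⟩ : ∃ L, s₁.reg 45 = L := ⟨_, rfl⟩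
  rw [hL] at hL1 hL2 hconst hne
  have e40 := (hf₁.1 40 (by simp)).trans h40
  have e41 := (hf₁.1 41 (by simp)).trans h41
  have e42 := hf₁.1 42 (by simp)
  have e43 := (hf₁.1 43 (by simp)).trans h43
  have e3 := (hf₁.1 3 (by simp)).trans h.h3
  have eP := (hf₁.2 0 (by simp)).trans h.hP
  have eT := (hf₁.2 1 (by simp)).trans h.hT
  have e21 := hf₁.2 21 (by simp)
  have hα := h21 (offset P T i c)
  obtain ⟨β, hβ⟩ : ∃ β, β = offset P T i c := ⟨_, rfl⟩
  have hadd := fun α => countBelow_add_of_const (offset P T i) α hc (by omega : 0 ≤ L) hconst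
  have hle := fun α => (countBelow_le_of_le (fun j => offset P T i j = α) hc
    (show c ≤ c + L by omega)).1
  have hcn := countBelow_le (fun j => offset P T i j = β) (show 0 ≤ c + L by omega)
  have h0n := countBelow_nonneg (fun j => offset P T i j = β) c
  have haddβ := hadd β
  rw [← hβ] at hα hadd haddβ
  rw [if_pos rfl] at haddβ
  have hupd : ∀ α, Function.update (s.arr 21) (β * Z + i) (s.arr 21 (β * Z + i) + L)
      (α * Z + i) = countBelow (fun j => offset P T i j = α) (c + L) := by
    intro α
    rw [hadd]
    by_cases hαβ : α = β
    · rw [hαβ, Function.update_self, if_pos rfl, hα]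
    · rw [Function.update_of_ne, if_neg hαβ, h21, add_zero]
      exact fun he => hαβ (mul_add_inj hi (by omega) hi (by omega) he).1
  have hother : ∀ α i', 0 ≤ i' → i' < Z → i' ≠ i →
      Function.update (s.arr 21) (β * Z + i) (s.arr 21 (β * Z + i) + L) (α * Z + i') =
        s.arr 21 (α * Z + i') := by
    intro α i' i0 i1 hne'
    rw [Function.update_of_ne]
    exact fun he => hne' (mul_add_inj i0 i1 hi (by omega) he).2
  have hmax : ∀ b', b ≤ b' → countBelow (fun j => offset P T i j = β) (c + L) ≤ b' →
      ∀ α, countBelow (fun j => offset P T i j = α) (c + L) ≤ b' := by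
    intro b' h1 h2 α
    by_cases hαβ : α = β
    · rw [hαβ]; exact h2
    · rw [hadd, if_neg hαβ, add_zero]; exact (hb α).trans h1
  have hstart : β = T (i + c) - P c := hβ
  have hPT' := hPT (i + c) c
  rw [← hstart] at hPT'
  simp only [wp_assign, wp_store]
  rw [wp_cond, eval_less, flag_ne_zero, flag_eq_zero]
  simp only [wp_assign, wp_skip]
  simp only [eval_reg, eval_cell, eval_add, eval_sub, eval_mul, eval_one, State.reg_setReg,
    State.arr_setReg, State.reg_setArr, State.arr_setArr, Nat.reduceEqDiff, if_true, if_false,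
    e40, e41, e42, e43, e3, eP, eT, e21, hL, ← hstart, hα, ← haddβ, Function.update_self,
    cost_reg, cost_cell, cost_add, cost_sub, cost_mul, cost_less, cost_one]
  rw [hα, ← haddβ] at hupd hother
  push_cast
  refine ⟨hPT', by omega, fun hlt => ⟨by omega, by omega, by omega, by omega, by omega, hL2, hne,
    trivial, hupd, hmax _ hlt.le le_rfl, ⟨β, rfl⟩, hother⟩, fun hlt => ⟨by omega, by omega,
    by omega, by omega, hL2, hne, trivial, hupd, hmax _ le_rfl (by omega), ?_, hother⟩⟩
  obtain ⟨α, hα'⟩ := hb'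
  have h1 := hle α
  have h2 := hmax b le_rfl (by omega) α
  exact ⟨α, by omega⟩

end

end RAM

/-! ### All alignments -/

namespace RAM

open RAM.Expr RAM.Program

/-- Solve the shift-normalised mismatch problem. -/
def mismatchProgram : Program :=
  preprocess ;; forLoop 40 (reg 1 - reg 0 + 1) alignmentDistance

section
variable {B : ℤ} {s : State} {τ : ℤ}

theorem changes_lt {f : ℤ → ℤ} {c d : ℤ} (hc : 0 ≤ c) (hcd : c < d) (h : f d ≠ f (d - 1)) :
    changes f (c + 1) < changes f (d + 1) := by
  have h1 := (countBelow_le_of_le (fun j => 1 ≤ j ∧ f j ≠ f (j - 1)) (show 0 ≤ c + 1 by omega)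
    (show c + 1 ≤ d by omega)).1
  have h2 := countBelow_succ (fun j => 1 ≤ j ∧ f j ≠ f (j - 1)) (i := d) (by omega)
  rw [if_pos ⟨by omega, h⟩] at h2
  rw [changes, changes]
  omega

/-- Each new run starts at a change, so after `r` runs at least `r` changes lie up to the current
position as long as it is inside the pattern. Stopping early thus means `2 * k + 1` changes and the
answer `k + 1`; otherwise all offsets are counted and the maximum counter gives the distance. -/
theorem alignmentDistance_spec {P T : ℤ → ℤ} {m n k Z i : ℤ} (h : s.Ready P T m n k Z)
    (hm : 1 ≤ m) (hB : 4 * n + 10 ≤ B) (hk : 0 ≤ k) (hkB : 2 * k + 2 ≤ B)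
    (hPT : ∀ x y, -B ≤ (T x - P y) * Z + i ∧ (T x - P y) * Z + i ≤ B)
    (h40 : s.reg 40 = i) (hi : 0 ≤ i) (hin : i + m ≤ n) (hnZ : n < Z)
    (h21 : ∀ α, s.arr 21 (α * Z + i) = 0) :
    wp B alignmentDistance s τ (fun s' τ' => τ' ≤ τ + 1200 * (k + 1) ∧
      IsDistance (offset P T i) m k (s'.arr 2 i) ∧ (∀ p, p ≠ i → s'.arr 2 p = s.arr 2 p) ∧
      ∀ α i', 0 ≤ i' → i' < Z → i' ≠ i → s'.arr 21 (α * Z + i') = s.arr 21 (α * Z + i')) := by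
  obtain ⟨f, hf⟩ : ∃ f, f = offset P T i := ⟨_, rfl⟩
  simp only [alignmentDistance, wp_seq, wp_assign]
  refine ⟨by simp; omega, by simp; omega, by simp; omega, ?_⟩
  refine wp_loop (fun s' τ' => τ' ≤ τ + 10 + 520 * s'.reg 42 ∧
    (0 ≤ s'.reg 42 ∧ s'.reg 42 ≤ 2 * k + 1) ∧ (0 ≤ s'.reg 41 ∧ s'.reg 41 ≤ m) ∧
    (s'.reg 41 < m → s'.reg 42 ≤ changes f (s'.reg 41 + 1)) ∧
    (∀ α, s'.arr 21 (α * Z + i) = countBelow (fun j => f j = α) (s'.reg 41)) ∧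
    (∀ α, countBelow (fun j => f j = α) (s'.reg 41) ≤ s'.reg 43) ∧
    (∃ α, countBelow (fun j => f j = α) (s'.reg 41) = s'.reg 43) ∧
    ∀ α i', 0 ≤ i' → i' < Z → i' ≠ i → s'.arr 21 (α * Z + i') = s.arr 21 (α * Z + i'))
    (τ + 10 + 520 * (2 * k + 1)) ?_ ?_ ?_ ?_
  · simp only [State.reg_setReg, State.arr_setReg, Nat.reduceEqDiff, if_true, if_false, eval_zero,
      cost_zero, countBelow_zero]
    push_cast
    exact ⟨by omega, ⟨trivial, by omega⟩, ⟨trivial, by omega⟩, fun _ => countBelow_nonneg _ _,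
      h21, fun _ => trivial, ⟨0, trivial⟩, fun _ _ _ _ _ => trivial⟩
  · rintro s' τ' ⟨hτ, hs, -⟩
    omega
  · rintro s' τ' hfr ⟨hτ, hs, hc, hch, hcnt, hb, hb', hoth⟩ htest
    have hR : s'.Ready P T m n k Z := h.congr
      (fun x hx => by rw [hfr.1 x (by simp; omega)]; simp; omega)
      (fun a ha ha2 => by rw [hfr.2 a (by simp; omega)]; simp)
    have e40 : s'.reg 40 = i := by rw [hfr.1 40 (by simp)]; simp [h40]
    rw [eval_mul, eval_less, eval_less] at htest
    have t1 := flag_ne_zero.1 (left_ne_zero_of_mul htest)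
    have t2 := flag_ne_zero.1 (right_ne_zero_of_mul htest)
    simp only [eval_reg, eval_add, eval_mul, eval_ofNat, eval_one, hR.h0, hR.h2] at t1 t2
    rw [hf] at hcnt hb hb' hch
    refine wp_frame_mono (countSegment_spec hR hm hB hPT e40 hi hin hnZ rfl hc.1 t1 rfl
      ⟨hs.1, by omega⟩ hcnt hb hb') ?_
    rintro s₁ τ₁ hf₁ ⟨hτ₁, c1, c2, hne, e42, hcnt', hb₁, hb₁', hoth'⟩
    simp only [cost_mul, cost_less, cost_reg, cost_add, cost_ofNat, cost_one] at hτ₁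
    push_cast at hτ₁
    rw [hf]
    refine ⟨by omega, by omega, by omega, fun hlt => ?_, hcnt', hb₁, hb₁',
      fun α i' i0 i1 hi' => by rw [hoth' α i' i0 i1 hi', hoth α i' i0 i1 hi']⟩
    have := changes_lt hc.1 c1 (hne hlt)
    have := hch t1
    omega
  · rintro s' τ' hfr ⟨hτ, hs, hc, hch, hcnt, hb, hb', hoth⟩ htest
    have hR : s'.Ready P T m n k Z := h.congr
      (fun x hx => by rw [hfr.1 x (by simp; omega)]; simp; omega)
      (fun a ha ha2 => by rw [hfr.2 a (by simp; omega)]; simp)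
    have e40 : s'.reg 40 = i := by rw [hfr.1 40 (by simp)]; simp [h40]
    have e2 : s'.arr 2 = s.arr 2 := by rw [hfr.2 2 (by simp)]; simp
    rw [eval_mul, eval_less, eval_less] at htest
    have htest' : s'.reg 41 < m → s'.reg 42 = 2 * k + 1 := by
      intro h1
      rcases mul_eq_zero.1 htest with h2 | h2
      · have := flag_eq_zero.1 h2
        simp only [eval_reg, hR.h0] at this
        omega
      · have := flag_eq_zero.1 h2
        simp only [eval_reg, eval_add, eval_mul, eval_ofNat, eval_one, hR.h2] at this
        omega
    have hb0 : 0 ≤ s'.reg 43 ∧ s'.reg 43 ≤ m := by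
      obtain ⟨α, hα⟩ := hb'
      have h1 := countBelow_le (fun j => f j = α) hc.1
      have h2 := countBelow_nonneg (fun j => f j = α) (s'.reg 41)
      omega
    have fin : ∀ (s₁ : State) τ₁, s₁.arr = s'.arr → s₁.reg 40 = i →
        IsDistance f m k (s₁.reg 45) → (-B ≤ s₁.reg 45 ∧ s₁.reg 45 ≤ B) → τ₁ ≤ τ' + 50 →
        wp B (store 2 (reg 40) (reg 45)) s₁ τ₁ (fun s' τ' => τ' ≤ τ + 1200 * (k + 1) ∧
          IsDistance (offset P T i) m k (s'.arr 2 i) ∧ (∀ p, p ≠ i → s'.arr 2 p = s.arr 2 p) ∧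
          ∀ α i', 0 ≤ i' → i' < Z → i' ≠ i →
            s'.arr 21 (α * Z + i') = s.arr 21 (α * Z + i')) := by
      intro s₁ τ₁ ha h40' hd hbd hτ₁
      rw [wp_store]
      simp only [eval_reg, State.arr_setArr, Nat.reduceEqDiff, if_true, if_false, h40', ha, e2,
        Function.update_self, cost_reg]
      push_cast
      rw [← hf]
      exact ⟨hbd, by omega, hd, fun p hp => Function.update_of_ne hp _ _, hoth⟩
    rw [wp_cond, eval_less, flag_ne_zero, flag_eq_zero, wp_cond, eval_less, flag_ne_zero,
      flag_eq_zero]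
    simp only [wp_assign, wp_skip]
    simp only [eval_reg, eval_add, eval_sub, eval_one, State.reg_setReg, Nat.reduceEqDiff,
      if_true, if_false, hR.h0, hR.h2, cost_mul, cost_less, cost_reg, cost_add, cost_ofNat,
      cost_one, cost_sub]
    push_cast
    refine ⟨by omega, fun hlt => ?_, fun hge => ⟨fun hlt => ⟨by omega, ?_⟩, fun hge' => ?_⟩⟩
    · refine fin _ _ rfl (by simp [e40]) ?_ (by simp; omega) (by omega)
      simp only [State.reg_setReg, if_true]
      have := hch hlt
      exact isDistance_of_changes hc.1 hlt (by rw [← htest' hlt]; exact this)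
    · refine fin _ _ rfl (by simp [e40]) ?_ (by simp; omega) (by omega)
      have e41 : s'.reg 41 = m := by omega
      rw [e41] at hb hb'
      have := isDistance_of_max (k := k) hb hb'
      rw [min_eq_left (by omega)] at this
      simpa using this
    · refine fin _ _ rfl (by simp [e40]) ?_ (by simp; omega) (by omega)
      have e41 : s'.reg 41 = m := by omega
      rw [e41] at hb hb'
      have := isDistance_of_max (k := k) hb hb'
      rw [min_eq_right (by omega)] at this
      simpa using this

/-- An alignment touches only counters with its own remainder modulo `2 * n + 10`, so later
alignments still find zeros. Each takes `O(k + 1)` steps, on top of linear preprocessing. -/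
theorem mismatchProgram_spec {P T : ℤ → ℤ} {m n k : ℤ} (hm : 1 ≤ m) (hmn : m ≤ n) (hk : 0 ≤ k)
    (h0 : s.reg 0 = m) (h1 : s.reg 1 = n) (h2 : s.reg 2 = k) (hP : s.arr 0 = P)
    (hT : s.arr 1 = T) (hz : ∀ a, 2 ≤ a → ∀ p, s.arr a p = 0)
    (hB : (2 * n + 10) * (2 * n + 10) * (2 * n + 10) ≤ B) (hkB : 2 * k + 2 ≤ B)
    (hdB : ∀ i, -B ≤ differences P T n i ∧ differences P T n i ≤ B)
    (hPT : ∀ x y i, 0 ≤ i → i ≤ n → -B ≤ (T x - P y) * (2 * n + 10) + i ∧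
      (T x - P y) * (2 * n + 10) + i ≤ B) :
    wp B mismatchProgram s τ (fun s' τ' => τ' ≤ τ + 100000 * (n * (k + 1)) ∧
      ∀ i, 0 ≤ i → i + m ≤ n → IsDistance (offset P T i) m k (s'.arr 2 i)) := by
  have hB' : 6 * (2 * n + 10) ≤ B := by nlinarith
  rw [mismatchProgram, wp_seq]
  refine wp_frame_mono (preprocess_spec hm hmn h0 h1 hP hT hz hB hdB) ?_
  rintro s₁ τ₁ hf₁ ⟨hτ₁, e3, hlcp⟩
  have hR : s₁.Ready P T m n k (2 * n + 10) := ⟨(hf₁.1 0 (by simp)).trans h0,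
    (hf₁.1 1 (by simp)).trans h1, (hf₁.1 2 (by simp)).trans h2, e3, (hf₁.2 0 (by simp)).trans hP,
    (hf₁.2 1 (by simp)).trans hT, hlcp⟩
  have hn := mul_nonneg (show 0 ≤ n by omega) hk
  have hn' : n * (k + 1) = n * k + n := by ring
  refine wp_for (n - m + 1) (fun i s' τ' => τ' ≤ τ₁ + 2 + i * (1200 * (k + 1) + 20) ∧
    (∀ j, 0 ≤ j → j < i → IsDistance (offset P T j) m k (s'.arr 2 j)) ∧
    ∀ α j, i ≤ j → j < 2 * n + 10 → s'.arr 21 (α * (2 * n + 10) + j) = 0) (by omega) (by omega)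
    (by simp) ?_ ?_ ?_ ?_
  · intro s' hf
    simp only [eval_add, eval_sub, eval_reg, eval_one]
    rw [hf.1 1 (by simp [forLoop, Program.regs]), hf.1 0 (by simp [forLoop, Program.regs]), hR.h0,
      hR.h1]
  · refine ⟨by omega, fun j _ _ => by omega, fun α j _ _ => ?_⟩
    rw [State.arr_setReg, hf₁.2 21 (by simp), hz 21 (by norm_num)]
  · rintro i s' τ' hi0 hin hxi hf ⟨hτ, hI, hzero⟩
    refine wp_frame_mono (alignmentDistance_spec (i := i) (hR.congr
      (fun x hx => hf.1 x (by simp [forLoop, Program.regs]; omega))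
      (fun a ha ha2 => hf.2 a (by simp [forLoop, Program.arrs]; omega))) hm (by omega) hk hkB
      (fun x y => hPT x y i hi0 (by omega)) hxi hi0 (by omega) (by omega)
      (fun α => hzero α i le_rfl (by omega))) ?_
    rintro s₂ τ₂ - ⟨hτ₂, hd, hold, hoth⟩
    simp only [cost_add, cost_sub, cost_reg, cost_one] at hτ₂
    push_cast at hτ₂
    have hmul : (i + 1) * (1200 * (k + 1) + 20) =
      i * (1200 * (k + 1) + 20) + (1200 * (k + 1) + 20) := by ring
    refine ⟨by omega, fun j j0 j1 => ?_, fun α j j0 j1 => ?_⟩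
    · rcases eq_or_lt_of_le (show j ≤ i by omega) with h | h
      · rw [h]; exact hd
      · rw [State.arr_setReg, hold j h.ne]; exact hI j j0 h
    · rw [State.arr_setReg, hoth α j (by omega) j1 (by omega)]
      exact hzero α j (by omega) j1
  · rintro s' τ' hx hf ⟨hτ, hI, -⟩
    simp only [cost_add, cost_sub, cost_reg, cost_one]
    have hmul : (n - m + 1) * (1200 * (k + 1) + 20) ≤ n * (1200 * (k + 1) + 20) :=
      mul_le_mul_of_nonneg_right (by omega) (by omega)
    have hmul' : n * (1200 * (k + 1) + 20) = 1200 * (n * k) + 1220 * n := by ring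
    exact ⟨by push_cast; omega, fun i i0 i1 => hI i i0 (by omega)⟩

end

end RAM

/-! ### The main theorem -/

namespace RAM

/-- The largest absolute value of a constant in an expression. -/
def Expr.maxConst : Expr → ℕ
  | .const c => c.natAbs
  | .reg _ => 0
  | .cell _ p => p.maxConst
  | .op _ e₁ e₂ => max e₁.maxConst e₂.maxConst

/-- The largest absolute value of a constant in a program. -/
def Program.maxConst : Program → ℕ
  | .skip => 0
  | .assign _ e => e.maxConst
  | .store _ p e => max p.maxConst e.maxConst
  | .seq c₁ c₂ => max c₁.maxConst c₂.maxConst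
  | .cond b c₁ c₂ => max b.maxConst (max c₁.maxConst c₂.maxConst)
  | .loop b c => max b.maxConst c.maxConst

theorem Expr.constLe {B : ℤ} (e : Expr) (h : (e.maxConst : ℤ) ≤ B) : e.ConstLe B := by
  induction e with
  | const c => simpa [Expr.ConstLe, Expr.maxConst] using h
  | reg x => trivial
  | cell a p ih => exact ih h
  | op o e₁ e₂ ih₁ ih₂ =>
    simp only [Expr.maxConst, Nat.cast_max, max_le_iff] at h
    exact ⟨ih₁ h.1, ih₂ h.2⟩

theorem Program.constLe {B : ℤ} (c : Program) (h : (c.maxConst : ℤ) ≤ B) : c.ConstLe B := by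
  induction c with
  | skip => trivial
  | assign x e => exact e.constLe h
  | store a p e =>
    simp only [Program.maxConst, Nat.cast_max, max_le_iff] at h
    exact ⟨p.constLe h.1, e.constLe h.2⟩
  | seq c₁ c₂ ih₁ ih₂ =>
    simp only [Program.maxConst, Nat.cast_max, max_le_iff] at h
    exact ⟨ih₁ h.1, ih₂ h.2⟩
  | cond b c₁ c₂ ih₁ ih₂ =>
    simp only [Program.maxConst, Nat.cast_max, max_le_iff] at h
    exact ⟨b.constLe h.1, ih₁ h.2.1, ih₂ h.2.2⟩
  | loop b c ih =>
    simp only [Program.maxConst, Nat.cast_max, max_le_iff] at h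
    exact ⟨b.constLe h.1, ih h.2⟩

theorem width_mismatchProgram : mismatchProgram.width = 53 := rfl

theorem maxConst_mismatchProgram : mismatchProgram.maxConst ≤ 100 :=
  Nat.le_of_ble_eq_true rfl

theorem abs_ofString_le {S : List ℤ} {U : ℕ} (h : ∀ x ∈ S, |x| ≤ (U : ℤ)) (p : ℤ) :
    |ofString S p| ≤ (U : ℤ) := by
  unfold ofString
  split_ifs
  · rw [List.getD_eq_getElem?_getD]
    cases hx : S[p.toNat]? with
    | none => simp
    | some x => simpa using h x (List.mem_of_getElem? hx)
  · simp

end RAM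

theorem card_filter_not_range (p : ℤ → Prop) [∀ j : ℕ, Decidable (¬ p j)] (x : ℕ) :
    (((Finset.range x).filter fun j : ℕ => ¬ p j).card : ℤ) = x - countBelow p x := by
  classical
  induction x with
  | zero => simp [countBelow_zero]
  | succ x ih =>
    rw [Finset.range_add_one, Finset.filter_insert, Nat.cast_succ, countBelow_succ _ (by omega)]
    by_cases hp : p x
    · rw [if_neg (by simpa using hp), if_pos hp]; omega
    · rw [if_pos hp, if_neg hp, Finset.card_insert_of_notMem (by simp)]; push_cast; omega

/-- Offsets are integers, so a rational shift matches no more positions than its integer part does: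
if it matches anything it is an integer, and otherwise there is nothing to compare. Thus integer
constants suffice. -/
theorem IsDistance.eq_shiftMismatch {P T : List ℤ} {k i : ℕ} {v : ℤ}
    (h : IsDistance (offset (RAM.ofString P) (RAM.ofString T) i) P.length k v) :
    v = shiftMismatch k P T i := by
  have hcard : ∀ α : ℚ, (((Finset.range P.length).filter
      (fun j => α + (P.getD j 0 : ℚ) ≠ (T.getD (i + j) 0 : ℚ))).card : ℤ) = P.length -
        countBelow (fun j => α + (RAM.ofString P j : ℚ) = (RAM.ofString T (i + j) : ℚ))
          P.length := by
    intro α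
    rw [← card_filter_not_range]
    congr 2
  have hcast : ∀ (a j : ℤ), (a : ℚ) + (RAM.ofString P j : ℚ) = (RAM.ofString T (i + j) : ℚ) ↔
      offset (RAM.ofString P) (RAM.ofString T) i j = a := by
    intro a j
    rw [offset]
    norm_cast
    omega
  have hle : ∀ α : ℚ, v ≤ (((Finset.range P.length).filter
      (fun j => α + (P.getD j 0 : ℚ) ≠ (T.getD (i + j) 0 : ℚ))).card : ℤ) := by
    intro α
    rw [hcard]
    refine (h.le_sub ⌊α⌋).trans (sub_le_sub_left (countBelow_mono fun j _ _ hj => ?_) _)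
    have : α = ((offset (RAM.ofString P) (RAM.ofString T) i j : ℤ) : ℚ) := by
      rw [offset]; push_cast; linarith
    rw [this, Int.floor_intCast]
  have hham : v ≤ (shiftHam P T i : ℤ) := by
    obtain ⟨α, hα⟩ := ciInf_mem (fun α : ℚ => ((Finset.range P.length).filter
      (fun j => α + (P.getD j 0 : ℚ) ≠ (T.getD (i + j) 0 : ℚ))).card)
    have := hle α
    rw [shiftHam, ← hα]
    exact this
  have h1 := h.le
  rw [shiftMismatch]
  push_cast
  rcases h.attained with h2 | ⟨a, ha⟩
  · omega
  · have h3 : shiftHam P T i ≤ _ := ciInf_le (OrderBot.bddBelow _) (a : ℚ)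
    have h4 := hcard a
    simp only [hcast, ← ha] at h4
    omega

/-- There is one deterministic RAM program that, for all `P`, `T`, `k` with `1 ≤ m ≤ n`, writes
`min(d(i), k + 1)` into cell `i` of array `2` for every alignment `i`, within
`C · n · max(1, k log₂ k)` steps, on words of `O(log (n + k + U))` bits, where `U` bounds the
absolute values of the input characters. -/
theorem mainTheorem8 :
    ∃ (prog : RAM.Program) (C : ℕ), ∀ (P T : List ℤ) (k U : ℕ),
      1 ≤ P.length → P.length ≤ T.length →
      (∀ x ∈ P, |x| ≤ (U : ℤ)) → (∀ x ∈ T, |x| ≤ (U : ℤ)) →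
      ∃ (t : ℕ) (s : RAM.State),
        RAM.Runs ((T.length + k + U + 2) ^ C) prog (RAM.initial P T k) t s ∧
        (∀ i : ℕ, i + P.length ≤ T.length →
          s.arr 2 (i : ℤ) = (shiftMismatch k P T i : ℤ)) ∧
        (t : ℝ) ≤ (C : ℝ) * (T.length : ℝ) * max 1 ((k : ℝ) * Real.logb 2 (k : ℝ)) := by
  -- One constant has two roles. As a time factor it is twice the `100000` of the specification; as
  -- an exponent it merely has to exceed `10 * 53`.
  refine ⟨RAM.mismatchProgram, 200000, fun P T k U hm hmn hP hT => ?_⟩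
  obtain ⟨n, hn⟩ : ∃ n : ℕ, n = T.length := ⟨_, rfl⟩
  obtain ⟨X, hX⟩ : ∃ X : ℕ, X = n + k + U + 2 := ⟨_, rfl⟩
  rw [← hn] at hmn ⊢
  rw [← hX]
  have hX3 : (3 : ℤ) ≤ X := by omega
  have hX2 : (9 : ℤ) ≤ X ^ 2 := by nlinarith
  have hX9 : (3 : ℤ) ^ 9 ≤ X ^ 9 := pow_le_pow_left₀ (by norm_num) hX3 9
  have hB4 : (9 : ℤ) * X * X ≤ X ^ 10 := by
    calc (9 : ℤ) * X * X = 9 * X ^ 2 := by ring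
      _ ≤ X ^ 2 * X ^ 2 := mul_le_mul_of_nonneg_right hX2 (by positivity)
      _ = X ^ 4 := by ring
      _ ≤ X ^ 10 := pow_le_pow_right₀ (by omega) (by norm_num)
  -- Triple codes need the cube of the level distance `2 * n + 10`. As `X ≥ 3`, constants are
  -- absorbed into powers: `2 * n + 10 ≤ 9 * X ≤ X ^ 3`.
  have hB9 : ((2 : ℤ) * n + 10) * (2 * n + 10) * (2 * n + 10) ≤ X ^ 10 := by
    have h1 : (2 : ℤ) * n + 10 ≤ X ^ 3 := by
      have : 9 * (X : ℤ) ≤ X ^ 2 * X := mul_le_mul_of_nonneg_right hX2 (by omega)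
      rw [pow_succ]
      omega
    calc ((2 : ℤ) * n + 10) * (2 * n + 10) * (2 * n + 10) = (2 * n + 10) ^ 3 := by ring
      _ ≤ ((X : ℤ) ^ 3) ^ 3 := pow_le_pow_left₀ (by omega) h1 3
      _ = X ^ 9 := by ring
      _ ≤ X ^ 10 := pow_le_pow_right₀ (by omega) (by norm_num)
  have hB1 : 100 * (X : ℤ) ≤ X ^ 10 := by rw [pow_succ]; nlinarith
  have hPU := RAM.abs_ofString_le hP
  have hTU := RAM.abs_ofString_le hT
  have hoff : ∀ x y, -(2 * (U : ℤ)) ≤ RAM.ofString T x - RAM.ofString P y ∧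
      RAM.ofString T x - RAM.ofString P y ≤ 2 * U := fun x y => by
    have h1 := abs_le.1 (hTU x)
    have h2 := abs_le.1 (hPU y)
    omega
  have hspec := RAM.mismatchProgram_spec (B := (X : ℤ) ^ 10) (s := RAM.initial P T k) (τ := 0)
    (P := RAM.ofString P) (T := RAM.ofString T) (m := P.length) (n := n) (k := k) (by omega) (by omega)
    (by omega) (by simp [RAM.initial]) (by simp [RAM.initial, hn]) (by simp [RAM.initial]) (by simp [RAM.initial])
    (by simp [RAM.initial])
    (fun a ha p => by simp only [RAM.initial]; rw [if_neg (by omega), if_neg (by omega)])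
    hB9 (by omega) (fun i => by
      have h1 := abs_le.1 (hTU (i + 1))
      have h2 := abs_le.1 (hTU i)
      have h3 := abs_le.1 (hPU (i - n + 2))
      have h4 := abs_le.1 (hPU (i - n + 1))
      unfold differences
      split_ifs <;> constructor <;> omega)
    (fun x y i i0 i1 => by
      have h1 := hoff x y
      have h2 : |(RAM.ofString T x - RAM.ofString P y) * (2 * (n : ℤ) + 10)| ≤ (2 * X) * (4 * X) := by
        rw [abs_mul]
        refine mul_le_mul (abs_le.2 ⟨by omega, by omega⟩) (abs_le.2 ⟨by omega, by omega⟩)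
          (abs_nonneg _) (by omega)
      have h3 := abs_le.1 h2
      have h4 : (X : ℤ) ≤ X * X := by nlinarith
      constructor <;> nlinarith)
  obtain ⟨t, s, hexec, htime, hout⟩ := hspec
  have hbd : (RAM.initial P T k).Bounded ((X : ℤ) ^ 10) := by
    refine ⟨fun x => ?_, fun a p => ?_⟩
    · simp only [RAM.initial]
      rw [abs_le]
      split_ifs <;> constructor <;> omega
    · simp only [RAM.initial]
      split_ifs
      · exact (hPU p).trans (by omega)
      · exact (hTU p).trans (by omega)
      · simp
  -- Stored values are bounded by `X ^ 10`, and no expression costs more than `53`, so everything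
  -- stays below `X ^ 530`.
  have hrun := hexec.runs (by omega) (W := X ^ 200000) (E := 53) (by
      push_cast
      rw [← pow_mul]
      exact pow_le_pow_right₀ (by omega) (by norm_num)) hbd
    (RAM.Program.constLe _ (by have := RAM.maxConst_mismatchProgram; omega)) RAM.width_mismatchProgram.le
  refine ⟨t, s, hrun.1, fun i hi => ?_, ?_⟩
  · exact (hout i (by omega) (by omega)).eq_shiftMismatch
  · have ht : (t : ℝ) ≤ 100000 * (n * (k + 1)) := by
      rw [zero_add, zero_add] at htime
      exact_mod_cast htime
    -- For `k ≤ 1` the maximum is at least `1`; for `k ≥ 2` the logarithm is at least `1`, so `k log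
    -- k ≥ k`.
    have hk : (k : ℝ) + 1 ≤ 2 * max 1 (k * Real.logb 2 k) := by
      rcases Nat.lt_or_ge k 2 with h | h
      · have : (k : ℝ) ≤ 1 := by exact_mod_cast (by omega : k ≤ 1)
        have := le_max_left 1 ((k : ℝ) * Real.logb 2 k)
        linarith
      · have h2 : (2 : ℝ) ≤ k := by exact_mod_cast h
        have h3 : 1 ≤ Real.logb 2 k := by
          rw [Real.le_logb_iff_rpow_le (by norm_num) (by linarith)]
          simpa using h2
        have h4 : (k : ℝ) ≤ k * Real.logb 2 k := by nlinarith
        have := le_max_right 1 ((k : ℝ) * Real.logb 2 k)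
        linarith
    have hn0 : (0 : ℝ) ≤ n := by positivity
    have := mul_le_mul_of_nonneg_left hk hn0
    push_cast
    linarith
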